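/- **Setting.** Let $\kappa$ be the security parameter and consider the (2,2)-threshold Paillier cryptosystem: $p,q$ are random $2\kappa$-bit odd primes, $p',q'$ random odd integers of $\frac{n(\kappa)-4\kappa}{2}-1$ bits (rounded down), conditioned on $p,q,p',q'$ being pairwise coprime and $P=2pp'+1$, $Q=2qq'+1$ being prime; $N=PQ$, $\alpha=pq$, $\beta=\frac{(P-1)(Q-1)}{4pq}$, $h=-y^{2\beta}\bmod N$ for random $y\in\mathbb Z_N^*$; the public key is $(N,h)$, the private key is $\alpha$, and the threshold keys are $sk_1\in\{0,1\}^{\sigma}$ random and $sk_2=((2\alpha)^{-1}\bmod N)\cdot 2\alpha-sk_1+\eta\cdot 2\alpha N$ with any $\eta\in\mathbb Z$. $\mathrm{Enc}(m)=(1+N)^m(h^\rho\bmod N)^N\bmod N^2$ with $\rho$ random in $\{0,1\}^{4\kappa}$ (negative $m$ are taken modulo $N$), $\llbracket m\rrbracket$ denotes a ciphertext of $m$, i.e. an element of this form with any exponent $\rho\ge 0$, partial decryption with $sk_j$ is $c\mapsto c^{sk_j}\bmod N^2$, threshold decryption of $(M_1,M_2)$ is $\frac{(M_1M_2\bmod N^2)-1}{N}\bmod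 N$, and decryption with $\alpha$ is $\left(\frac{(c^{2\alpha}\bmod N^2)-1}{N}\bmod N\right)(2\alpha)^{-1}\bmod N$. Let $|\cdot|$ denote bit length, let $\ell<\sigma$ and $L\ge 2^{\sigma+2}$ be functions of $\kappa$, with $2^{\ell-\sigma}$ negligible and $n$ polynomially bounded. **Protocol BatchSquare.** $S_1$ holds $sk_1$ and $\llbracket x_1\rrbracket,\dots,\llbracket x_s\rrbracket$, where $-2^\ell\le x_i\le 2^\ell$; $S_2$ holds $sk_2$; both know $(N,h)$, $L$ and an integer $0\le\delta\le 2^\ell$ with $x_i+\delta\ge 0$ for all $i$ (for instance $\delta=\max(0,-\min_i x_i)$). (1) $S_1$ chooses $r_i\in\{0,1\}^\sigma$ at random and sends $\llbracket C\rrbracket=\prod_{i=1}^s(\llbracket x_i\rrbracket\llbracket\delta\rrbracket\llbracket r_i\rrbracket)^{L^{i-1}}$ and its partial decryption $\llbracket C_1\rrbracket=\llbracket C\rrbracket^{sk_1}$ to $S_2$. (2) $S_2$ obtains $C$ by threshold decryption, unpacks $u_i=\lfloor (C\bmod L^i)/L^{i-1}\rfloor-\delta$, and returns the encryptions $\llbracket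 u_i^2\rrbracket$. (3) $S_1$ outputs $\llbracket u_i^2\rrbracket\cdot(\llbracket x_i\rrbracket\llbracket\delta\rrbracket)^{-2r_i}\cdot\llbracket -r_i^2\rrbracket\cdot\llbracket 2\delta r_i\rrbracket$ for $i=1,\dots,s$. Here $\llbracket\delta\rrbracket$ (encrypted once), $\llbracket r_i\rrbracket$, $\llbracket -r_i^2\rrbracket$, $\llbracket 2\delta r_i\rrbracket$ are encryptions computed by $S_1$. **Statement.** For every number of values $s\le\lfloor |N|/|L|\rfloor$, BatchSquare securely computes $\llbracket x_1^2\rrbracket,\dots,\llbracket x_s^2\rrbracket$ against non-colluding semi-honest servers, that is: 1. (Correctness.) For all keys, all such $x_i$ and $\delta$, all ciphertexts $\llbracket x_i\rrbracket$ and all random choices, $S_2$ unpacks exactly $u_i=x_i+r_i$, and the $i$-th output of $S_1$ is a ciphertext of $x_i^2$; both the private key and the two threshold keys decrypt it to $x_i^2\bmod N$. 2. (Privacy against $S_1$.) If the cryptosystem is semantically secure (no polynomial-time algorithm that is given the public key distinguishes encryptions of two messages of polynomial length), there is a polynomial-time simulator that, given only $(N,h)$, $sk_1$ and $\delta$, outputs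 a view that is computationally indistinguishable from the view of $S_1$ (input ciphertexts, random choices, received messages) in a real execution on fresh encryptions of $x_1,\dots,x_s$, for all choices of $x_i$ and $\delta$ as above. 3. (Privacy against $S_2$.) There is a polynomial-time simulator that, given only $(N,h)$, $sk_2$ and $\delta$, outputs a view that is computationally indistinguishable from the view of $S_2$ (random choices, received messages) in such an execution, for all choices of $x_i$ and $\delta$ as above. Here polynomial time means non-uniform probabilistic polynomial time (for each $\kappa$ one program with hard-wired constants), $n,\sigma,\ell,L$ and $s$ are fixed functions of $\kappa$, and indistinguishability means that for all families $(x_i)$, $\delta$ indexed by $\kappa$ every such distinguisher has negligible advantage in $\kappa$. The probabilities include the generation of the keys, and keys with $s>\lfloor |N|/|L|\rfloor$, for which the protocol is not executed, contribute nothing. -/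

import Mathlib

open scoped BigOperators

namespace BatchSquare

/-! ## Asymptotics -/

/-- `f` is bounded by a polynomial in the security parameter. -/
def PolyBounded (f : ℕ → ℕ) : Prop :=
  ∃ c : ℕ, ∀ κ, f κ ≤ (κ + c) ^ c

/-- `f` is negligible: `κ ^ c * f κ → 0` for every `c`. -/
def Negligible (f : ℕ → ℝ) : Prop :=
  Asymptotics.SuperpolynomialDecay Filter.atTop (fun κ : ℕ => (κ : ℝ)) f

/-! ## Probabilistic polynomial time

Non-uniform probabilistic polynomial time: for every value of the security parameter a
straight-line program of a register machine over the natural numbers, with random bits as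
additional inputs and with the logarithmic (bit length) cost measure.  Each instruction is a
polynomial-time operation on binary numbers and Boolean gates are special cases of them, so the
functions computed with polynomial cost are those of polynomial-size Boolean circuit families. -/

/-- Instructions; the first argument is the destination register.  Subtraction is truncated,
`x / 0 = 0` and `x % 0 = x`. -/
inductive Instr where
  | const (d c : ℕ)
  | add (d a b : ℕ)
  | sub (d a b : ℕ)
  | mul (d a b : ℕ)
  | div (d a b : ℕ)
  | mod (d a b : ℕ)

/-- Contents of the registers. -/
abbrev State := ℕ → ℕ

/-- Effect of one instruction. -/
def Instr.exec (μ : State) : Instr → State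
  | .const d c => Function.update μ d c
  | .add d a b => Function.update μ d (μ a + μ b)
  | .sub d a b => Function.update μ d (μ a - μ b)
  | .mul d a b => Function.update μ d (μ a * μ b)
  | .div d a b => Function.update μ d (μ a / μ b)
  | .mod d a b => Function.update μ d (μ a % μ b)

/-- Logarithmic cost of one instruction: one plus the bit lengths of operands and result. -/
def Instr.cost (μ : State) : Instr → ℕ
  | .const _ c => 1 + c.size
  | .add _ a b => 1 + (μ a).size + (μ b).size + (μ a + μ b).size
  | .sub _ a b => 1 + (μ a).size + (μ b).size + (μ a - μ b).size
  | .mul _ a b => 1 + (μ a).size + (μ b).size + (μ a * μ b).size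
  | .div _ a b => 1 + (μ a).size + (μ b).size + (μ a / μ b).size
  | .mod _ a b => 1 + (μ a).size + (μ b).size + (μ a % μ b).size

/-- Final state of a straight-line program. -/
def execCode : List Instr → State → State
  | [], μ => μ
  | I :: code, μ => execCode code (I.exec μ)

/-- Total cost of a straight-line program. -/
def codeCost : List Instr → State → ℕ
  | [], _ => 0
  | I :: code, μ => I.cost μ + codeCost code (I.exec μ)

/-- Length of the binary encoding of a list of numbers. -/
def listSize (w : List ℕ) : ℕ := (w.map fun a => a.size + 1).sum

/-- A probabilistic program: the number of random bits, the code, and the output registers. -/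
structure Prog where
  coins : ℕ
  code : List Instr
  out : List ℕ

/-- Initial state: the input, followed by the random bits; all other registers are `0`. -/
def Prog.init (P : Prog) (w : List ℕ) (ω : Fin P.coins → Bool) : State :=
  fun i => (w ++ List.ofFn fun j => (ω j).toNat).getD i 0

/-- Output of the program on input `w` with random bits `ω`. -/
def Prog.run (P : Prog) (w : List ℕ) (ω : Fin P.coins → Bool) : List ℕ :=
  P.out.map (execCode P.code (P.init w ω))

/-- Cost of the program on input `w` with random bits `ω`: the random bits, the instructions
and the written output. -/
def Prog.cost (P : Prog) (w : List ℕ) (ω : Fin P.coins → Bool) : ℕ :=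
  P.coins + codeCost P.code (P.init w ω) + listSize (P.run w ω)

/-- A non-uniform probabilistic polynomial-time algorithm: the cost is polynomial in the security
parameter and the length of the input, for all inputs and all random bits. -/
def IsPPT (A : ℕ → Prog) : Prop :=
  ∃ c : ℕ, ∀ (κ : ℕ) (w : List ℕ) (ω : Fin (A κ).coins → Bool),
    (A κ).cost w ω ≤ (κ + listSize w + c) ^ c

/-- Probability that the program, used as a distinguisher, answers `1` on input `w`. -/
noncomputable def Prog.acceptProb (P : Prog) (w : List ℕ) : ℝ :=
  𝔼 ω : Fin P.coins → Bool, if (P.run w ω).head? = some 1 then (1 : ℝ) else 0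

/-! ## The (2,2)-threshold Paillier cryptosystem -/

/-- The quadruples `(p, q, p', q')` that the generation of the modulus can accept; as the generation
is by rejection, its outcome is uniform on this set.  Here `p, q` are odd primes of
`l(κ) / 2 = 2 κ` bits, `p', q'` are odd integers of `(n - l(κ)) / 2 - 1` bits, all four are
pairwise coprime, and `2 p p' + 1` and `2 q q' + 1` are prime. -/
def NGen (κ n : ℕ) : Finset (ℕ × ℕ × ℕ × ℕ) :=
  (Finset.range (2 ^ (2 * κ)) ×ˢ Finset.range (2 ^ (2 * κ)) ×ˢ
    Finset.range (2 ^ ((n - 4 * κ) / 2 - 1)) ×ˢ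
    Finset.range (2 ^ ((n - 4 * κ) / 2 - 1))).filter fun (p, q, p', q') =>
      (p.size = 2 * κ ∧ q.size = 2 * κ ∧
        p'.size = (n - 4 * κ) / 2 - 1 ∧ q'.size = (n - 4 * κ) / 2 - 1) ∧
      (p.Prime ∧ Odd p ∧ q.Prime ∧ Odd q ∧ Odd p' ∧ Odd q') ∧
      (p.Coprime q ∧ p.Coprime p' ∧ p.Coprime q' ∧
        q.Coprime p' ∧ q.Coprime q' ∧ p'.Coprime q') ∧
      (2 * p * p' + 1).Prime ∧ (2 * q * q' + 1).Prime

/-- The modulus `N = P Q` with `P = 2 p p' + 1` and `Q = 2 q q' + 1`. -/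
def modulus : ℕ × ℕ × ℕ × ℕ → ℕ
  | (p, q, p', q') => (2 * p * p' + 1) * (2 * q * q' + 1)

instance (t : ℕ × ℕ × ℕ × ℕ) : NeZero (modulus t) :=
  ⟨Nat.mul_ne_zero (Nat.succ_ne_zero _) (Nat.succ_ne_zero _)⟩

/-- The private key `α = p q`. -/
def alpha : ℕ × ℕ × ℕ × ℕ → ℕ
  | (p, q, _, _) => p * q

/-- `β = (P - 1) (Q - 1) / (4 p q)`. -/
def beta : ℕ × ℕ × ℕ × ℕ → ℕ
  | (p, q, p', q') => ((2 * p * p' + 1 - 1) * (2 * q * q' + 1 - 1)) / (4 * p * q)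

/-- A public key. -/
structure PublicKey where
  N : ℕ
  h : ZMod N

/-- The public key, the private key and the two threshold keys. -/
structure Keys where
  pk : PublicKey
  α : ℕ
  sk₁ : ℕ
  sk₂ : ℤ

/-- The public key `(N, h)` with `h = - y ^ (2 β) mod N`. -/
def pubKey (t : ℕ × ℕ × ℕ × ℕ) (y : (ZMod (modulus t))ˣ) : PublicKey where
  N := modulus t
  h := -((y : ZMod (modulus t)) ^ (2 * beta t))

/-- All keys, with
`sk₂ = ((2 α)⁻¹ mod N) * (2 α) - sk₁ + η * (2 α) * N`. -/
def keyGen (t : ℕ × ℕ × ℕ × ℕ) (y : (ZMod (modulus t))ˣ) (sk₁ : ℕ) (η : ℤ) : Keys where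
  pk := pubKey t y
  α := alpha t
  sk₁ := sk₁
  sk₂ := ((((2 * alpha t : ℕ) : ZMod (modulus t))⁻¹).val : ℤ) * (2 * alpha t) - sk₁
    + η * (2 * alpha t) * modulus t

/-- Ciphertexts are residues modulo `N ^ 2`. -/
abbrev Cipher (pk : PublicKey) := ZMod (pk.N ^ 2)

/-- `(1 + N) ^ m * (h ^ r mod N) ^ N mod N ^ 2`; an integer plaintext stands for its residue
modulo `N`. -/
def enc (pk : PublicKey) (m : ℤ) (r : ℕ) : Cipher pk :=
  (1 + (pk.N : ZMod (pk.N ^ 2))) ^ (m : ZMod pk.N).val *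
    (((pk.h ^ r).val : ℕ) : ZMod (pk.N ^ 2)) ^ pk.N

/-- `c` is a ciphertext of `m`, with an exponent of any size: products and powers of outputs
of `enc` are covered. -/
def IsCiphertext (pk : PublicKey) (m : ℤ) (c : Cipher pk) : Prop :=
  ∃ r : ℕ, c = enc pk m r

/-- Powers with an integer exponent (of invertible residues). -/
def intPow {M : ℕ} (c : ZMod M) (k : ℤ) : ZMod M :=
  if 0 ≤ k then c ^ k.toNat else c⁻¹ ^ (-k).toNat

/-- Decryption with the private key. -/
def dec (K : Keys) (c : Cipher K.pk) : ZMod K.pk.N :=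
  ((((c ^ (2 * K.α)).val - 1) / K.pk.N : ℕ) : ZMod K.pk.N) *
    ((2 * K.α : ℕ) : ZMod K.pk.N)⁻¹

/-- Partial decryption with a threshold key. -/
def pdec (pk : PublicKey) (sk : ℤ) (c : Cipher pk) : Cipher pk := intPow c sk

/-- Threshold decryption. -/
def tdec (pk : PublicKey) (M₁ M₂ : Cipher pk) : ZMod pk.N :=
  ((((M₁ * M₂).val - 1) / pk.N : ℕ) : ZMod pk.N)

/-- Encryption randomness: `l(κ) = 4 κ` bits. -/
abbrev EncCoin (κ : ℕ) := Fin (2 ^ (4 * κ))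

/-- Expectation over a random public key. -/
noncomputable def expPK (κ n : ℕ) (f : PublicKey → ℝ) : ℝ :=
  𝔼 t ∈ NGen κ n, 𝔼 y : (ZMod (modulus t))ˣ, f (pubKey t y)

/-- Expectation over random keys; `sk₁` is a random `σ`-bit number, and the integer `η`
may be chosen in any way that depends on the primes and on `sk₁`. -/
noncomputable def expKeys (κ n σ : ℕ) (η : ℕ × ℕ × ℕ × ℕ → ℕ → ℤ) (f : Keys → ℝ) : ℝ :=
  𝔼 t ∈ NGen κ n, 𝔼 y : (ZMod (modulus t))ˣ, 𝔼 a : Fin (2 ^ σ), f (keyGen t y a (η t a))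

/-- Probability that `D` answers `1` on the public key and an encryption of `m`. -/
noncomputable def encGame (κ n : ℕ) (m : ℤ) (D : Prog) : ℝ :=
  expPK κ n fun pk => 𝔼 r : EncCoin κ, D.acceptProb [pk.N, pk.h.val, (enc pk m r).val]

/-- Semantic security of the encryption scheme, in the form of indistinguishability of
encryptions: no polynomial-time algorithm that is given the public key distinguishes the
encryptions of two messages of polynomial length. -/
def SemanticallySecure (n : ℕ → ℕ) : Prop :=
  ∀ m₀ m₁ : ℕ → ℤ, PolyBounded (fun κ => (m₀ κ).natAbs.size) →
    PolyBounded (fun κ => (m₁ κ).natAbs.size) →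
    ∀ D : ℕ → Prog, IsPPT D →
      Negligible fun κ => |encGame κ (n κ) (m₀ κ) (D κ) - encGame κ (n κ) (m₁ κ) (D κ)|

/-! ## The protocol

`S₁` holds `c i = ⟦x i⟧`, `sk₁`; `S₂` holds `sk₂`; `L` and `δ` are shared.  Indices start at `0`. -/

section Protocol

/-- First step, packing by `S₁`: the product of `(⟦x i⟧ * ⟦δ⟧ * ⟦r i⟧) ^ (L ^ i)`. -/
def pack (pk : PublicKey) (L δ : ℕ) {s : ℕ} (c : Fin s → Cipher pk) (r : Fin s → ℕ)
    (ρδ : ℕ) (ρr : Fin s → ℕ) : Cipher pk :=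
  ∏ i : Fin s, (c i * enc pk δ ρδ * enc pk (r i) (ρr i)) ^ (L ^ (i : ℕ))

/-- Second step, unpacking by `S₂` of the message `⟨C, C₁⟩`: the value that `S₂` obtains for
`x i + r i`. -/
def unpack (pk : PublicKey) (sk₂ : ℤ) (L δ : ℕ) (C C₁ : Cipher pk) (i : ℕ) : ℤ :=
  (((tdec pk C₁ (pdec pk sk₂ C)).val % L ^ (i + 1) / L ^ i : ℕ) : ℤ) - δ

/-- Second step, answer of `S₂`: encryptions of the squares of the unpacked values. -/
def reply (pk : PublicKey) (sk₂ : ℤ) (L δ : ℕ) {s : ℕ} (C C₁ : Cipher pk) (τ : Fin s → ℕ)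
    (i : Fin s) : Cipher pk :=
  enc pk (unpack pk sk₂ L δ C C₁ i ^ 2) (τ i)

/-- Third step, output of `S₁`:
`⟦(x i + r i) ^ 2⟧ * ⟦x i + δ⟧ ^ (- 2 * r i) * ⟦- (r i) ^ 2⟧ * ⟦2 * δ * r i⟧`. -/
def output (pk : PublicKey) (δ : ℕ) {s : ℕ} (c M : Fin s → Cipher pk) (r : Fin s → ℕ)
    (ρδ : ℕ) (ρsq ρlin : Fin s → ℕ) (i : Fin s) : Cipher pk :=
  M i * intPow (c i * enc pk δ ρδ) (-2 * (r i : ℤ)) * enc pk (-(r i : ℤ) ^ 2) (ρsq i) *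
    enc pk (2 * δ * r i) (ρlin i)

end Protocol

/-- The shared constant `δ` makes the admissible plaintexts `x i` non-negative.  The choice
`δ = 0` if all `x i` are non-negative, and `δ = - min x i` otherwise, is admissible. -/
def Admissible (ℓ δ : ℕ) {s : ℕ} (x : Fin s → ℤ) : Prop :=
  δ ≤ 2 ^ ℓ ∧ ∀ i, -(2 ^ ℓ : ℤ) ≤ x i ∧ x i ≤ 2 ^ ℓ ∧ 0 ≤ x i + δ

/-- `s` values fit into one ciphertext: `s ≤ ⌊|N| / |L|⌋`, where `|·|` is the bit length. -/
def Fits (pk : PublicKey) (L s : ℕ) : Prop := s ≤ pk.N.size / L.size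

instance (pk : PublicKey) (L s : ℕ) : Decidable (Fits pk L s) :=
  inferInstanceAs (Decidable (s ≤ _))

/-- Correctness: for all keys, all ciphertexts of admissible plaintexts that fit, and all random
choices, `S₂` unpacks the values `x i + r i`, and the outputs of `S₁` are ciphertexts of
`(x i) ^ 2`, decrypted as such with the private key and with the two threshold keys. -/
def Correct (n σ ℓ L : ℕ → ℕ) : Prop :=
  ∀ (κ : ℕ), ∀ t ∈ NGen κ (n κ), ∀ (y : (ZMod (modulus t))ˣ) (sk₁ : ℕ) (η : ℤ),
    sk₁ < 2 ^ σ κ →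
    let K := keyGen t y sk₁ η
    ∀ (s δ : ℕ) (x : Fin s → ℤ), Fits K.pk (L κ) s → Admissible (ℓ κ) δ x →
    ∀ c : Fin s → Cipher K.pk, (∀ i, IsCiphertext K.pk (x i) (c i)) →
    ∀ (r : Fin s → ℕ), (∀ i, r i < 2 ^ σ κ) →
    ∀ (ρδ : ℕ) (ρr ρsq ρlin τ : Fin s → ℕ),
    let C := pack K.pk (L κ) δ c r ρδ ρr
    let C₁ := pdec K.pk K.sk₁ C
    let out := output K.pk δ c (reply K.pk K.sk₂ (L κ) δ C C₁ τ) r ρδ ρsq ρlin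
    ∀ i : Fin s,
      unpack K.pk K.sk₂ (L κ) δ C C₁ i = x i + r i ∧
      IsCiphertext K.pk (x i ^ 2) (out i) ∧
      dec K (out i) = ((x i ^ 2 : ℤ) : ZMod K.pk.N) ∧
      tdec K.pk (pdec K.pk K.sk₁ (out i)) (pdec K.pk K.sk₂ (out i)) =
        ((x i ^ 2 : ℤ) : ZMod K.pk.N)

/-! ## Views of the servers and privacy

The view of a server consists of its keys and the shared constant `δ`, its further inputs, its
random choices and the messages it receives.  Everything else that it computes is a function
of these. -/

/-- What `S₁` holds apart from its input ciphertexts. -/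
def keys₁ (K : Keys) (δ : ℕ) : List ℕ := [K.pk.N, K.pk.h.val, K.sk₁, δ]

/-- What `S₂` holds; an integer is encoded by its positive and its negative part. -/
def keys₂ (K : Keys) (δ : ℕ) : List ℕ :=
  [K.pk.N, K.pk.h.val, K.sk₂.toNat, (-K.sk₂).toNat, δ]

/-- View of `S₁` in an execution: input ciphertexts, random choices, and the answer of `S₂`. -/
def view₁ (K : Keys) (L δ : ℕ) {s : ℕ} (c : Fin s → Cipher K.pk) (r : Fin s → ℕ) (ρδ : ℕ)
    (ρr ρsq ρlin τ : Fin s → ℕ) : List ℕ :=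
  let C := pack K.pk L δ c r ρδ ρr
  let M := reply K.pk K.sk₂ L δ C (pdec K.pk K.sk₁ C) τ
  (List.ofFn fun i => (c i).val) ++ List.ofFn r ++ [ρδ] ++ List.ofFn ρr ++ List.ofFn ρsq ++
    List.ofFn ρlin ++ List.ofFn fun i => (M i).val

/-- View of `S₂` in an execution: the message of `S₁`, and its random choices. -/
def view₂ (K : Keys) (L δ : ℕ) {s : ℕ} (c : Fin s → Cipher K.pk) (r : Fin s → ℕ) (ρδ : ℕ)
    (ρr τ : Fin s → ℕ) : List ℕ :=
  let C := pack K.pk L δ c r ρδ ρr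
  [C.val, (pdec K.pk K.sk₁ C).val] ++ List.ofFn τ

/-- Probability that `D` answers `1` on the view of `S₁` in a real execution on fresh encryptions
of `x`.  The protocol is only executed with keys for which the `s` values fit. -/
noncomputable def real₁ (κ n σ : ℕ) (η : ℕ × ℕ × ℕ × ℕ → ℕ → ℤ) (L δ : ℕ) {s : ℕ}
    (x : Fin s → ℤ) (D : Prog) : ℝ :=
  expKeys κ n σ η fun K => if Fits K.pk L s then
    𝔼 ρx : Fin s → EncCoin κ, 𝔼 r : Fin s → Fin (2 ^ σ), 𝔼 ρδ : EncCoin κ,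
    𝔼 ρr : Fin s → EncCoin κ, 𝔼 ρsq : Fin s → EncCoin κ, 𝔼 ρlin : Fin s → EncCoin κ,
    𝔼 τ : Fin s → EncCoin κ,
      D.acceptProb (keys₁ K δ ++ view₁ K L δ (fun i => enc K.pk (x i) (ρx i)) (fun i => r i) ρδ
        (fun i => ρr i) (fun i => ρsq i) (fun i => ρlin i) (fun i => τ i))
  else 0

/-- Probability that `D` answers `1` on the view of `S₁` produced by the simulator `S` from
the keys of `S₁` and `δ` alone. -/
noncomputable def ideal₁ (κ n σ : ℕ) (η : ℕ × ℕ × ℕ × ℕ → ℕ → ℤ) (L δ s : ℕ)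
    (S D : Prog) : ℝ :=
  expKeys κ n σ η fun K => if Fits K.pk L s then
    𝔼 ω : Fin S.coins → Bool, D.acceptProb (keys₁ K δ ++ S.run (keys₁ K δ) ω)
  else 0

/-- As `real₁`, for the view of `S₂`. -/
noncomputable def real₂ (κ n σ : ℕ) (η : ℕ × ℕ × ℕ × ℕ → ℕ → ℤ) (L δ : ℕ) {s : ℕ}
    (x : Fin s → ℤ) (D : Prog) : ℝ :=
  expKeys κ n σ η fun K => if Fits K.pk L s then
    𝔼 ρx : Fin s → EncCoin κ, 𝔼 r : Fin s → Fin (2 ^ σ), 𝔼 ρδ : EncCoin κ,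
    𝔼 ρr : Fin s → EncCoin κ, 𝔼 τ : Fin s → EncCoin κ,
      D.acceptProb (keys₂ K δ ++ view₂ K L δ (fun i => enc K.pk (x i) (ρx i)) (fun i => r i) ρδ
        (fun i => ρr i) (fun i => τ i))
  else 0

/-- As `ideal₁`, for the view of `S₂`. -/
noncomputable def ideal₂ (κ n σ : ℕ) (η : ℕ × ℕ × ℕ × ℕ → ℕ → ℤ) (L δ s : ℕ)
    (S D : Prog) : ℝ :=
  expKeys κ n σ η fun K => if Fits K.pk L s then
    𝔼 ω : Fin S.coins → Bool, D.acceptProb (keys₂ K δ ++ S.run (keys₂ K δ) ω)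
  else 0

/-- Privacy against the semi-honest server `S₁`: a polynomial-time simulator produces, without any
access to the plaintexts or their ciphertexts, a view that is computationally
indistinguishable from the real one, for all admissible plaintexts. -/
def PrivateAgainstS₁ (n σ ℓ L s : ℕ → ℕ) (η : ℕ → ℕ × ℕ × ℕ × ℕ → ℕ → ℤ) : Prop :=
  ∃ S : ℕ → Prog, IsPPT S ∧
    ∀ (δ : ℕ → ℕ) (x : ∀ κ, Fin (s κ) → ℤ), (∀ κ, Admissible (ℓ κ) (δ κ) (x κ)) →
    ∀ D : ℕ → Prog, IsPPT D →
      Negligible fun κ =>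
        |real₁ κ (n κ) (σ κ) (η κ) (L κ) (δ κ) (x κ) (D κ) -
          ideal₁ κ (n κ) (σ κ) (η κ) (L κ) (δ κ) (s κ) (S κ) (D κ)|

/-- Privacy against the semi-honest server `S₂`. -/
def PrivateAgainstS₂ (n σ ℓ L s : ℕ → ℕ) (η : ℕ → ℕ × ℕ × ℕ × ℕ → ℕ → ℤ) : Prop :=
  ∃ S : ℕ → Prog, IsPPT S ∧
    ∀ (δ : ℕ → ℕ) (x : ∀ κ, Fin (s κ) → ℤ), (∀ κ, Admissible (ℓ κ) (δ κ) (x κ)) →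
    ∀ D : ℕ → Prog, IsPPT D →
      Negligible fun κ =>
        |real₂ κ (n κ) (σ κ) (η κ) (L κ) (δ κ) (x κ) (D κ) -
          ideal₂ κ (n κ) (σ κ) (η κ) (L κ) (δ κ) (s κ) (S κ) (D κ)|

end BatchSquare

/-! Correctness is algebra modulo N². Since (1 + N)^m = 1 + mN, and the N-th power of a residue
modulo N is well defined modulo N², `enc` turns sums of plaintexts and of exponents into products
(`enc_mul_enc`). Hence packing yields an encryption of Σ (x_i + δ + r_i) L^i (`pack_enc`). Because
φ(N) = 2β · 2α and 2α is even, h^(2α) = 1 (`totient_modulus`, `pubKey_h_pow`). The sum sk₁ + sk₂ is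
divisible by 2α and congruent to 1 modulo N, so raising a ciphertext to this power erases its
randomness and keeps its plaintext (`intPow_enc_of_dvd`). The bit length condition gives only L^s <
2N, but every digit x_i + δ + r_i is below L/2, so the packed number is below L^s/2 < N and its
digits in base L are recovered exactly (`packed_digit`). The output is correct because (x + r)² -
2r(x + δ) - r² + 2δr = x².

Privacy against S₁ is computational. By correctness the answers of S₂ encrypt (x_i + r_i)², so the
view of S₁ consists of choices independent of the public key and of 2s ciphertexts under that key
(`real₁_eq`). The simulator replaces all 2s plaintexts by zero. A hybrid argument exchanges one
ciphertext at a time (`hybrid`, `viewGame_hybrid`). In each exchange all random choices except the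
key, the challenge and the coins of the distinguisher are fixed at worst values and hard-wired,
which non-uniformity permits. This produces a distinguisher against the encryption scheme
(`reductionProg`), at the price of a factor 2s ≤ 2n.

Privacy against S₂ is statistical. For fixed encryption exponents the message of S₁ depends on x_i
and r_i only through x_i + r_i, and shifting a uniform σ-bit number by x_i costs at most |x_i| / 2^σ
(`abs_expect_shift_sub_le`, `abs_view₂_sub_le`). The simulator therefore executes the protocol on
zero plaintexts. It can form the partial decryption because sk₁ is the residue of 1 - sk₂ modulo N
(`recover_sk₁`), and its output agrees with the real view coin by coin (`sim₂_run`).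

Polynomial time has to be shown for explicit straight-line programs on all inputs, also malformed
ones. The invariant is `Safe`: every product or sum that enters a loop is reduced at once modulo a
non-zero register, so that all numbers keep one common length bound. If the values fit for some key,
then s and, for s > 0, also σ are at most n; otherwise both games are zero and the simulator may be
the one for s = 0. -/

namespace BatchSquare

/-! ## Algebra of Paillier ciphertexts -/

/-- The `N`-th power map from residues modulo `N` to residues modulo `N ^ 2`. -/
def powLift (N : ℕ) (a : ZMod N) : ZMod (N ^ 2) := ((a.val : ℕ) : ZMod (N ^ 2)) ^ N

/-- In a^N - b^N = (a - b) · Σ a^i b^(N-1-i) both factors are divisible by N when a ≡ b, the second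
because all its N summands agree modulo N. This makes `powLift` independent of representatives and
therefore multiplicative. -/
lemma natCast_pow_eq_of_natCast_eq {N : ℕ} {a b : ℕ} (h : (a : ZMod N) = b) :
    (a : ZMod (N ^ 2)) ^ N = (b : ZMod (N ^ 2)) ^ N := by
  have h1 : ((N : ℕ) : ℤ) ∣ (a : ℤ) - b := by
    rw [← ZMod.intCast_zmod_eq_zero_iff_dvd]
    push_cast
    rw [h, sub_self]
  have h2 := dvd_sub_pow_of_dvd_sub h1 1
  rw [pow_one] at h2
  have h3 : ((N ^ 2 : ℕ) : ℤ) ∣ (a : ℤ) ^ N - (b : ℤ) ^ N := by exact_mod_cast h2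
  rw [← ZMod.intCast_zmod_eq_zero_iff_dvd] at h3
  push_cast at h3
  exact sub_eq_zero.mp h3

lemma powLift_one {N : ℕ} [NeZero N] : powLift N 1 = 1 := by
  have : powLift N 1 = ((1 : ℕ) : ZMod (N ^ 2)) ^ N :=
    natCast_pow_eq_of_natCast_eq (by simp)
  simpa using this

lemma powLift_mul {N : ℕ} [NeZero N] (a b : ZMod N) :
    powLift N (a * b) = powLift N a * powLift N b := by
  have : powLift N (a * b) = ((a.val * b.val : ℕ) : ZMod (N ^ 2)) ^ N :=
    natCast_pow_eq_of_natCast_eq (by simp)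
  rw [this, powLift, powLift, Nat.cast_mul, mul_pow]

/-- The binomial expansion stops after the linear term because N² = 0. -/
lemma one_add_natCast_pow (N m : ℕ) :
    (1 + (N : ZMod (N ^ 2))) ^ m = 1 + (m : ZMod (N ^ 2)) * N := by
  have h : (N : ZMod (N ^ 2)) * N = 0 := by
    rw [← Nat.cast_mul, ← sq, ZMod.natCast_self]
  induction m with
  | zero => simp
  | succ m ih =>
    rw [pow_succ (1 + (N : ZMod (N ^ 2))) m, ih]
    push_cast
    linear_combination (m : ZMod (N ^ 2)) * h

lemma natCast_mul_modulus_eq {N a b : ℕ} (h : (a : ZMod N) = b) :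
    (a : ZMod (N ^ 2)) * N = (b : ZMod (N ^ 2)) * N := by
  have h1 : ((N : ℕ) : ℤ) ∣ (a : ℤ) - b := by
    rw [← ZMod.intCast_zmod_eq_zero_iff_dvd]
    push_cast
    rw [h, sub_self]
  have h3 : ((N ^ 2 : ℕ) : ℤ) ∣ ((a : ℤ) - b) * N := by
    push_cast
    rw [sq]
    exact mul_dvd_mul_right h1 _
  rw [← ZMod.intCast_zmod_eq_zero_iff_dvd] at h3
  push_cast at h3
  linear_combination h3

lemma enc_eq (pk : PublicKey) (m : ℤ) (r : ℕ) :
    enc pk m r = (1 + ((m : ZMod pk.N).val : ZMod (pk.N ^ 2)) * pk.N) * powLift pk.N (pk.h ^ r) := by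
  rw [enc, one_add_natCast_pow, powLift]

lemma enc_congr {pk : PublicKey} {m m' : ℤ} (h : (m : ZMod pk.N) = m') (r : ℕ) :
    enc pk m r = enc pk m' r := by
  rw [enc, enc, h]

section

variable {pk : PublicKey} [NeZero pk.N]

lemma enc_zero_zero : enc pk 0 0 = 1 := by
  simp [enc_eq, powLift_one]

/-- In (1 + mN)(1 + m'N) the cross term contains N² and vanishes, and the random factors combine by
`powLift_mul`. Exponents add as natural numbers, without reduction; this is why ciphertexts are
allowed exponents of any size. -/
lemma enc_mul_enc (m m' : ℤ) (r r' : ℕ) :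
    enc pk m r * enc pk m' r' = enc pk (m + m') (r + r') := by
  have h : (pk.N : ZMod (pk.N ^ 2)) * pk.N = 0 := by
    rw [← Nat.cast_mul, ← sq, ZMod.natCast_self]
  have h1 : (((m + m' : ℤ) : ZMod pk.N).val : ZMod (pk.N ^ 2)) * pk.N =
      (((m : ZMod pk.N).val + (m' : ZMod pk.N).val : ℕ) : ZMod (pk.N ^ 2)) * pk.N :=
    natCast_mul_modulus_eq (by simp)
  rw [enc_eq, enc_eq, enc_eq, pow_add, powLift_mul, h1]
  push_cast
  linear_combination (powLift pk.N (pk.h ^ r) * powLift pk.N (pk.h ^ r') *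
    ((m : ZMod pk.N).val : ZMod (pk.N ^ 2)) * ((m' : ZMod pk.N).val : ZMod (pk.N ^ 2))) * h

lemma enc_pow (m : ℤ) (r k : ℕ) : enc pk m r ^ k = enc pk (k * m) (k * r) := by
  induction k with
  | zero => simp [enc_zero_zero]
  | succ k ih =>
    rw [pow_succ, ih, enc_mul_enc]
    congr 1
    · push_cast; ring
    · ring

lemma prod_enc {ι : Type*} (S : Finset ι) (m : ι → ℤ) (r : ι → ℕ) :
    ∏ i ∈ S, enc pk (m i) (r i) = enc pk (∑ i ∈ S, m i) (∑ i ∈ S, r i) := by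
  classical
  induction S using Finset.induction_on with
  | empty => simp [enc_zero_zero]
  | insert a S ha ih => rw [Finset.prod_insert ha, ih, enc_mul_enc, Finset.sum_insert ha,
      Finset.sum_insert ha]

/-- The explicit plaintext is what unpacking reads. The explicit exponent does not involve the x_i,
which is what makes the masking argument for S₂ possible. -/
lemma pack_enc (L δ : ℕ) {s : ℕ} (x : Fin s → ℤ) (ρx r : Fin s → ℕ) (ρδ : ℕ) (ρr : Fin s → ℕ) :
    pack pk L δ (fun i => enc pk (x i) (ρx i)) r ρδ ρr =
      enc pk (∑ i : Fin s, (x i + δ + r i) * (L : ℤ) ^ (i : ℕ))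
        (∑ i : Fin s, (ρx i + ρδ + ρr i) * L ^ (i : ℕ)) := by
  rw [pack, ← prod_enc]
  refine Finset.prod_congr rfl fun i _ => ?_
  rw [enc_mul_enc, enc_mul_enc, enc_pow]
  congr 1
  · push_cast; ring
  · ring

/-- The representative of the plaintext is at most N - 1, so 1 + mN is already below N² and no
reduction takes place. -/
lemma enc_val_zero (hN : 1 < pk.N) (m : ℤ) :
    (enc pk m 0).val = 1 + (m : ZMod pk.N).val * pk.N := by
  rw [enc_eq, pow_zero, powLift_one, mul_one]
  have : (1 + ((m : ZMod pk.N).val : ZMod (pk.N ^ 2)) * pk.N) =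
      ((1 + (m : ZMod pk.N).val * pk.N : ℕ) : ZMod (pk.N ^ 2)) := by push_cast; ring
  rw [this, ZMod.val_natCast, Nat.mod_eq_of_lt]
  have h := ZMod.val_lt (m : ZMod pk.N)
  nlinarith

lemma enc_zero_decode (hN : 1 < pk.N) (m : ℤ) :
    ((((enc pk m 0).val - 1) / pk.N : ℕ) : ZMod pk.N) = m := by
  rw [enc_val_zero hN, Nat.add_sub_cancel_left, Nat.mul_div_cancel _ (by omega)]
  simp

lemma IsCiphertext.mul {m m' : ℤ} {c c' : Cipher pk} (h : IsCiphertext pk m c)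
    (h' : IsCiphertext pk m' c') : IsCiphertext pk (m + m') (c * c') := by
  obtain ⟨r, rfl⟩ := h
  obtain ⟨r', rfl⟩ := h'
  exact ⟨r + r', enc_mul_enc _ _ _ _⟩

/-! ### Keys whose base has a known exponent -/

variable {a : ℕ} (ha : 0 < a) (hh : pk.h ^ a = 1)

omit [NeZero pk.N] in
include hh in
lemma enc_add_mul_exponent (m : ℤ) (r j : ℕ) : enc pk m (r + a * j) = enc pk m r := by
  rw [enc, enc, pow_add, pow_mul, hh, one_pow, mul_one]

include ha hh

/-- Exponents are natural numbers; as h^a = 1, the exponent (a - 1) r plays the role of -r. -/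
lemma enc_mul_enc_neg (m : ℤ) (r : ℕ) : enc pk m r * enc pk (-m) ((a - 1) * r) = 1 := by
  rw [enc_mul_enc, add_neg_cancel]
  have : r + (a - 1) * r = 0 + a * r := by
    obtain ⟨b, rfl⟩ : ∃ b, a = b + 1 := ⟨a - 1, by omega⟩
    simp; ring
  rw [this, enc_add_mul_exponent hh, enc_zero_zero]

lemma isUnit_enc (m : ℤ) (r : ℕ) : IsUnit (enc pk m r) :=
  IsUnit.of_mul_eq_one _ (enc_mul_enc_neg ha hh m r)

lemma enc_inv (m : ℤ) (r : ℕ) : (enc pk m r)⁻¹ = enc pk (-m) ((a - 1) * r) :=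
  ZMod.inv_eq_of_mul_eq_one _ _ _ (enc_mul_enc_neg ha hh m r)

lemma IsCiphertext.intPow {m : ℤ} {c : Cipher pk} (h : IsCiphertext pk m c) (k : ℤ) :
    IsCiphertext pk (k * m) (BatchSquare.intPow c k) := by
  obtain ⟨r, rfl⟩ := h
  rw [BatchSquare.intPow]
  split_ifs with hk
  · refine ⟨k.toNat * r, ?_⟩
    rw [enc_pow, Int.toNat_of_nonneg hk]
  · refine ⟨(-k).toNat * ((a - 1) * r), ?_⟩
    rw [enc_inv ha hh, enc_pow, Int.toNat_of_nonneg (by omega)]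
    congr 1
    ring

end

/-! ### Integer powers of invertible residues, and decryption. -/

lemma intPow_unit {M : ℕ} (u : (ZMod M)ˣ) (k : ℤ) : intPow (u : ZMod M) k = ((u ^ k : _ˣ) : ZMod M) := by
  rw [intPow]
  split_ifs with hk
  · obtain ⟨j, rfl⟩ := Int.eq_ofNat_of_zero_le hk
    simp
  · obtain ⟨j, hj⟩ := Int.eq_ofNat_of_zero_le (show 0 ≤ -k by omega)
    obtain rfl : k = -(j : ℤ) := by omega
    simp [ZMod.inv_coe_unit]

lemma intPow_mul_intPow {M : ℕ} {c : ZMod M} (hc : IsUnit c) (k l : ℤ) :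
    intPow c k * intPow c l = intPow c (k + l) := by
  obtain ⟨u, rfl⟩ := hc
  rw [intPow_unit, intPow_unit, intPow_unit, zpow_add, Units.val_mul]

lemma intPow_pow {M : ℕ} {c : ZMod M} (hc : IsUnit c) (a : ℕ) (j : ℤ) :
    intPow c (a * j) = intPow (c ^ a) j := by
  obtain ⟨u, rfl⟩ := hc
  rw [← Units.val_pow_eq_pow_val, intPow_unit, intPow_unit, zpow_mul, zpow_natCast]

section

variable {pk : PublicKey} {a : ℕ} (hN : 1 < pk.N) (ha : 0 < a) (hh : pk.h ^ a = 1)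
include hN ha hh

/-- The a-th power already removes the randomness because h^a = 1, and multiplying the plaintext by
d ≡ 1 modulo N does not change it. For threshold keys d = sk₁ + sk₂ and a = 2α. -/
lemma intPow_enc_of_dvd {d : ℤ} (hd : (a : ℤ) ∣ d) (hd1 : (d : ZMod pk.N) = 1) (m : ℤ) (r : ℕ) :
    intPow (enc pk m r) d = enc pk m 0 := by
  have : NeZero pk.N := ⟨by omega⟩
  obtain ⟨j, rfl⟩ := hd
  have h0 : ∀ m', intPow (enc pk m' 0) j = enc pk (j * m') 0 := by
    intro m'
    rw [intPow]
    split_ifs with hk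
    · rw [enc_pow, Int.toNat_of_nonneg hk, mul_zero]
    · rw [enc_inv ha hh, enc_pow, Int.toNat_of_nonneg (by omega), mul_zero, mul_zero]
      congr 1
      ring
  have h1 : enc pk m r ^ a = enc pk (a * m) 0 := by
    rw [enc_pow, ← zero_add (a * r), enc_add_mul_exponent hh]
  rw [intPow_pow (isUnit_enc ha hh m r), h1, h0]
  refine enc_congr ?_ 0
  push_cast at hd1 ⊢
  linear_combination (m : ZMod pk.N) * hd1

lemma tdec_of_isCiphertext {sk₁ sk₂ : ℤ} (hd : (a : ℤ) ∣ sk₁ + sk₂)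
    (hd1 : ((sk₁ + sk₂ : ℤ) : ZMod pk.N) = 1) {m : ℤ} {c : Cipher pk} (hc : IsCiphertext pk m c) :
    tdec pk (pdec pk sk₁ c) (pdec pk sk₂ c) = m := by
  have : NeZero pk.N := ⟨by omega⟩
  obtain ⟨r, rfl⟩ := hc
  rw [tdec, pdec, pdec, intPow_mul_intPow (isUnit_enc ha hh m r),
    intPow_enc_of_dvd hN ha hh hd hd1, enc_zero_decode hN]

end

/-- The power 2α erases the randomness but multiplies the plaintext by 2α, which is undone by the
inverse modulo N. -/
lemma dec_of_isCiphertext {K : Keys} (hN : 1 < K.pk.N) (hh : K.pk.h ^ (2 * K.α) = 1)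
    (hα : (2 * K.α).Coprime K.pk.N) {m : ℤ} {c : Cipher K.pk} (hc : IsCiphertext K.pk m c) :
    dec K c = m := by
  have : NeZero K.pk.N := ⟨by omega⟩
  have ha : 0 < 2 * K.α := by
    rcases Nat.eq_zero_or_pos (2 * K.α) with h | h
    · rw [h] at hα
      simp at hα
      omega
    · exact h
  obtain ⟨r, rfl⟩ := hc
  rw [dec, enc_pow, ← zero_add (2 * K.α * r), enc_add_mul_exponent hh, enc_zero_decode hN]
  have := ZMod.coe_mul_inv_eq_one _ hα
  push_cast at this ⊢
  linear_combination (m : ZMod K.pk.N) * this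

/-! ## Digits -/

lemma sum_mul_pow_lt {u : ℕ → ℕ} {L : ℕ} (hu : ∀ i, u i < L) (s : ℕ) :
    ∑ i ∈ Finset.range s, u i * L ^ i < L ^ s := by
  induction s with
  | zero => simp
  | succ s ih =>
    rw [Finset.sum_range_succ, pow_succ]
    have := hu s
    have h2 : (u s + 1) * L ^ s ≤ L * L ^ s := Nat.mul_le_mul_right _ this
    nlinarith

lemma sum_mul_pow_mod {u : ℕ → ℕ} {L : ℕ} (hu : ∀ i, u i < L) {s i : ℕ} (hi : i ≤ s) :
    (∑ j ∈ Finset.range s, u j * L ^ j) % L ^ i = ∑ j ∈ Finset.range i, u j * L ^ j := by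
  obtain ⟨k, rfl⟩ := Nat.exists_eq_add_of_le hi
  rw [Finset.sum_range_add]
  have : ∑ x ∈ Finset.range k, u (i + x) * L ^ (i + x) =
      L ^ i * ∑ x ∈ Finset.range k, u (i + x) * L ^ x := by
    rw [Finset.mul_sum]
    exact Finset.sum_congr rfl fun x _ => by ring
  rw [this, Nat.add_mul_mod_self_left, Nat.mod_eq_of_lt (sum_mul_pow_lt hu i)]

/-- Reduction modulo L^(i+1) removes the higher digits, and division by L^i the lower ones, whose
sum stays below L^i. Used with base L for unpacking and with base 2 for random bits. -/
lemma sum_mul_pow_digit {u : ℕ → ℕ} {L : ℕ} (hu : ∀ i, u i < L) {s i : ℕ} (hi : i < s) :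
    (∑ j ∈ Finset.range s, u j * L ^ j) % L ^ (i + 1) / L ^ i = u i := by
  rw [sum_mul_pow_mod hu hi, Finset.sum_range_succ, mul_comm (u i),
    Nat.add_mul_div_left _ _ (Nat.pow_pos (by have := hu 0; omega)),
    Nat.div_eq_of_lt (sum_mul_pow_lt hu i), zero_add]

/-- A number whose leading digit is at most `L / 2` is below `L ^ s / 2`. -/
lemma two_mul_sum_mul_pow_lt {u : ℕ → ℕ} {L : ℕ} (hu : ∀ i, 2 * (u i + 1) ≤ L) {s : ℕ} (hs : 0 < s) :
    2 * ∑ i ∈ Finset.range s, u i * L ^ i < L ^ s := by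
  obtain ⟨k, rfl⟩ := Nat.exists_eq_add_of_le' hs
  rw [Finset.sum_range_succ, pow_succ]
  have h1 := sum_mul_pow_lt (u := u) (L := L) (fun i => by have := hu i; omega) k
  have h2 : 2 * (u k + 1) * L ^ k ≤ L * L ^ k := Nat.mul_le_mul_right _ (hu k)
  nlinarith

/-! ## The modulus -/

instance (t : ℕ × ℕ × ℕ × ℕ) (y : (ZMod (modulus t))ˣ) : NeZero (pubKey t y).N :=
  inferInstanceAs (NeZero (modulus t))

instance (t : ℕ × ℕ × ℕ × ℕ) (y : (ZMod (modulus t))ˣ) (sk₁ : ℕ) (η : ℤ) :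
    NeZero (keyGen t y sk₁ η).pk.N :=
  inferInstanceAs (NeZero (modulus t))

section

variable {κ n : ℕ} {t : ℕ × ℕ × ℕ × ℕ}

/-- Both factors of N are below 2^(2κ + e + 1), where e is the length of p' and q', and twice this
exponent is at most n. This bound transfers all sizes in the protocol to the polynomial n. -/
lemma modulus_size_le (ht : t ∈ NGen κ n) : (modulus t).size ≤ n := by
  obtain ⟨p, q, p', q'⟩ := t
  simp only [NGen, Finset.mem_filter, Finset.mem_product, Finset.mem_range] at ht
  obtain ⟨⟨hp, hq, hp', hq'⟩, ⟨-, -, hs, -⟩, ⟨-, -, -, -, hodd, -⟩, -⟩ := ht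
  set e := (n - 4 * κ) / 2 - 1 with he
  -- An odd number has at least one bit. With e ≥ 1 the truncated subtractions in the definition of
  -- e are genuine, so 2(2κ + e + 1) ≤ n.
  have he1 : e ≠ 0 := by
    intro h0
    rw [h0] at hs
    have : p' = 0 := Nat.size_eq_zero.mp hs
    subst this
    simp at hodd
  have key : ∀ u v : ℕ, u < 2 ^ (2 * κ) → v < 2 ^ e → 2 * u * v + 1 < 2 ^ (2 * κ + e + 1) := by
    intro u v hu hv
    have h1 : u * v ≤ (2 ^ (2 * κ) - 1) * (2 ^ e) := Nat.mul_le_mul (by omega) hv.le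
    have h2 : (2 : ℕ) ^ (2 * κ + e + 1) = 2 * (2 ^ (2 * κ) * 2 ^ e) := by ring
    have h3 : (2 ^ (2 * κ) - 1) * (2 ^ e) + 2 ^ e = 2 ^ (2 * κ) * 2 ^ e := by
      obtain ⟨b, hb⟩ : ∃ b, 2 ^ (2 * κ) = b + 1 := ⟨2 ^ (2 * κ) - 1, by omega⟩
      rw [hb]; simp; ring
    have h4 : 1 ≤ 2 ^ e := Nat.one_le_two_pow
    have h5 : 2 * u * v = 2 * (u * v) := by ring
    omega
  rw [Nat.size_le, modulus]
  have h1 := key p p' hp hp'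
  have h2 := key q q' hq hq'
  calc (2 * p * p' + 1) * (2 * q * q' + 1)
      < 2 ^ (2 * κ + e + 1) * 2 ^ (2 * κ + e + 1) := Nat.mul_lt_mul'' h1 h2
    _ = 2 ^ (2 * (2 * κ + e + 1)) := by ring
    _ ≤ 2 ^ n := Nat.pow_le_pow_right (by norm_num) (by omega)

lemma one_lt_modulus (ht : t ∈ NGen κ n) : 1 < modulus t := by
  obtain ⟨p, q, p', q'⟩ := t
  simp only [NGen, Finset.mem_filter] at ht
  obtain ⟨-, -, -, -, hP, hQ⟩ := ht
  exact Nat.one_lt_mul_iff.mpr ⟨hP.pos, hQ.pos, Or.inl hP.one_lt⟩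

lemma alpha_pos (ht : t ∈ NGen κ n) : 0 < 2 * alpha t := by
  obtain ⟨p, q, p', q'⟩ := t
  simp only [NGen, Finset.mem_filter] at ht
  obtain ⟨-, -, ⟨hp, -, hq, -⟩, -⟩ := ht
  have := Nat.mul_pos hp.pos hq.pos
  simp only [alpha]
  omega

/-- With distinct primes P and Q, φ(N) = (P - 1)(Q - 1) = 4pq · p'q', and β = p'q'. The primes are
distinct because P = Q would give pp' = qq', although p is coprime to q and q'. -/
lemma totient_modulus (ht : t ∈ NGen κ n) :
    (modulus t).totient = 2 * beta t * (2 * alpha t) := by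
  obtain ⟨p, q, p', q'⟩ := t
  simp only [NGen, Finset.mem_filter] at ht
  obtain ⟨-, -, ⟨hp, -, hq, -⟩, ⟨hpq, -, hpq', -⟩, hP, hQ⟩ := ht
  have hne : 2 * p * p' + 1 ≠ 2 * q * q' + 1 := by
    intro h
    have h1 : p ∣ q * q' := ⟨p', by nlinarith⟩
    have h2 : p ∣ 1 := by
      have h3 : Nat.Coprime p (q * q') := Nat.Coprime.mul_right hpq hpq'
      exact (Nat.Coprime.eq_one_of_dvd h3 h1) ▸ dvd_rfl
    exact hp.one_lt.ne' (Nat.dvd_one.mp h2)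
  rw [modulus, Nat.totient_mul ((Nat.coprime_primes hP hQ).mpr hne), Nat.totient_prime hP,
    Nat.totient_prime hQ, beta, alpha]
  simp only [Nat.add_sub_cancel]
  have h4 : 2 * p * p' * (2 * q * q') = 4 * p * q * (p' * q') := by ring
  rw [h4, Nat.mul_div_cancel_left _ (by have := hp.pos; have := hq.pos; positivity)]
  ring

/-- That p is coprime to P = 2pp' + 1 is immediate. For Q, equality of bit lengths gives p < 2^(2κ)
≤ 2q < Q, so p and Q are different primes; the case of q is symmetric. -/
lemma coprime_alpha_modulus (ht : t ∈ NGen κ n) : (2 * alpha t).Coprime (modulus t) := by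
  obtain ⟨p, q, p', q'⟩ := t
  simp only [NGen, Finset.mem_filter, Finset.mem_product, Finset.mem_range] at ht
  obtain ⟨⟨hplt, hqlt, -, -⟩, ⟨hps, hqs, -⟩, ⟨hp, -, hq, -, hp'o, hq'o⟩, -, hP, hQ⟩ := ht
  have hle : ∀ u : ℕ, u.size = 2 * κ → u.Prime → 2 ^ (2 * κ) ≤ 2 * u := by
    intro u hu hup
    have h1 : 2 * κ ≠ 0 := by
      rw [← hu]
      exact fun h => hup.ne_zero (Nat.size_eq_zero.mp h)
    have h2 : 2 ^ (2 * κ - 1) ≤ u := Nat.lt_size.mp (by omega)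
    calc 2 ^ (2 * κ) = 2 * 2 ^ (2 * κ - 1) := by
          rw [← pow_succ']
          congr 1
          omega
      _ ≤ _ := Nat.mul_le_mul_left _ h2
  have aux : ∀ u v w : ℕ, u.Prime → (2 * v * w + 1).Prime → u < 2 * v * w + 1 →
      u.Coprime (2 * v * w + 1) := fun u v w hu hv hlt =>
    (Nat.coprime_primes hu hv).mpr hlt.ne
  have self : ∀ u v : ℕ, u.Coprime (2 * u * v + 1) := by
    intro u v
    have : 2 * u * v + 1 = 1 + u * (2 * v) := by ring
    rw [this]
    simp
  have two : ∀ u v : ℕ, (2 : ℕ).Coprime (2 * u * v + 1) := by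
    intro u v
    have : 2 * u * v + 1 = 1 + 2 * (u * v) := by ring
    rw [this]
    simp
  have big : ∀ v w : ℕ, 0 < w → 2 * v ≤ 2 * v * w := fun v w hw => Nat.le_mul_of_pos_right _ hw
  have h1 := hle p hps hp
  have h2 := hle q hqs hq
  have h3 := big p p' hp'o.pos
  have h4 := big q q' hq'o.pos
  simp only [alpha, modulus]
  refine Nat.Coprime.mul_left ?_ (Nat.Coprime.mul_left ?_ ?_)
  · exact Nat.Coprime.mul_right (two _ _) (two _ _)
  · exact Nat.Coprime.mul_right (self _ _) (aux _ _ _ hp hQ (by omega))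
  · exact Nat.Coprime.mul_right (aux _ _ _ hq hP (by omega)) (self _ _)

/-- The even exponent cancels the sign in h = -y^(2β), and what remains is y^φ(N) = 1 by Euler's
theorem. -/
lemma pubKey_h_pow (ht : t ∈ NGen κ n) (y : (ZMod (modulus t))ˣ) :
    (pubKey t y).h ^ (2 * alpha t) = 1 := by
  have h1 : (-((y : ZMod (modulus t)) ^ (2 * beta t))) ^ (2 * alpha t) = 1 := by
    rw [Even.neg_pow ⟨alpha t, by ring⟩, ← pow_mul, ← totient_modulus ht,
      ← Units.val_pow_eq_pow_val, ZMod.pow_totient, Units.val_one]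
  exact h1

lemma keyGen_sum_dvd (y : (ZMod (modulus t))ˣ) (sk₁ : ℕ) (η : ℤ) :
    ((2 * alpha t : ℕ) : ℤ) ∣ ((keyGen t y sk₁ η).sk₁ : ℤ) + (keyGen t y sk₁ η).sk₂ := by
  refine ⟨((((2 * alpha t : ℕ) : ZMod (modulus t))⁻¹).val : ℤ) + η * modulus t, ?_⟩
  simp only [keyGen]
  push_cast
  ring

lemma keyGen_sum_cast (ht : t ∈ NGen κ n) (y : (ZMod (modulus t))ˣ) (sk₁ : ℕ) (η : ℤ) :
    ((((keyGen t y sk₁ η).sk₁ : ℤ) + (keyGen t y sk₁ η).sk₂ : ℤ) : ZMod (modulus t)) = 1 := by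
  have := ZMod.coe_mul_inv_eq_one _ (coprime_alpha_modulus ht)
  simp only [keyGen]
  push_cast at this ⊢
  rw [ZMod.natCast_self, ZMod.natCast_val, ZMod.cast_id]
  linear_combination this

end

/-! ## Correctness -/

/-- From s|L| ≤ |N| only the leading bit of N is known, so 2^(s|L| - 1) ≤ N. The lost factor 2 is
regained from digits below L/2 in `two_mul_sum_mul_pow_lt`. -/
lemma pow_mul_le_of_fits {pk : PublicKey} {L s : ℕ} (hL : 0 < L) (hs : 0 < s) (h : Fits pk L s) :
    L ^ s < 2 * pk.N := by
  have h1 : s * L.size ≤ pk.N.size :=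
    (Nat.le_div_iff_mul_le (Nat.size_pos.mpr hL)).mp h
  have h2 : 0 < L.size := Nat.size_pos.mpr hL
  have h3 : L ^ s < 2 ^ (s * L.size) := by
    rw [mul_comm, pow_mul]
    exact Nat.pow_lt_pow_left (Nat.lt_size_self L) hs.ne'
  have h4 : 0 < s * L.size := Nat.mul_pos hs h2
  have h5 : 2 ^ (s * L.size - 1) ≤ pk.N := Nat.lt_size.mp (by omega)
  have h6 : 2 ^ (s * L.size) = 2 * 2 ^ (s * L.size - 1) := by
    rw [← pow_succ']
    congr 1
    omega
  omega

/-- The packed plaintext determines its digits. -/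
lemma packed_digit {pk : PublicKey} {L s : ℕ} (hL : 0 < L) (h : Fits pk L s)
    {u : Fin s → ℤ} (hu : ∀ i, 0 ≤ u i ∧ 2 * (u i + 1) ≤ L) (i : Fin s) :
    ((((∑ i : Fin s, u i * (L : ℤ) ^ (i : ℕ) : ℤ) : ZMod pk.N).val % L ^ ((i : ℕ) + 1) /
      L ^ (i : ℕ) : ℕ) : ℤ) = u i := by
  have hs : 0 < s := i.pos
  have hN := pow_mul_le_of_fits hL hs h
  let v : ℕ → ℕ := fun j => if hj : j < s then (u ⟨j, hj⟩).toNat else 0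
  have hv : ∀ j : Fin s, u j = (v j : ℤ) := by
    intro j
    simp only [v, j.2, dif_pos]
    exact (Int.toNat_of_nonneg (hu j).1).symm
  have hL2 : 2 ≤ L := by
    have := hu i
    omega
  have hvL : ∀ j, 2 * (v j + 1) ≤ L := by
    intro j
    by_cases hj : j < s
    · have h1 := hv ⟨j, hj⟩
      have h2 := hu ⟨j, hj⟩
      rw [h1] at h2
      simp only at h2
      omega
    · simp [v, hj, hL2]
  have hsum : (∑ i : Fin s, u i * (L : ℤ) ^ (i : ℕ)) =
      ((∑ j ∈ Finset.range s, v j * L ^ j : ℕ) : ℤ) := by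
    rw [Finset.sum_range]
    push_cast
    exact Finset.sum_congr rfl fun j _ => by rw [hv]
  -- Twice the sum is below L^s, and L^s < 2N; so the packed plaintext does not wrap around modulo
  -- N.
  have hlt : ∑ j ∈ Finset.range s, v j * L ^ j < pk.N := by
    have := two_mul_sum_mul_pow_lt hvL hs
    omega
  rw [hsum, Int.cast_natCast, ZMod.val_natCast, Nat.mod_eq_of_lt hlt,
    sum_mul_pow_digit (fun j => by have := hvL j; omega) i.2, hv]

/-- Here x + δ ≤ 2^(ℓ+1) ≤ 2^σ and r + 1 ≤ 2^σ, so x + δ + r + 1 ≤ 2^(σ+1). The bound L ≥ 2^(σ+2)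
leaves one more bit, which is the factor 2 in the conclusion. -/
lemma admissible_bounds {ℓ σ L δ s : ℕ} {x : Fin s → ℤ} (hσ : ℓ < σ) (hL : 2 ^ (σ + 2) ≤ L)
    (hx : Admissible ℓ δ x) {r : Fin s → ℕ} (hr : ∀ i, r i < 2 ^ σ) (i : Fin s) :
    0 ≤ x i + δ + r i ∧ 2 * (x i + δ + r i + 1) ≤ L := by
  obtain ⟨hδ, hx⟩ := hx
  obtain ⟨-, h2, h3⟩ := hx i
  have h4 := hr i
  have h5 : 2 ^ (ℓ + 1) ≤ 2 ^ σ := Nat.pow_le_pow_right (by norm_num) hσ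
  rw [pow_succ] at h5
  rw [pow_add] at hL
  zify at hδ h4 h5 hL
  constructor <;> omega

section

variable {κ n σ ℓ L : ℕ} {t : ℕ × ℕ × ℕ × ℕ} (ht : t ∈ NGen κ n) (y : (ZMod (modulus t))ˣ)
  (sk₁ : ℕ) (η : ℤ)
include ht

lemma tdec_keyGen {m : ℤ} {c : Cipher (keyGen t y sk₁ η).pk}
    (hc : IsCiphertext (keyGen t y sk₁ η).pk m c) :
    tdec (keyGen t y sk₁ η).pk (pdec _ (keyGen t y sk₁ η).sk₁ c)
      (pdec _ (keyGen t y sk₁ η).sk₂ c) = m :=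
  tdec_of_isCiphertext (one_lt_modulus ht) (alpha_pos ht) (pubKey_h_pow ht y)
    (keyGen_sum_dvd y sk₁ η) (keyGen_sum_cast ht y sk₁ η) hc

lemma unpack_pack (hσ : ℓ < σ) (hL : 2 ^ (σ + 2) ≤ L) {s δ : ℕ} {x : Fin s → ℤ}
    (hfit : Fits (keyGen t y sk₁ η).pk L s) (hx : Admissible ℓ δ x)
    {c : Fin s → Cipher (keyGen t y sk₁ η).pk}
    (hc : ∀ i, IsCiphertext (keyGen t y sk₁ η).pk (x i) (c i)) {r : Fin s → ℕ}
    (hr : ∀ i, r i < 2 ^ σ) (ρδ : ℕ) (ρr : Fin s → ℕ) (i : Fin s) :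
    unpack (keyGen t y sk₁ η).pk (keyGen t y sk₁ η).sk₂ L δ (pack _ L δ c r ρδ ρr)
      (pdec _ (keyGen t y sk₁ η).sk₁ (pack _ L δ c r ρδ ρr)) i = x i + r i := by
  choose ρx hρx using hc
  obtain rfl : c = fun i => enc _ (x i) (ρx i) := funext hρx
  rw [unpack, tdec_keyGen ht y sk₁ η ⟨_, pack_enc L δ x ρx r ρδ ρr⟩,
    packed_digit (lt_of_lt_of_le (by positivity) hL) hfit (admissible_bounds hσ hL hx hr)]
  ring

end

lemma correct (n σ ℓ L : ℕ → ℕ) (hσ : ∀ κ, ℓ κ < σ κ) (hL : ∀ κ, 2 ^ (σ κ + 2) ≤ L κ) :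
    Correct n σ ℓ L := by
  intro κ t ht y sk₁ η hsk K s δ x hfit hx c hc r hr ρδ ρr ρsq ρlin τ C C₁ out i
  have : NeZero K.pk.N := inferInstanceAs (NeZero (modulus t))
  have hun : unpack K.pk K.sk₂ (L κ) δ C C₁ i = x i + r i :=
    unpack_pack ht y sk₁ η (hσ κ) (hL κ) hfit hx hc hr ρδ ρr i
  have hout : IsCiphertext K.pk (x i ^ 2) (out i) := by
    have h1 : IsCiphertext K.pk ((x i + r i) ^ 2) (reply K.pk K.sk₂ (L κ) δ C C₁ τ i) :=
      ⟨τ i, by rw [reply, hun]⟩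
    have h2 := ((hc i).mul ⟨ρδ, rfl⟩ : IsCiphertext K.pk (x i + δ) (c i * enc K.pk δ ρδ)).intPow
      (alpha_pos ht) (pubKey_h_pow ht y) (-2 * (r i : ℤ))
    have h3 := ((h1.mul h2).mul (⟨ρsq i, rfl⟩ : IsCiphertext K.pk (-(r i : ℤ) ^ 2) _)).mul
      (⟨ρlin i, rfl⟩ : IsCiphertext K.pk (2 * δ * r i) _)
    -- The linear term removes 2rx but also 2rδ, because the shifted ciphertext is used; the last
    -- encryption restores 2δr.
    have h4 : (x i + r i) ^ 2 + -2 * (r i : ℤ) * (x i + δ) + -(r i : ℤ) ^ 2 + 2 * δ * r i =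
        x i ^ 2 := by ring
    rw [h4] at h3
    exact h3
  exact ⟨hun, hout, dec_of_isCiphertext (one_lt_modulus ht) (pubKey_h_pow ht y)
    (coprime_alpha_modulus ht) hout, tdec_keyGen ht y sk₁ η hout⟩

/-! ## Straight-line programs of bounded cost -/

lemma execCode_append (a b : List Instr) (μ : State) :
    execCode (a ++ b) μ = execCode b (execCode a μ) := by
  induction a generalizing μ with
  | nil => rfl
  | cons I a ih => exact ih _

lemma codeCost_append (a b : List Instr) (μ : State) :
    codeCost (a ++ b) μ = codeCost a μ + codeCost b (execCode a μ) := by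
  induction a generalizing μ with
  | nil => simp [codeCost, execCode]
  | cons I a ih => simp [codeCost, execCode, ih, add_assoc]

lemma size_mul_le (a b : ℕ) : (a * b).size ≤ a.size + b.size := by
  rw [Nat.size_le, pow_add]
  exact Nat.mul_lt_mul'' (Nat.lt_size_self a) (Nat.lt_size_self b)

lemma size_add_le {a b B : ℕ} (ha : a.size ≤ B) (hb : b.size ≤ B) : (a + b).size ≤ B + 1 := by
  rw [Nat.size_le] at *
  rw [pow_succ]
  omega

/-- All registers hold numbers of at most `B` bits. -/
def BoundedState (B : ℕ) (μ : State) : Prop := ∀ i, (μ i).size ≤ B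

lemma BoundedState.update {B : ℕ} {μ : State} (h : BoundedState B μ) (d : ℕ) {v : ℕ}
    (hv : v.size ≤ B) : BoundedState B (Function.update μ d v) := by
  intro i
  by_cases hi : i = d
  · subst hi
    rwa [Function.update_self]
  · rw [Function.update_of_ne hi]
    exact h i

/-- If the registers in `Z` (the moduli) are non-zero and the numbers in all registers have at
most `B ≥ G` bits, then the code preserves this and the moduli, at cost at most `k * (4 * B + 2)`. -/
def Safe (Z : List ℕ) (G : ℕ) (code : List Instr) (k : ℕ) : Prop :=
  ∀ B, G ≤ B → ∀ μ : State, BoundedState B μ → (∀ z ∈ Z, μ z ≠ 0) →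
    BoundedState B (execCode code μ) ∧ (∀ z ∈ Z, execCode code μ z = μ z) ∧
      codeCost code μ ≤ k * (4 * B + 2)

section

variable {Z : List ℕ} {G : ℕ}

lemma Safe.nil : Safe Z G [] 0 := fun _ _ _ hμ _ => ⟨hμ, fun _ _ => rfl, by simp [codeCost]⟩

lemma Safe.append {a b : List Instr} {k l : ℕ} (ha : Safe Z G a k) (hb : Safe Z G b l) :
    Safe Z G (a ++ b) (k + l) := by
  intro B hB μ hμ hZ
  obtain ⟨h1, h2, h3⟩ := ha B hB μ hμ hZ
  obtain ⟨h4, h5, h6⟩ := hb B hB _ h1 (fun z hz => by rw [h2 z hz]; exact hZ z hz)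
  rw [execCode_append, codeCost_append]
  refine ⟨h4, fun z hz => (h5 z hz).trans (h2 z hz), ?_⟩
  rw [add_mul]
  exact Nat.add_le_add h3 h6

lemma Safe.mono {a : List Instr} {k l : ℕ} (ha : Safe Z G a k) (h : k ≤ l) : Safe Z G a l := by
  intro B hB μ hμ hZ
  obtain ⟨h1, h2, h3⟩ := ha B hB μ hμ hZ
  exact ⟨h1, h2, h3.trans (Nat.mul_le_mul_right _ h)⟩

lemma Safe.flatten_replicate {a : List Instr} {k : ℕ} (ha : Safe Z G a k) (j : ℕ) :
    Safe Z G (List.replicate j a).flatten (j * k) := by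
  induction j with
  | zero => simpa using Safe.nil
  | succ j ih =>
    rw [List.replicate_succ, List.flatten_cons]
    exact (ha.append ih).mono (by rw [add_mul, one_mul, add_comm])

lemma Safe.of_update {I : Instr} {d : ℕ} (hd : d ∉ Z)
    (h : ∀ B, G ≤ B → ∀ μ : State, BoundedState B μ →
      ∃ v, I.exec μ = Function.update μ d v ∧ v.size ≤ B ∧ I.cost μ ≤ 4 * B + 2) :
    Safe Z G [I] 1 := by
  intro B hB μ hμ _
  obtain ⟨v, h1, h2, h3⟩ := h B hB μ hμ
  simp only [execCode, codeCost, h1]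
  refine ⟨hμ.update d h2, fun z hz => Function.update_of_ne ?_ _ _, by omega⟩
  rintro rfl
  exact hd hz

lemma Safe.const {d c : ℕ} (hd : d ∉ Z) (hc : c.size ≤ G) : Safe Z G [.const d c] 1 :=
  Safe.of_update hd fun B hB μ _ => ⟨c, rfl, by omega, by simp only [Instr.cost]; omega⟩

lemma Safe.sub {d : ℕ} (a b : ℕ) (hd : d ∉ Z) : Safe Z G [.sub d a b] 1 :=
  Safe.of_update hd fun B hB μ hμ => by
    have h1 := hμ a
    have h2 := hμ b
    have h3 : (μ a - μ b).size ≤ (μ a).size := Nat.size_le_size (Nat.sub_le _ _)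
    exact ⟨_, rfl, by omega, by simp only [Instr.cost]; omega⟩

lemma Safe.div {d : ℕ} (a b : ℕ) (hd : d ∉ Z) : Safe Z G [.div d a b] 1 :=
  Safe.of_update hd fun B hB μ hμ => by
    have h1 := hμ a
    have h2 := hμ b
    have h3 : (μ a / μ b).size ≤ (μ a).size := Nat.size_le_size (Nat.div_le_self _ _)
    exact ⟨_, rfl, by omega, by simp only [Instr.cost]; omega⟩

lemma Safe.mod {d : ℕ} (a b : ℕ) (hd : d ∉ Z) : Safe Z G [.mod d a b] 1 :=
  Safe.of_update hd fun B hB μ hμ => by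
    have h1 := hμ a
    have h2 := hμ b
    have h3 : (μ a % μ b).size ≤ (μ a).size := Nat.size_le_size (Nat.mod_le _ _)
    exact ⟨_, rfl, by omega, by simp only [Instr.cost]; omega⟩

/-- Modular multiplication. -/
def mulMod (d a b m : ℕ) : List Instr := [.mul d a b, .mod d d m]

/-- Modular addition. -/
def addMod (d a b m : ℕ) : List Instr := [.add d a b, .mod d d m]

lemma execCode_mulMod {d m : ℕ} (h : m ≠ d) (a b : ℕ) (μ : State) :
    execCode (mulMod d a b m) μ = Function.update μ d (μ a * μ b % μ m) := by
  simp [mulMod, execCode, Instr.exec, Function.update_of_ne h]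

lemma execCode_addMod {d m : ℕ} (h : m ≠ d) (a b : ℕ) (μ : State) :
    execCode (addMod d a b m) μ = Function.update μ d ((μ a + μ b) % μ m) := by
  simp [addMod, execCode, Instr.exec, Function.update_of_ne h]

/-- A product may have 2B bits, so multiplication alone is not safe. Followed by reduction modulo a
non-zero register it is, since the residue is no longer than the modulus; the cost is that of both
instructions together. -/
lemma Safe.mulMod {d m : ℕ} (a b : ℕ) (hd : d ∉ Z) (hm : m ∈ Z) :
    Safe Z G (BatchSquare.mulMod d a b m) 2 := by
  intro B hB μ hμ hZ
  have hmd : m ≠ d := by rintro rfl; exact hd hm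
  have h1 := hμ a
  have h2 := hμ b
  have h3 := size_mul_le (μ a) (μ b)
  have h4 : (μ a * μ b % μ m).size ≤ (μ m).size :=
    Nat.size_le_size (Nat.mod_lt _ (Nat.pos_of_ne_zero (hZ m hm))).le
  have h5 := hμ m
  rw [execCode_mulMod hmd]
  refine ⟨hμ.update d (by omega), fun z hz => Function.update_of_ne ?_ _ _, ?_⟩
  · rintro rfl
    exact hd hz
  · simp only [BatchSquare.mulMod, codeCost, Instr.cost, Instr.exec, Function.update_self,
      Function.update_of_ne hmd]
    omega

lemma Safe.addMod {d m : ℕ} (a b : ℕ) (hd : d ∉ Z) (hm : m ∈ Z) :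
    Safe Z G (BatchSquare.addMod d a b m) 3 := by
  intro B hB μ hμ hZ
  have hmd : m ≠ d := by rintro rfl; exact hd hm
  have h1 := hμ a
  have h2 := hμ b
  have h3 := size_add_le h1 h2
  have h4 : ((μ a + μ b) % μ m).size ≤ (μ m).size :=
    Nat.size_le_size (Nat.mod_lt _ (Nat.pos_of_ne_zero (hZ m hm))).le
  have h5 := hμ m
  rw [execCode_addMod hmd]
  refine ⟨hμ.update d (by omega), fun z hz => Function.update_of_ne ?_ _ _, ?_⟩
  · rintro rfl
    exact hd hz
  · simp only [BatchSquare.addMod, codeCost, Instr.cost, Instr.exec, Function.update_self,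
      Function.update_of_ne hmd]
    omega

end

/-! ### Modular exponentiation

The registers from `A` on hold the modulus `N`, the constants `1` and `2`, `N ^ 2`, `h`, the power
of two that bounds plain numbers, two further values, and eight registers of working space. -/

/-- The registers that hold moduli. -/
def moduli (A : ℕ) : List ℕ := [A, A + 3, A + 5]

/-- One step of the square-and-multiply algorithm. -/
def powStep (A m : ℕ) : List Instr :=
  [.mod (A + 13) (A + 12) (A + 2), .div (A + 12) (A + 12) (A + 2)] ++
  mulMod (A + 14) (A + 13) (A + 11) m ++ [.sub (A + 13) (A + 1) (A + 13)] ++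
  addMod (A + 14) (A + 14) (A + 13) m ++ mulMod (A + 10) (A + 10) (A + 14) m ++
  mulMod (A + 11) (A + 11) (A + 11) m

lemma safe_powStep (A G : ℕ) {m : ℕ} (hm : m ∈ moduli A) :
    Safe (moduli A) G (powStep A m) 12 := by
  have h : ∀ i, 6 ≤ i → A + i ∉ moduli A := by
    intro i hi
    simp [moduli]
    omega
  refine Safe.mono (((((((Safe.mod _ _ (h _ (by norm_num))).append
    (Safe.div _ _ (h _ (by norm_num)))).append
    (Safe.mulMod _ _ (h _ (by norm_num)) hm)).append (Safe.sub _ _ (h _ (by norm_num)))).append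
    (Safe.addMod _ _ (h _ (by norm_num)) hm)).append
    (Safe.mulMod _ _ (h _ (by norm_num)) hm)).append
    (Safe.mulMod _ _ (h _ (by norm_num)) hm)) (by norm_num)

/-- The working space is not part of the frame. -/
def Frame (A : ℕ) (μ ν : State) : Prop := ∀ r, r < A + 8 ∨ A + 16 ≤ r → ν r = μ r

lemma Frame.trans {A : ℕ} {μ ν ξ : State} (h : Frame A μ ν) (h' : Frame A ν ξ) : Frame A μ ξ :=
  fun r hr => (h' r hr).trans (h r hr)

/-- Replaces an update by a named state known only through its values, so that long pieces of code
are evaluated register by register. -/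
lemma exists_update (μ : State) (d v : ℕ) :
    ∃ ν, Function.update μ d v = ν ∧ ν d = v ∧ ∀ r, r ≠ d → ν r = μ r :=
  ⟨_, rfl, Function.update_self _ _ _, fun _ hr => Function.update_of_ne hr _ _⟩

/-- The machine cannot branch. With bit e and base b the conditional factor is computed as eb + (1 -
e), which is b or 1. -/
lemma powStep_spec {A m : ℕ} (hm : m ∈ moduli A) {μ : State} (h1 : μ (A + 1) = 1)
    (h2 : μ (A + 2) = 2) :
    Frame A μ (execCode (powStep A m) μ) ∧
    execCode (powStep A m) μ (A + 12) = μ (A + 12) / 2 ∧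
    execCode (powStep A m) μ (A + 11) = μ (A + 11) * μ (A + 11) % μ m ∧
    execCode (powStep A m) μ (A + 10) =
      μ (A + 10) * ((μ (A + 12) % 2 * μ (A + 11) % μ m + (1 - μ (A + 12) % 2)) % μ m) % μ m := by
  have hm' : m = A ∨ m = A + 3 ∨ m = A + 5 := by simpa [moduli] using hm
  have hne : ∀ i, 6 ≤ i → m ≠ A + i := by omega
  simp only [powStep, execCode_append, execCode_mulMod (hne 14 (by norm_num)),
    execCode_mulMod (hne 10 (by norm_num)), execCode_mulMod (hne 11 (by norm_num)),
    execCode_addMod (hne 14 (by norm_num)), execCode, Instr.exec]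
  obtain ⟨μ₁, e, v₁, f₁⟩ := exists_update μ (A + 13) (μ (A + 12) % μ (A + 2))
  rw [e]; clear e
  obtain ⟨μ₂, e, v₂, f₂⟩ := exists_update μ₁ (A + 12) (μ₁ (A + 12) / μ₁ (A + 2))
  rw [e]; clear e
  obtain ⟨μ₃, e, v₃, f₃⟩ := exists_update μ₂ (A + 14) (μ₂ (A + 13) * μ₂ (A + 11) % μ₂ m)
  rw [e]; clear e
  obtain ⟨μ₄, e, v₄, f₄⟩ := exists_update μ₃ (A + 13) (μ₃ (A + 1) - μ₃ (A + 13))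
  rw [e]; clear e
  obtain ⟨μ₅, e, v₅, f₅⟩ := exists_update μ₄ (A + 14) ((μ₄ (A + 14) + μ₄ (A + 13)) % μ₄ m)
  rw [e]; clear e
  obtain ⟨μ₆, e, v₆, f₆⟩ := exists_update μ₅ (A + 10) (μ₅ (A + 10) * μ₅ (A + 14) % μ₅ m)
  rw [e]; clear e
  obtain ⟨μ₇, e, v₇, f₇⟩ := exists_update μ₆ (A + 11) (μ₆ (A + 11) * μ₆ (A + 11) % μ₆ m)
  rw [e]; clear e
  have b₂ : μ₂ (A + 13) = μ (A + 12) % 2 := by rw [f₂ _ (by omega), v₁, h2]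
  have c₃ : μ₃ (A + 14) = μ (A + 12) % 2 * μ (A + 11) % μ m := by
    rw [v₃, b₂, f₂ _ (by omega), f₂ _ (by omega), f₁ _ (by omega), f₁ _ (by omega)]
  have b₄ : μ₄ (A + 13) = 1 - μ (A + 12) % 2 := by
    rw [v₄, f₃ _ (by omega), f₃ _ (by omega), b₂, f₂ _ (by omega), f₁ _ (by omega), h1]
  have frame : ∀ r, r ∉ [A + 13, A + 12, A + 14, A + 10, A + 11] → μ₇ r = μ r := by
    intro r hr
    simp only [List.mem_cons, List.not_mem_nil, or_false, not_or] at hr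
    obtain ⟨r1, r2, r3, r4, r5⟩ := hr
    rw [f₇ _ r5, f₆ _ r4, f₅ _ r3, f₄ _ r1, f₃ _ r3, f₂ _ r2, f₁ _ r1]
  have keep : ∀ r, r ∉ [A + 13, A + 12, A + 14] → μ₅ r = μ r := by
    intro r hr
    simp only [List.mem_cons, List.not_mem_nil, or_false, not_or] at hr
    obtain ⟨r1, r2, r3⟩ := hr
    rw [f₅ _ r3, f₄ _ r1, f₃ _ r3, f₂ _ r2, f₁ _ r1]
  have m₄ : μ₄ m = μ m := by
    rw [f₄ _ (by omega), f₃ _ (by omega), f₂ _ (by omega), f₁ _ (by omega)]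
  have k10 : μ₅ (A + 10) = μ (A + 10) := keep _ (by simp)
  have k11 : μ₅ (A + 11) = μ (A + 11) := keep _ (by simp)
  have km : μ₅ m = μ m := by rw [f₅ _ (by omega), m₄]
  refine ⟨fun r hr => frame r ?_, ?_, ?_, ?_⟩
  · simp only [List.mem_cons, List.not_mem_nil, or_false, not_or]
    omega
  · rw [f₇ _ (by omega), f₆ _ (by omega), f₅ _ (by omega), f₄ _ (by omega), f₃ _ (by omega), v₂,
      f₁ _ (by omega), f₁ _ (by omega), h2]
  · rw [v₇, f₆ _ (by omega), f₆ _ (by omega), k11, km]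
  · rw [f₇ _ (by omega), v₆, k10, km, v₅, m₄, b₄, f₄ _ (by omega), c₃]

/-- The invariant is the residue of result · base^exponent. Every round halves the exponent, so K
rounds exhaust any exponent below 2^K. The result is reduced only after at least one round, hence
the separate last clause. -/
lemma powLoop_spec {A m : ℕ} (hm : m ∈ moduli A) (K : ℕ) {μ : State} (h1 : μ (A + 1) = 1)
    (h2 : μ (A + 2) = 2) (hK : μ (A + 12) < 2 ^ K) :
    let ν := execCode (List.replicate K (powStep A m)).flatten μ
    Frame A μ ν ∧ ν (A + 10) ≡ μ (A + 10) * μ (A + 11) ^ μ (A + 12) [MOD μ m] ∧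
      (0 < K → μ m ≠ 0 → ν (A + 10) < μ m) := by
  induction K generalizing μ with
  | zero =>
    have : μ (A + 12) = 0 := by simpa using hK
    simp [execCode, this, Nat.ModEq.refl, Frame]
  | succ K ih =>
    rw [List.replicate_succ, List.flatten_cons, execCode_append]
    obtain ⟨hf, h3, h4, h5⟩ := powStep_spec hm h1 h2
    set ξ := execCode (powStep A m) μ with hξ
    have hm' : m = A ∨ m = A + 3 ∨ m = A + 5 := by simpa [moduli] using hm
    have hξm : ξ m = μ m := hf m (by omega)
    obtain ⟨hf', h6, h7⟩ := ih (μ := ξ) (by rw [hf _ (by omega), h1]) (by rw [hf _ (by omega), h2])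
      (by rw [h3, pow_succ] at *; omega)
    rw [hξm] at h6 h7
    refine ⟨hf.trans hf', h6.trans ?_, fun _ hm0 => ?_⟩
    · rw [h3, h4, h5]
      set e := μ (A + 12)
      set b := μ (A + 11)
      have hb : b * b % μ m ≡ b * b [MOD μ m] := Nat.mod_modEq _ _
      have hbit : (e % 2 * b % μ m + (1 - e % 2)) % μ m ≡ b ^ (e % 2) [MOD μ m] := by
        refine (Nat.mod_modEq _ _).trans (((Nat.mod_modEq _ _).add_right _).trans ?_)
        rcases Nat.mod_two_eq_zero_or_one e with he | he <;> simp [he, Nat.ModEq.refl]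
      refine (((Nat.mod_modEq _ _).trans (hbit.mul_left _)).mul (hb.pow _)).trans ?_
      have : μ (A + 10) * b ^ (e % 2) * (b * b) ^ (e / 2) = μ (A + 10) * b ^ e := by
        conv_rhs => rw [← Nat.mod_add_div e 2]
        rw [pow_add, pow_mul]
        ring
      rw [this]
    · rcases Nat.eq_zero_or_pos K with hK0 | hK0
      · subst hK0
        simp only [List.replicate_zero, List.flatten_nil, execCode, h5]
        exact Nat.mod_lt _ (Nat.pos_of_ne_zero hm0)
      · exact h7 hK0 hm0

/-- Exponentiation of the number in register `b` with the exponent in register `e`, modulo the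
number in register `m`. -/
def powCode (A K m b e : ℕ) : List Instr :=
  -- Division by the register that holds 1 serves as a copy instruction. The exponent is copied
  -- first, so the base must not sit in A + 12; it may sit in A + 10, which is overwritten last.
  [.div (A + 12) e (A + 1), .div (A + 11) b (A + 1), .const (A + 10) 1] ++
    (List.replicate K (powStep A m)).flatten

lemma not_mem_moduli (A : ℕ) {i : ℕ} (hi : 6 ≤ i) : A + i ∉ moduli A := by
  simp [moduli]
  omega

lemma safe_powCode (A K G b e : ℕ) (hG : 0 < G) {m : ℕ} (hm : m ∈ moduli A) :
    Safe (moduli A) G (powCode A K m b e) (3 + 12 * K) := by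
  refine Safe.mono ((((Safe.div _ _ (not_mem_moduli A (by norm_num))).append
    (Safe.div _ _ (not_mem_moduli A (by norm_num)))).append
    (Safe.const (not_mem_moduli A (by norm_num)) (by simpa using Nat.succ_le_of_lt hG))).append
    ((safe_powStep A G hm).flatten_replicate K)) (by omega)

lemma powCode_spec {A K m b e : ℕ} (hm : m ∈ moduli A) (hK : 0 < K) {μ : State}
    (h1 : μ (A + 1) = 1) (h2 : μ (A + 2) = 2) (hm0 : μ m ≠ 0) (he : μ e < 2 ^ K)
    (hb : b ≠ A + 12) :
    let ν := execCode (powCode A K m b e) μ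
    Frame A μ ν ∧ ν (A + 10) = μ b ^ μ e % μ m := by
  have hm' : m = A ∨ m = A + 3 ∨ m = A + 5 := by simpa [moduli] using hm
  intro ν
  have hν : ν = execCode (List.replicate K (powStep A m)).flatten
      (Function.update (Function.update (Function.update μ (A + 12) (μ e)) (A + 11) (μ b))
        (A + 10) 1) := by
    simp (disch := omega) only [ν, powCode, execCode_append, execCode, Instr.exec,
      Function.update_of_ne, h1, Nat.div_one]
  set ξ := Function.update (Function.update (Function.update μ (A + 12) (μ e)) (A + 11) (μ b))
        (A + 10) 1 with hξ
  have hf0 : Frame A μ ξ := by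
    intro r hr
    simp (disch := omega) only [hξ, Function.update_of_ne]
  have e0 : ξ (A + 10) = 1 := by simp [hξ]
  have e1 : ξ (A + 11) = μ b := by simp (disch := omega) only [hξ, Function.update_of_ne, Function.update_self]
  have e2 : ξ (A + 12) = μ e := by simp (disch := omega) only [hξ, Function.update_of_ne, Function.update_self]
  obtain ⟨hf, h3, h4⟩ := powLoop_spec hm K (μ := ξ) (by rw [hf0 _ (by omega), h1])
    (by rw [hf0 _ (by omega), h2]) (by rw [e2]; exact he)
  rw [← hν] at hf h3 h4
  rw [e0, e1, e2, one_mul, hf0 m (by omega)] at h3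
  rw [hf0 m (by omega)] at h4
  refine ⟨hf0.trans hf, ?_⟩
  rw [← Nat.mod_eq_of_lt (h4 hK hm0)]
  exact h3

/-! ### Encryption -/

/-- The number that represents an encryption of `m` with exponent `r`. -/
def encNat (N h m r : ℕ) : ℕ := (1 + m * N) * (h ^ r % N) ^ N % N ^ 2

lemma enc_val (pk : PublicKey) [NeZero pk.N] (m : ℤ) (r : ℕ) :
    (enc pk m r).val = encNat pk.N pk.h.val (m % (pk.N : ℤ)).toNat r := by
  have h1 : (m : ZMod pk.N).val = (m % (pk.N : ℤ)).toNat := by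
    rw [← ZMod.val_intCast, Int.toNat_natCast]
  have h2 : (1 + ((m : ZMod pk.N).val : ZMod (pk.N ^ 2)) * pk.N) * powLift pk.N (pk.h ^ r) =
      (((1 + (m : ZMod pk.N).val * pk.N) * ((pk.h ^ r).val) ^ pk.N : ℕ) : ZMod (pk.N ^ 2)) := by
    rw [powLift]
    push_cast
    ring
  have h3 : (pk.h ^ r).val = pk.h.val ^ r % pk.N := by
    rw [← ZMod.val_natCast]
    simp
  rw [enc_eq, h2, ZMod.val_natCast, h3, h1, encNat]

/-- Registers `A` to `A + 5` hold the modulus and the constants used with it. -/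
structure Params (A K N h : ℕ) (μ : State) : Prop where
  N_eq : μ A = N
  one_eq : μ (A + 1) = 1
  two_eq : μ (A + 2) = 2
  sq_eq : μ (A + 3) = N ^ 2
  h_eq : μ (A + 4) = h
  pow_eq : μ (A + 5) = 2 ^ K
  N_pos : 0 < N
  N_lt : N < 2 ^ K
  K_pos : 0 < K

lemma Params.frame {A K N h : ℕ} {μ ν : State} (p : Params A K N h μ)
    (hf : ∀ r, A ≤ r → r < A + 6 → ν r = μ r) : Params A K N h ν :=
  ⟨by rw [hf _ (by omega) (by omega), p.N_eq], by rw [hf _ (by omega) (by omega), p.one_eq],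
    by rw [hf _ (by omega) (by omega), p.two_eq], by rw [hf _ (by omega) (by omega), p.sq_eq],
    by rw [hf _ (by omega) (by omega), p.h_eq], by rw [hf _ (by omega) (by omega), p.pow_eq],
    p.N_pos, p.N_lt, p.K_pos⟩

/-- Encryption of the number in register `A + 8` with the exponent in register `A + 9`; the result
is in register `A + 10`. -/
def encCode (A K : ℕ) : List Instr :=
  powCode A K A (A + 4) (A + 9) ++ powCode A K (A + 3) (A + 10) A ++
    mulMod (A + 13) (A + 8) A (A + 3) ++ addMod (A + 13) (A + 13) (A + 1) (A + 3) ++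
    mulMod (A + 10) (A + 10) (A + 13) (A + 3)

lemma safe_encCode (A K G : ℕ) (hG : 0 < G) :
    Safe (moduli A) G (encCode A K) (13 + 24 * K) := by
  have m0 : A ∈ moduli A := by simp [moduli]
  have m3 : A + 3 ∈ moduli A := by simp [moduli]
  exact Safe.mono (((((safe_powCode A K G _ _ hG m0).append (safe_powCode A K G _ _ hG m3)).append
    (Safe.mulMod _ _ (not_mem_moduli A (by norm_num)) m3)).append
    (Safe.addMod _ _ (not_mem_moduli A (by norm_num)) m3)).append
    (Safe.mulMod _ _ (not_mem_moduli A (by norm_num)) m3)) (by omega)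

/-- `powCode` writes only to registers `A + 10` to `A + 14`. -/
lemma powCode_frame {A K m b e : ℕ} (hm : m ∈ moduli A) (μ : State) {r : ℕ}
    (hr : r ∉ [A + 10, A + 11, A + 12, A + 13, A + 14]) :
    execCode (powCode A K m b e) μ r = μ r := by
  simp only [List.mem_cons, List.not_mem_nil, or_false, not_or] at hr
  obtain ⟨r1, r2, r3, r4, r5⟩ := hr
  have hm' : m = A ∨ m = A + 3 ∨ m = A + 5 := by simpa [moduli] using hm
  have hne : ∀ i, 6 ≤ i → m ≠ A + i := by omega
  have step : ∀ μ : State, execCode (powStep A m) μ r = μ r := by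
    intro μ
    simp only [powStep, execCode_append, execCode_mulMod (hne 14 (by norm_num)),
      execCode_mulMod (hne 10 (by norm_num)), execCode_mulMod (hne 11 (by norm_num)),
      execCode_addMod (hne 14 (by norm_num)), execCode, Instr.exec]
    rw [Function.update_of_ne r2, Function.update_of_ne r1, Function.update_of_ne r5,
      Function.update_of_ne r4, Function.update_of_ne r5, Function.update_of_ne r3,
      Function.update_of_ne r4]
  have loop : ∀ j (μ : State), execCode (List.replicate j (powStep A m)).flatten μ r = μ r := by
    intro j
    induction j with
    | zero => intro μ; rfl
    | succ j ih =>
      intro μ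
      rw [List.replicate_succ, List.flatten_cons, execCode_append, ih, step]
  rw [powCode, execCode_append, loop]
  simp only [execCode, Instr.exec]
  rw [Function.update_of_ne r1, Function.update_of_ne r2, Function.update_of_ne r3]

lemma encCode_spec {A K N h : ℕ} {μ : State} (p : Params A K N h μ) (hr : μ (A + 9) < 2 ^ K) :
    Frame A μ (execCode (encCode A K) μ) ∧
      execCode (encCode A K) μ (A + 10) = encNat N h (μ (A + 8)) (μ (A + 9)) := by
  have m0 : A ∈ moduli A := by simp [moduli]
  have m3 : A + 3 ∈ moduli A := by simp [moduli]
  have hN := p.N_pos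
  simp only [encCode, execCode_append, execCode_mulMod (show A + 3 ≠ A + 13 by omega),
    execCode_mulMod (show A + 3 ≠ A + 10 by omega),
    execCode_addMod (show A + 3 ≠ A + 13 by omega)]
  obtain ⟨fr₁, v₁⟩ := powCode_spec m0 p.K_pos p.one_eq p.two_eq (by rw [p.N_eq]; omega) hr
    (b := A + 4) (by omega)
  have w₁ : execCode (powCode A K A (A + 4) (A + 9)) μ (A + 8) = μ (A + 8) :=
    powCode_frame m0 μ (by simp)
  generalize execCode (powCode A K A (A + 4) (A + 9)) μ = μ₁ at *
  have p₁ : Params A K N h μ₁ := p.frame fun r h1 h2 => fr₁ r (by omega)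
  obtain ⟨fr₂, v₂⟩ := powCode_spec m3 p.K_pos p₁.one_eq p₁.two_eq
    (by rw [p₁.sq_eq]; positivity) (e := A) (by rw [p₁.N_eq]; exact p.N_lt)
    (b := A + 10) (by omega)
  have w₂ : execCode (powCode A K (A + 3) (A + 10) A) μ₁ (A + 8) = μ₁ (A + 8) :=
    powCode_frame m3 μ₁ (by simp)
  generalize execCode (powCode A K (A + 3) (A + 10) A) μ₁ = μ₂ at *
  have p₂ : Params A K N h μ₂ := p₁.frame fun r h1 h2 => fr₂ r (by omega)
  rw [p₂.N_eq, p₂.sq_eq]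
  obtain ⟨μ₃, e, v₃, f₃⟩ := exists_update μ₂ (A + 13) (μ₂ (A + 8) * N % N ^ 2)
  rw [e]; clear e
  rw [f₃ _ (show A + 1 ≠ A + 13 by omega), f₃ _ (show A + 3 ≠ A + 13 by omega), p₂.one_eq,
    p₂.sq_eq, v₃]
  obtain ⟨μ₄, e, v₄, f₄⟩ := exists_update μ₃ (A + 13) ((μ₂ (A + 8) * N % N ^ 2 + 1) % N ^ 2)
  rw [e]; clear e
  have hμ₄ : ∀ r, r ≠ A + 13 → μ₄ r = μ₂ r := fun r hr => (f₄ r hr).trans (f₃ r hr)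
  rw [hμ₄ _ (show A + 10 ≠ A + 13 by omega), hμ₄ _ (show A + 3 ≠ A + 13 by omega), v₄, p₂.sq_eq]
  refine ⟨fun r hr' => ?_, ?_⟩
  · rw [Function.update_of_ne (by omega), hμ₄ _ (by omega), fr₂ r hr', fr₁ r hr']
  · rw [Function.update_self, v₂, v₁, p.h_eq, p.N_eq, p₁.N_eq, p₁.sq_eq, w₂, w₁, encNat,
      mul_comm (1 + _)]
    refine (Nat.mod_modEq _ _).mul ((Nat.mod_modEq _ _).trans ?_)
    rw [add_comm 1]
    exact (Nat.mod_modEq _ _).add_right 1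

/-! ### Lists of computed values -/

/-- A number that is hard-wired, read from a register, or read off from a block of random bits. -/
inductive Source where
  | cst (c : ℕ)
  | reg (i : ℕ)
  | bits (o k : ℕ)

/-- The number with the binary digits in `k` registers from `o` on. -/
def bitsVal (μ : State) (o k : ℕ) : ℕ := ∑ j ∈ Finset.range k, μ (o + j) % 2 * 2 ^ j

def Source.val (μ : State) : Source → ℕ
  | .cst c => c
  | .reg i => μ i
  | .bits o k => bitsVal μ o k

/-- Code that writes `bitsVal μ o k` to register `A + 9`. -/
def bitsCode (A : ℕ) : ℕ → ℕ → List Instr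
  | _, 0 => [.const (A + 9) 0]
  | o, k + 1 => bitsCode A (o + 1) k ++ addMod (A + 9) (A + 9) (A + 9) (A + 5) ++
      [.mod (A + 13) o (A + 2)] ++ addMod (A + 9) (A + 9) (A + 13) (A + 5)

/-- Code that writes the number to register `A + 9`. -/
def Source.code (A : ℕ) : Source → List Instr
  | .cst c => [.const (A + 9) c]
  | .reg i => [.div (A + 9) i (A + 1)]
  | .bits o k => bitsCode A o k

/-- The registers that are read are not clobbered, and the number has at most `K` bits. -/
def Source.Ok (A K : ℕ) : Source → Prop
  | .cst c => c.size ≤ K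
  | .reg i => i < A + 8
  | .bits o k => o + k ≤ A ∧ k ≤ K

lemma bitsVal_lt (μ : State) (o k : ℕ) : bitsVal μ o k < 2 ^ k :=
  sum_mul_pow_lt (u := fun j => μ (o + j) % 2) (L := 2) (fun _ => Nat.mod_lt _ (by norm_num)) k

lemma bitsVal_succ (μ : State) (o k : ℕ) :
    bitsVal μ o (k + 1) = 2 * bitsVal μ (o + 1) k + μ o % 2 := by
  rw [bitsVal, Finset.sum_range_succ', bitsVal, Finset.mul_sum]
  congr 1
  · refine Finset.sum_congr rfl fun j _ => ?_
    rw [show o + (j + 1) = o + 1 + j by ring]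
    ring
  · simp

/-- Horner's scheme from the most significant bit. The reductions modulo 2^K change nothing because
all partial values are below 2^k ≤ 2^K; they make the code safe for arbitrary register contents. -/
lemma bitsCode_spec {A K N h o k : ℕ} {μ : State} (p : Params A K N h μ) (ho : o + k ≤ A)
    (hk : k ≤ K) :
    (∀ r, r ≠ A + 9 → r ≠ A + 13 → execCode (bitsCode A o k) μ r = μ r) ∧
      execCode (bitsCode A o k) μ (A + 9) = bitsVal μ o k := by
  induction k generalizing o with
  | zero =>
    refine ⟨fun r h9 _ => ?_, ?_⟩ <;> simp [bitsCode, execCode, Instr.exec, bitsVal]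
    rw [Function.update_of_ne h9]
  | succ k ih =>
    obtain ⟨hf, hv⟩ := ih (o := o + 1) (by omega) (by omega)
    have hlt := bitsVal_lt μ o (k + 1)
    have hle : 2 ^ (k + 1) ≤ 2 ^ K := Nat.pow_le_pow_right (by norm_num) hk
    rw [bitsVal_succ] at *
    simp only [bitsCode, execCode_append, execCode_addMod (show A + 5 ≠ A + 9 by omega), execCode,
      Instr.exec]
    generalize execCode (bitsCode A (o + 1) k) μ = μ₁ at *
    obtain ⟨μ₂, e, v₂, f₂⟩ := exists_update μ₁ (A + 9)
      ((μ₁ (A + 9) + μ₁ (A + 9)) % μ₁ (A + 5))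
    rw [e]; clear e
    obtain ⟨μ₃, e, v₃, f₃⟩ := exists_update μ₂ (A + 13) (μ₂ o % μ₂ (A + 2))
    rw [e]; clear e
    refine ⟨fun r h9 h13 => ?_, ?_⟩
    · rw [Function.update_of_ne h9, f₃ _ h13, f₂ _ h9, hf _ h9 h13]
    · rw [Function.update_self, v₃, f₃ _ (by omega), f₃ _ (by omega), v₂, f₂ _ (by omega),
        f₂ _ (by omega), f₂ _ (by omega), hv, hf _ (by omega) (by omega),
        hf _ (by omega) (by omega), hf _ (by omega) (by omega), p.pow_eq, p.two_eq,
        Nat.mod_eq_of_lt (show bitsVal μ (o + 1) k + bitsVal μ (o + 1) k < 2 ^ K by omega),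
        Nat.mod_eq_of_lt (by omega)]
      ring

lemma safe_bitsCode (A G o k : ℕ) : Safe (moduli A) G (bitsCode A o k) (1 + 7 * k) := by
  have m5 : A + 5 ∈ moduli A := by simp [moduli]
  induction k generalizing o with
  | zero => exact Safe.const (not_mem_moduli A (by norm_num)) (by simp)
  | succ k ih =>
    exact Safe.mono ((((ih _).append (Safe.addMod _ _ (not_mem_moduli A (by norm_num)) m5)).append
      (Safe.mod _ _ (not_mem_moduli A (by norm_num)))).append
      (Safe.addMod _ _ (not_mem_moduli A (by norm_num)) m5)) (by omega)

lemma Source.code_spec {A K N h : ℕ} {μ : State} (p : Params A K N h μ) {src : Source}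
    (hs : src.Ok A K) :
    (∀ r, r ≠ A + 9 → r ≠ A + 13 → execCode (src.code A) μ r = μ r) ∧
      execCode (src.code A) μ (A + 9) = src.val μ := by
  cases src with
  | cst c =>
    refine ⟨fun r h9 _ => ?_, ?_⟩ <;> simp [Source.code, execCode, Instr.exec, Source.val]
    rw [Function.update_of_ne h9]
  | reg i =>
    refine ⟨fun r h9 _ => ?_, ?_⟩ <;> simp [Source.code, execCode, Instr.exec, Source.val, p.one_eq]
    rw [Function.update_of_ne h9]
  | bits o k => exact bitsCode_spec p hs.1 hs.2

lemma safe_sourceCode {A K G : ℕ} (hG : K ≤ G) {src : Source} (hs : src.Ok A K) :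
    Safe (moduli A) G (src.code A) (1 + 7 * K) := by
  cases src with
  | cst c => exact (Safe.const (not_mem_moduli A (by norm_num)) (le_trans hs hG)).mono (by omega)
  | reg i => exact (Safe.div _ _ (not_mem_moduli A (by norm_num))).mono (by omega)
  | bits o k => exact (safe_bitsCode A G o k).mono (by have := hs.2; omega)

lemma Source.val_congr {A K : ℕ} {μ ν : State} {src : Source} (hs : src.Ok A K)
    (h : ∀ r, r < A + 8 → ν r = μ r) : src.val ν = src.val μ := by
  cases src with
  | cst c => rfl
  | reg i => exact h i hs
  | bits o k =>
    simp only [Source.val, bitsVal]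
    refine Finset.sum_congr rfl fun j hj => ?_
    rw [h _ (by have := hs.1; have := Finset.mem_range.mp hj; omega)]

/-- An entry of a computed list: a number, or an encryption with a given exponent. -/
inductive Item where
  | plain (src : Source)
  | cipher (m : ℤ) (src : Source)

def Item.val (N h : ℕ) (μ : State) : Item → ℕ
  | .plain src => src.val μ
  | .cipher m src => encNat N h (m % (N : ℤ)).toNat (src.val μ)

/-- Code that writes the residue of `m` to register `A + 8`. -/
def residueCode (A : ℕ) (m : ℤ) : List Instr :=
  [.const (A + 8) m.toNat, .mod (A + 8) (A + 8) A, .const (A + 13) (-m).toNat,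
    .mod (A + 13) (A + 13) A, .sub (A + 13) A (A + 13)] ++ addMod (A + 8) (A + 8) (A + 13) A

/-- Code that writes the entry to register `d`. -/
def Item.code (A K d : ℕ) : Item → List Instr
  | .plain src => src.code A ++ [.div d (A + 9) (A + 1)]
  | .cipher m src => src.code A ++ residueCode A m ++ encCode A K ++ [.div d (A + 10) (A + 1)]

def Source.IsReg : Source → Prop
  | .cst _ => False
  | .reg _ => True
  | .bits _ _ => False

/-- A number read from a register has no a priori bound and could exceed what K rounds of
square-and-multiply handle, so it is not admitted as an encryption exponent. -/
def Item.Ok (A K : ℕ) : Item → Prop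
  | .plain src => src.Ok A K
  | .cipher m src => src.Ok A K ∧ m.natAbs.size ≤ K ∧ ¬ src.IsReg

lemma Source.val_lt {A K : ℕ} (μ : State) {src : Source} (hs : src.Ok A K) (hr : ¬ src.IsReg) :
    src.val μ < 2 ^ K := by
  cases src with
  | cst c => exact Nat.size_le.mp hs
  | reg i => exact absurd trivial hr
  | bits o k => exact (bitsVal_lt μ o k).trans_le (Nat.pow_le_pow_right (by norm_num) hs.2)

/-- As registers hold natural numbers, m is split into its positive and negative parts, and the
negative part enters as N minus its residue. -/
lemma residueCode_spec {A K N h : ℕ} {μ : State} (p : Params A K N h μ) (m : ℤ) :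
    (∀ r, r ≠ A + 8 → r ≠ A + 13 → execCode (residueCode A m) μ r = μ r) ∧
      execCode (residueCode A m) μ (A + 8) = (m % (N : ℤ)).toNat := by
  simp only [residueCode, execCode_append, execCode_addMod (show A ≠ A + 8 by omega), execCode,
    Instr.exec]
  obtain ⟨μ₁, e, v₁, f₁⟩ := exists_update μ (A + 8) m.toNat
  rw [e]; clear e
  obtain ⟨μ₂, e, v₂, f₂⟩ := exists_update μ₁ (A + 8) (μ₁ (A + 8) % μ₁ A)
  rw [e]; clear e
  obtain ⟨μ₃, e, v₃, f₃⟩ := exists_update μ₂ (A + 13) (-m).toNat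
  rw [e]; clear e
  obtain ⟨μ₄, e, v₄, f₄⟩ := exists_update μ₃ (A + 13) (μ₃ (A + 13) % μ₃ A)
  rw [e]; clear e
  obtain ⟨μ₅, e, v₅, f₅⟩ := exists_update μ₄ (A + 13) (μ₄ A - μ₄ (A + 13))
  rw [e]; clear e
  refine ⟨fun r h8 h13 => ?_, ?_⟩
  · rw [Function.update_of_ne h8, f₅ _ h13, f₄ _ h13, f₃ _ h13, f₂ _ h8, f₁ _ h8]
  · have hA₁ : μ₁ A = N := by rw [f₁ _ (by omega), p.N_eq]
    have hA₂ : μ₂ A = N := by rw [f₂ _ (by omega), hA₁]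
    have hA₃ : μ₃ A = N := by rw [f₃ _ (by omega), hA₂]
    have hA₄ : μ₄ A = N := by rw [f₄ _ (by omega), hA₃]
    rw [Function.update_self, f₅ _ (by omega), f₄ _ (by omega), f₃ _ (by omega), v₂, v₁, hA₁, v₅,
      v₄, v₃, hA₃, hA₄, f₅ _ (by omega), hA₄]
    have hN := p.N_pos
    have h1 : (-m).toNat % N ≤ N := (Nat.mod_lt _ hN).le
    zify [h1]
    rw [Int.toNat_of_nonneg (Int.emod_nonneg _ (by omega))]
    have h2 : (m.toNat : ℤ) - ((-m).toNat : ℤ) = m := by omega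
    conv_rhs => rw [← h2]
    rw [Int.emod_eq_emod_iff_emod_sub_eq_zero]
    refine Int.emod_eq_zero_of_dvd ?_
    have d1 := Int.emod_add_mul_ediv (m.toNat : ℤ) N
    have d2 := Int.emod_add_mul_ediv ((-m).toNat : ℤ) N
    -- The quotients of both parts by N, and 1 for the added N.
    refine ⟨1 - (m.toNat : ℤ) / N + ((-m).toNat : ℤ) / N, ?_⟩
    linear_combination d1 - d2

lemma safe_residueCode {A K G : ℕ} (hG : K ≤ G) {m : ℤ} (hm : m.natAbs.size ≤ K) :
    Safe (moduli A) G (residueCode A m) 8 := by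
  have m0 : A ∈ moduli A := by simp [moduli]
  have h1 : m.toNat.size ≤ G := (Nat.size_le_size (show m.toNat ≤ m.natAbs by omega)).trans
    (hm.trans hG)
  have h2 : (-m).toNat.size ≤ G := (Nat.size_le_size (show (-m).toNat ≤ m.natAbs by omega)).trans
    (hm.trans hG)
  exact Safe.mono ((((((Safe.const (not_mem_moduli A (by norm_num)) h1).append
    (Safe.mod _ _ (not_mem_moduli A (by norm_num)))).append
    (Safe.const (not_mem_moduli A (by norm_num)) h2)).append
    (Safe.mod _ _ (not_mem_moduli A (by norm_num)))).append
    (Safe.sub _ _ (not_mem_moduli A (by norm_num)))).append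
    (Safe.addMod _ _ (not_mem_moduli A (by norm_num)) m0)) (by omega)

lemma Item.code_spec {A K N h d : ℕ} {μ : State} (p : Params A K N h μ)
    {it : Item} (hi : it.Ok A K) :
    (∀ r, r ≠ d → (r < A + 8 ∨ A + 16 ≤ r) → execCode (it.code A K d) μ r = μ r) ∧
      execCode (it.code A K d) μ d = it.val N h μ := by
  cases it with
  | plain src =>
    obtain ⟨f₁, v₁⟩ := Source.code_spec p (src := src) hi
    simp only [Item.code, execCode_append, execCode, Instr.exec]
    refine ⟨fun r hrd hr => ?_, ?_⟩
    · rw [Function.update_of_ne hrd, f₁ _ (by omega) (by omega)]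
    · rw [Function.update_self, v₁, f₁ _ (by omega) (by omega), p.one_eq, Nat.div_one]
      rfl
  | cipher m src =>
    obtain ⟨f₁, v₁⟩ := Source.code_spec p (src := src) hi.1
    simp only [Item.code, execCode_append, execCode, Instr.exec]
    generalize execCode (src.code A) μ = μ₁ at *
    have p₁ : Params A K N h μ₁ := p.frame fun r h1 h2 => f₁ r (by omega) (by omega)
    obtain ⟨f₂, v₂⟩ := residueCode_spec p₁ m
    generalize execCode (residueCode A m) μ₁ = μ₂ at *
    have p₂ : Params A K N h μ₂ := p₁.frame fun r h1 h2 => f₂ r (by omega) (by omega)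
    have w₂ : μ₂ (A + 9) = src.val μ := by rw [f₂ _ (by omega) (by omega), v₁]
    obtain ⟨f₃, v₃⟩ := encCode_spec p₂ (by rw [w₂]; exact Source.val_lt μ hi.1 hi.2.2)
    refine ⟨fun r hrd hr => ?_, ?_⟩
    · rw [Function.update_of_ne hrd, f₃ _ hr, f₂ _ (by omega) (by omega),
        f₁ _ (by omega) (by omega)]
    · rw [Function.update_self, v₃, v₂, w₂, f₃ _ (by omega), p₂.one_eq, Nat.div_one]
      rfl

lemma safe_itemCode {A K G d : ℕ} (hG : K ≤ G) (hG0 : 0 < G) (hd : A + 16 ≤ d)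
    {it : Item} (hi : it.Ok A K) : Safe (moduli A) G (it.code A K d) (23 + 31 * K) := by
  have hd' : d ∉ moduli A := by
    simp [moduli]
    omega
  cases it with
  | plain src => exact ((safe_sourceCode hG hi).append (Safe.div _ _ hd')).mono (by omega)
  | cipher m src =>
    exact ((((safe_sourceCode hG hi.1).append (safe_residueCode hG hi.2.1)).append
      (safe_encCode A K G hG0)).append (Safe.div _ _ hd')).mono (by omega)

lemma Item.val_congr {A K N h : ℕ} {μ ν : State} {it : Item} (hi : it.Ok A K)
    (hf : ∀ r, r < A + 8 → ν r = μ r) : it.val N h ν = it.val N h μ := by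
  cases it with
  | plain src => exact Source.val_congr (src := src) hi hf
  | cipher m src => simp only [Item.val]; rw [Source.val_congr hi.1 hf]

/-- Code that writes the entries to the registers from `d` on. -/
def itemsCode (A K : ℕ) : ℕ → List Item → List Instr
  | _, [] => []
  | d, it :: l => it.code A K d ++ itemsCode A K (d + 1) l

/-- Entries read only registers below A + 8, and results are written from A + 16 on, so every entry
is evaluated as in the initial state. -/
lemma itemsCode_spec {A K N h : ℕ} (l : List Item) {d : ℕ} {μ : State} (p : Params A K N h μ)
    (hd : A + 16 ≤ d) (hl : ∀ it ∈ l, it.Ok A K) :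
    (∀ r, (r < A + 8 ∨ (A + 16 ≤ r ∧ r < d) ∨ d + l.length ≤ r) →
      execCode (itemsCode A K d l) μ r = μ r) ∧
    (List.range l.length).map (fun j => execCode (itemsCode A K d l) μ (d + j)) =
      l.map (Item.val N h μ) := by
  induction l generalizing d μ with
  | nil => simp [itemsCode, execCode]
  | cons it l ih =>
    obtain ⟨f₁, v₁⟩ := Item.code_spec (d := d) p (hl it (by simp))
    simp only [itemsCode, execCode_append]
    generalize execCode (it.code A K d) μ = μ₁ at *
    have p₁ : Params A K N h μ₁ := p.frame fun r h1 h2 => f₁ r (by omega) (by omega)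
    have hlow : ∀ r, r < A + 8 → μ₁ r = μ r := fun r hr => f₁ r (by omega) (by omega)
    obtain ⟨f₂, v₂⟩ := ih (d := d + 1) p₁ (by omega)
      (fun it' h' => hl it' (by simp [h']))
    refine ⟨fun r hr => ?_, ?_⟩
    · simp only [List.length_cons] at hr
      rw [f₂ _ (by omega), f₁ _ (by omega) (by omega)]
    · rw [List.length_cons, List.range_succ_eq_map, List.map_cons, List.map_map, List.map_cons]
      congr 1
      · rw [add_zero, f₂ _ (by omega), v₁]
      · have : (fun j => execCode (itemsCode A K (d + 1) l) μ₁ (d + j)) ∘ Nat.succ =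
            fun j => execCode (itemsCode A K (d + 1) l) μ₁ (d + 1 + j) := by
          funext j
          simp only [Function.comp]
          congr 1
          omega
        rw [this, v₂]
        exact List.map_congr_left fun it' h' => Item.val_congr (hl it' (by simp [h'])) hlow

lemma safe_itemsCode {A K G : ℕ} (hG : K ≤ G) (hG0 : 0 < G) (l : List Item) {d : ℕ}
    (hd : A + 16 ≤ d) (hl : ∀ it ∈ l, it.Ok A K) :
    Safe (moduli A) G (itemsCode A K d l) (l.length * (23 + 31 * K)) := by
  induction l generalizing d with
  | nil => simpa [itemsCode] using Safe.nil
  | cons it l ih =>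
    exact ((safe_itemCode hG hG0 hd (hl it (by simp))).append
      (ih (d := d + 1) (by omega) fun it' h' => hl it' (by simp [h']))).mono
        (by rw [List.length_cons]; ring_nf; rfl)

/-! ## Polynomial bounds -/

lemma PolyBounded.of_le {f g : ℕ → ℕ} (hg : PolyBounded g) (h : ∀ κ, f κ ≤ g κ) :
    PolyBounded f := by
  obtain ⟨c, hc⟩ := hg
  exact ⟨c, fun κ => (h κ).trans (hc κ)⟩

lemma PolyBounded.of_pow {f : ℕ → ℕ} (a b : ℕ) (h : ∀ κ, f κ ≤ (κ + a) ^ b) : PolyBounded f := by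
  refine ⟨a + b + 1, fun κ => (h κ).trans ?_⟩
  calc (κ + a) ^ b ≤ (κ + (a + b + 1)) ^ b := Nat.pow_le_pow_left (by omega) _
    _ ≤ _ := Nat.pow_le_pow_right (by omega) (by omega)

lemma polyBounded_const (a : ℕ) : PolyBounded fun _ => a :=
  .of_pow a 1 fun κ => by simp

lemma polyBounded_id : PolyBounded fun κ => κ := .of_pow 0 1 fun κ => by simp

lemma PolyBounded.mul {f g : ℕ → ℕ} (hf : PolyBounded f) (hg : PolyBounded g) :
    PolyBounded fun κ => f κ * g κ := by
  obtain ⟨c, hc⟩ := hf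
  obtain ⟨d, hd⟩ := hg
  refine .of_pow (c + d) (c + d) fun κ => ?_
  rw [pow_add]
  exact Nat.mul_le_mul ((hc κ).trans (Nat.pow_le_pow_left (by omega) _))
    ((hd κ).trans (Nat.pow_le_pow_left (by omega) _))

lemma PolyBounded.add {f g : ℕ → ℕ} (hf : PolyBounded f) (hg : PolyBounded g) :
    PolyBounded fun κ => f κ + g κ := by
  obtain ⟨c, hc⟩ := hf
  obtain ⟨d, hd⟩ := hg
  refine .of_pow (c + d + 2) (c + d + 1) fun κ => ?_
  have h1 : ∀ e, e ≤ c + d → (κ + e) ^ e ≤ (κ + (c + d + 2)) ^ (c + d) := fun e he =>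
    (Nat.pow_le_pow_left (show κ + e ≤ κ + (c + d + 2) by omega) _).trans
      (Nat.pow_le_pow_right (by omega) he)
  have h2 := (hc κ).trans (h1 c (by omega))
  have h3 := (hd κ).trans (h1 d (by omega))
  rw [pow_succ]
  nlinarith

lemma PolyBounded.comp {f g : ℕ → ℕ} (hf : PolyBounded f) (hg : PolyBounded g) :
    PolyBounded fun κ => f (g κ) := by
  obtain ⟨c, hc⟩ := hf
  obtain ⟨d, hd⟩ := hg
  have h : PolyBounded fun κ => (κ + d) ^ d + c := by
    refine PolyBounded.add (.of_pow d d fun _ => le_rfl) (polyBounded_const c)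
  have hpow : ∀ e, PolyBounded fun κ => ((κ + d) ^ d + c) ^ e := by
    intro e
    induction e with
    | zero => simpa using polyBounded_const 1
    | succ e ih => simpa only [pow_succ] using ih.mul h
  exact (hpow c).of_le fun κ => (hc _).trans (Nat.pow_le_pow_left (by have := hd κ; omega) _)

/-- Sizes are bounded in κ, costs in κ plus the input length; a monotone majorant lets both be
evaluated at the same argument. -/
lemma PolyBounded.exists_monotone {f : ℕ → ℕ} (hf : PolyBounded f) :
    ∃ g, PolyBounded g ∧ Monotone g ∧ ∀ κ, f κ ≤ g κ := by
  obtain ⟨c, hc⟩ := hf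
  exact ⟨fun κ => (κ + c) ^ c, ⟨c, fun _ => le_rfl⟩,
    fun a b hab => Nat.pow_le_pow_left (by omega) _, hc⟩

lemma isPPT_of_polyBounded {S : ℕ → Prog} {f : ℕ → ℕ} (hf : PolyBounded f)
    (h : ∀ κ w (ω : Fin (S κ).coins → Bool), (S κ).cost w ω ≤ f (κ + listSize w)) : IsPPT S := by
  obtain ⟨c, hc⟩ := hf
  exact ⟨c, fun κ w ω => (h κ w ω).trans (hc _)⟩

/-! ## Programs that compute lists of values -/

lemma size_le_listSize {w : List ℕ} {a : ℕ} (h : a ∈ w) : a.size + 1 ≤ listSize w :=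
  List.single_le_sum (by simp) _ (List.mem_map_of_mem h)

lemma length_le_listSize (w : List ℕ) : w.length ≤ listSize w := by
  induction w with
  | nil => simp
  | cons a w ih =>
    simp only [listSize, List.map_cons, List.sum_cons, List.length_cons] at *
    omega

lemma listSize_le {w : List ℕ} {B : ℕ} (h : ∀ a ∈ w, a.size ≤ B) :
    listSize w ≤ w.length * (B + 1) := by
  induction w with
  | nil => simp [listSize]
  | cons a w ih =>
    have h1 := ih fun b hb => h b (by simp [hb])
    have h2 := h a (by simp)
    simp only [listSize, List.map_cons, List.sum_cons, List.length_cons] at *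
    rw [add_mul, one_mul]
    omega

lemma boundedState_init (P : Prog) (w : List ℕ) (ω : Fin P.coins → Bool) :
    BoundedState (listSize w + 1) (P.init w ω) := by
  intro i
  rw [Prog.init, List.getD_eq_getElem?_getD]
  rcases h : (w ++ List.ofFn fun j => (ω j).toNat)[i]? with _ | a
  · simp
  · have := List.mem_of_getElem? h
    rw [List.mem_append, List.mem_ofFn] at this
    rcases this with h1 | ⟨j, rfl⟩
    · have := size_le_listSize h1
      simp only [Option.getD_some]
      omega
    · simp only [Option.getD_some]
      cases ω j <;> simp

/-- Preparation of the parameter registers from the input `[N, h, …]`; a modulus `0` is replaced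
by `1`. -/
def initCode (A K : ℕ) : List Instr :=
  [.const (A + 1) 1, .const (A + 2) 2, .const (A + 5) (2 ^ K), .div (A + 4) 1 (A + 1),
    .sub A (A + 1) 0, .add A A 0, .mul (A + 3) A A]

/-- With truncated subtraction 1 - N + N is max(N, 1). The cost must be polynomial on every input,
and reduction modulo 0 is the identity, so with N = 0 repeated squaring could double lengths in each
round. -/
lemma initCode_spec {A K : ℕ} (hA : 2 ≤ A) (μ : State) :
    execCode (initCode A K) μ A = 1 - μ 0 + μ 0 ∧
    execCode (initCode A K) μ (A + 1) = 1 ∧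
    execCode (initCode A K) μ (A + 2) = 2 ∧
    execCode (initCode A K) μ (A + 3) = (1 - μ 0 + μ 0) ^ 2 ∧
    execCode (initCode A K) μ (A + 4) = μ 1 ∧
    execCode (initCode A K) μ (A + 5) = 2 ^ K ∧
    ∀ r, r < A ∨ A + 6 ≤ r → execCode (initCode A K) μ r = μ r := by
  simp only [initCode, execCode, Instr.exec]
  obtain ⟨μ₁, e, v₁, f₁⟩ := exists_update μ (A + 1) 1
  rw [e]; clear e
  obtain ⟨μ₂, e, v₂, f₂⟩ := exists_update μ₁ (A + 2) 2
  rw [e]; clear e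
  obtain ⟨μ₃, e, v₃, f₃⟩ := exists_update μ₂ (A + 5) (2 ^ K)
  rw [e]; clear e
  obtain ⟨μ₄, e, v₄, f₄⟩ := exists_update μ₃ (A + 4) (μ₃ 1 / μ₃ (A + 1))
  rw [e]; clear e
  obtain ⟨μ₅, e, v₅, f₅⟩ := exists_update μ₄ A (μ₄ (A + 1) - μ₄ 0)
  rw [e]; clear e
  obtain ⟨μ₆, e, v₆, f₆⟩ := exists_update μ₅ A (μ₅ A + μ₅ 0)
  rw [e]; clear e
  obtain ⟨μ₇, e, v₇, f₇⟩ := exists_update μ₆ (A + 3) (μ₆ A * μ₆ A)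
  rw [e]; clear e
  have low : ∀ r, r < A → μ₄ r = μ r := by
    intro r hr
    rw [f₄ _ (by omega), f₃ _ (by omega), f₂ _ (by omega), f₁ _ (by omega)]
  have one₃ : μ₃ (A + 1) = 1 := by rw [f₃ _ (by omega), f₂ _ (by omega), v₁]
  have one₄ : μ₄ (A + 1) = 1 := by rw [f₄ _ (by omega), one₃]
  have hA₆ : μ₆ A = 1 - μ 0 + μ 0 := by
    rw [v₆, v₅, one₄, f₅ _ (by omega), low _ (by omega)]
  refine ⟨?_, ?_, ?_, ?_, ?_, ?_, fun r hr => ?_⟩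
  · rw [f₇ _ (by omega), hA₆]
  · rw [f₇ _ (by omega), f₆ _ (by omega), f₅ _ (by omega), one₄]
  · rw [f₇ _ (by omega), f₆ _ (by omega), f₅ _ (by omega), f₄ _ (by omega), f₃ _ (by omega), v₂]
  · rw [v₇, hA₆, sq]
  · rw [f₇ _ (by omega), f₆ _ (by omega), f₅ _ (by omega), v₄, one₃, Nat.div_one,
      f₃ _ (by omega), f₂ _ (by omega), f₁ _ (by omega)]
  · rw [f₇ _ (by omega), f₆ _ (by omega), f₅ _ (by omega), f₄ _ (by omega), v₃]
  · rw [f₇ _ (by omega), f₆ _ (by omega), f₅ _ (by omega), f₄ _ (by omega), f₃ _ (by omega),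
      f₂ _ (by omega), f₁ _ (by omega)]

lemma params_initCode {A K : ℕ} (hA : 2 ≤ A) (hK : 0 < K) {μ : State} (h0 : 0 < μ 0)
    (h1 : μ 0 < 2 ^ K) : Params A K (μ 0) (μ 1) (execCode (initCode A K) μ) := by
  obtain ⟨e0, e1, e2, e3, e4, e5, -⟩ := initCode_spec (K := K) hA μ
  have : 1 - μ 0 + μ 0 = μ 0 := by omega
  rw [this] at e0 e3
  exact ⟨e0, e1, e2, e3, e4, e5, h0, h1, hK⟩

/-- The constants in the instruction have at most `G` bits. -/
def Instr.SmallConst (G : ℕ) : Instr → Prop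
  | .const _ c => c.size ≤ G
  | _ => True

lemma Instr.exec_bounded {G b : ℕ} {I : Instr} (hI : I.SmallConst G) {μ : State}
    (hμ : BoundedState b μ) :
    BoundedState (2 * (b + G + 1)) (I.exec μ) ∧ I.cost μ ≤ 4 * (b + G + 1) := by
  have weak : BoundedState (2 * (b + G + 1)) μ := fun i => (hμ i).trans (by omega)
  cases I with
  | const d c =>
    simp only [Instr.SmallConst] at hI
    exact ⟨weak.update d (by omega), by simp only [Instr.cost]; omega⟩
  | add d x y =>
    have h1 := hμ x
    have h2 := hμ y
    have h3 := size_add_le h1 h2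
    exact ⟨weak.update d (by omega), by simp only [Instr.cost]; omega⟩
  | sub d x y =>
    have h1 := hμ x
    have h2 := hμ y
    have h3 : (μ x - μ y).size ≤ (μ x).size := Nat.size_le_size (Nat.sub_le _ _)
    exact ⟨weak.update d (by omega), by simp only [Instr.cost]; omega⟩
  | mul d x y =>
    have h1 := hμ x
    have h2 := hμ y
    have h3 := size_mul_le (μ x) (μ y)
    exact ⟨weak.update d (by omega), by simp only [Instr.cost]; omega⟩
  | div d x y =>
    have h1 := hμ x
    have h2 := hμ y
    have h3 : (μ x / μ y).size ≤ (μ x).size := Nat.size_le_size (Nat.div_le_self _ _)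
    exact ⟨weak.update d (by omega), by simp only [Instr.cost]; omega⟩
  | mod d x y =>
    have h1 := hμ x
    have h2 := hμ y
    have h3 : (μ x % μ y).size ≤ (μ x).size := Nat.size_le_size (Nat.mod_le _ _)
    exact ⟨weak.update d (by omega), by simp only [Instr.cost]; omega⟩

/-- A crude bound, for short pieces of code. -/
lemma execCode_bounded {G b : ℕ} {code : List Instr} (hc : ∀ I ∈ code, I.SmallConst G) {μ : State}
    (hμ : BoundedState b μ) :
    BoundedState (4 ^ code.length * (b + G + 1)) (execCode code μ) ∧
      codeCost code μ ≤ code.length * (4 ^ (code.length + 1) * (b + G + 1)) := by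
  induction code generalizing b μ with
  | nil => exact ⟨fun i => (hμ i).trans (by simp; omega), by simp [codeCost]⟩
  | cons I code ih =>
    obtain ⟨h1, h2⟩ := I.exec_bounded (hc I (by simp)) hμ
    obtain ⟨h3, h4⟩ := ih (fun J hJ => hc J (by simp [hJ])) h1
    have h5 : 2 * (b + G + 1) + G + 1 ≤ 4 * (b + G + 1) := by omega
    rw [List.length_cons]
    refine ⟨fun i => (h3 i).trans ?_, ?_⟩
    · rw [pow_succ, mul_assoc]
      exact Nat.mul_le_mul_left _ h5
    · rw [codeCost, add_mul, one_mul, add_comm]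
      refine Nat.add_le_add (h4.trans (Nat.mul_le_mul_left _ ?_)) (h2.trans ?_)
      · rw [pow_succ 4 (code.length + 1), mul_assoc]
        exact Nat.mul_le_mul_left _ h5
      · refine Nat.mul_le_mul_right _ ?_
        rw [pow_succ]
        exact Nat.le_mul_of_pos_left _ (by positivity)

lemma initCode_bounded {A K b : ℕ} (hA : 2 ≤ A) {μ : State} (hμ : BoundedState b μ) :
    BoundedState (4 ^ 7 * (b + K + 4)) (execCode (initCode A K) μ) ∧
    (∀ z ∈ moduli A, execCode (initCode A K) μ z ≠ 0) ∧
    codeCost (initCode A K) μ ≤ 7 * (4 ^ 8 * (b + K + 4)) := by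
  obtain ⟨e0, e1, e2, e3, e4, e5, e6⟩ := initCode_spec (K := K) hA μ
  obtain ⟨h1, h2⟩ := execCode_bounded (G := K + 3) (code := initCode A K) (b := b) (by
    intro I hI
    simp only [initCode, List.mem_cons, List.not_mem_nil, or_false] at hI
    rcases hI with rfl | rfl | rfl | rfl | rfl | rfl | rfl <;> simp [Instr.SmallConst]
    · rw [Nat.size_le]
      exact lt_of_lt_of_le (by norm_num : 2 < 2 ^ 2) (Nat.pow_le_pow_right (by norm_num) (by omega))
    · rw [Nat.size_pow]
      omega) hμ
  refine ⟨h1, ?_, h2⟩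
  have : 1 - μ 0 + μ 0 ≠ 0 := by omega
  simp only [moduli, List.mem_cons, List.not_mem_nil, or_false, forall_eq_or_imp, forall_eq]
  rw [e0, e3, e5]
  exact ⟨this, pow_ne_zero _ this, by positivity⟩

/-- Preparation, further code, and the computation of a list of entries. -/
def listCode (A K : ℕ) (mid : List Instr) (items : List Item) : List Instr :=
  initCode A K ++ mid ++ itemsCode A K (A + 16) items

lemma listCode_bounded {A K k b : ℕ} {mid : List Instr} {items : List Item} (hA : 2 ≤ A)
    (hmid : Safe (moduli A) (K + 1) mid k) (hit : ∀ it ∈ items, it.Ok A K) {μ : State}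
    (hμ : BoundedState b μ) :
    BoundedState (4 ^ 7 * (b + K + 4)) (execCode (listCode A K mid items) μ) ∧
      codeCost (listCode A K mid items) μ ≤
        (28 + k + items.length * (23 + 31 * K)) * (4 ^ 8 * (b + K + 4) + 2) := by
  obtain ⟨h1, h2, h3⟩ := initCode_bounded (K := K) hA hμ
  have hs := hmid.append (safe_itemsCode (G := K + 1) (by omega) (by omega) items le_rfl hit)
  obtain ⟨h4, -, h6⟩ := hs (4 ^ 7 * (b + K + 4)) (by omega) _ h1 h2
  rw [listCode, List.append_assoc, execCode_append, codeCost_append]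
  refine ⟨h4, (Nat.add_le_add h3 h6).trans ?_⟩
  have : 4 * (4 ^ 7 * (b + K + 4)) + 2 = 4 ^ 8 * (b + K + 4) + 2 := by ring
  rw [this, add_assoc 28, add_mul 28]
  exact Nat.add_le_add_right (by omega) _

/-- The program that outputs a list of entries. -/
def listProg (coins A K : ℕ) (mid : List Instr) (items : List Item) : Prog where
  coins := coins
  code := listCode A K mid items
  out := (List.range items.length).map (A + 16 + ·)

lemma listProg_cost {coins A K k : ℕ} {mid : List Instr} {items : List Item} (hA : 2 ≤ A)
    (hmid : Safe (moduli A) (K + 1) mid k) (hit : ∀ it ∈ items, it.Ok A K) (w : List ℕ)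
    (ω : Fin (listProg coins A K mid items).coins → Bool) :
    (listProg coins A K mid items).cost w ω ≤
      coins + (28 + k + items.length * (23 + 31 * K)) * (4 ^ 8 * (listSize w + 1 + K + 4) + 2) +
        items.length * (4 ^ 7 * (listSize w + 1 + K + 4) + 1) := by
  obtain ⟨h1, h2⟩ := listCode_bounded (items := items) hA hmid hit
    (boundedState_init (listProg coins A K mid items) w ω)
  refine Nat.add_le_add (Nat.add_le_add_left h2 _) ((listSize_le (B := 4 ^ 7 * (listSize w + 1 + K + 4)) ?_).trans
    (Nat.mul_le_mul_right _ ?_))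
  · intro a ha
    simp only [Prog.run, List.mem_map] at ha
    obtain ⟨r, -, rfl⟩ := ha
    exact h1 r
  · simp [Prog.run, listProg]

lemma isPPT_listProg {S : ℕ → Prog} {p : ℕ → ℕ} (hp : PolyBounded p)
    (h : ∀ κ, ∃ coins A K k mid items, S κ = listProg coins A K mid items ∧ 2 ≤ A ∧
      Safe (moduli A) (K + 1) mid k ∧ (∀ it ∈ items, it.Ok A K) ∧
      coins ≤ p κ ∧ K ≤ p κ ∧ k ≤ p κ ∧ items.length ≤ p κ) : IsPPT S := by
  obtain ⟨P, hP, hmono, hle⟩ := hp.exists_monotone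
  have c := polyBounded_const
  have hb : ∀ e, PolyBounded fun u => e * (u + 1 + P u + 4) := fun e =>
    (c e).mul (((polyBounded_id.add (c 1)).add hP).add (c 4))
  refine isPPT_of_polyBounded (f := fun u =>
    P u + (28 + P u + P u * (23 + 31 * P u)) * (4 ^ 8 * (u + 1 + P u + 4) + 2) +
      P u * (4 ^ 7 * (u + 1 + P u + 4) + 1)) ?_ ?_
  · exact (hP.add ((((c 28).add hP).add (hP.mul ((c 23).add ((c 31).mul hP)))).mul
      ((hb _).add (c 2)))).add (hP.mul ((hb _).add (c 1)))
  · intro κ w ω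
    obtain ⟨coins, A, K, k, mid, items, hS, hA, hmid, hit, h1, h2, h3, h4⟩ := h κ
    revert ω
    rw [hS]
    intro ω
    refine (listProg_cost hA hmid hit w ω).trans ?_
    have hu : p κ ≤ P (κ + listSize w) := (hle κ).trans (hmono (by omega))
    have g1 := h1.trans hu
    have g2 := h2.trans hu
    have g3 := h3.trans hu
    have g4 := h4.trans hu
    gcongr <;> omega

lemma execCode_listCode {A K : ℕ} {mid : List Instr} {items : List Item} {μ ν : State}
    (hν : execCode mid (execCode (initCode A K) μ) = ν) {N h : ℕ} (p : Params A K N h ν)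
    (hit : ∀ it ∈ items, it.Ok A K) :
    (∀ r, A + 16 + items.length ≤ r → execCode (listCode A K mid items) μ r = ν r) ∧
    (List.range items.length).map (fun j => execCode (listCode A K mid items) μ (A + 16 + j)) =
      items.map (Item.val N h ν) := by
  obtain ⟨h1, h2⟩ := itemsCode_spec items p (le_refl (A + 16)) hit
  rw [listCode, List.append_assoc, execCode_append, execCode_append, hν]
  exact ⟨fun r hr => h1 r (by omega), h2⟩

lemma listProg_run {coins A K : ℕ} {mid : List Instr} {items : List Item} {w : List ℕ}
    {ω : Fin (listProg coins A K mid items).coins → Bool} {ν : State}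
    (hν : execCode mid (execCode (initCode A K) ((listProg coins A K mid items).init w ω)) = ν)
    {N h : ℕ} (p : Params A K N h ν) (hit : ∀ it ∈ items, it.Ok A K) :
    (listProg coins A K mid items).run w ω = items.map (Item.val N h ν) := by
  rw [← (execCode_listCode hν p hit).2]
  simp [Prog.run, listProg, Function.comp_def]

/-! ## Random bits -/

/-- The bits of `ω`, followed by zeros. -/
def coinStream {b : ℕ} (ω : Fin b → Bool) : ℕ → ℕ := fun j => if h : j < b then (ω ⟨j, h⟩).toNat else 0

/-- The first `s` blocks of `k` bits of a stream. -/
def blocks (s k : ℕ) (β : ℕ → ℕ) : Fin s → ℕ := fun i => bitsVal β (i * k) k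

/-- The stream without its first `o` bits. -/
def dropBits (o : ℕ) (β : ℕ → ℕ) : ℕ → ℕ := fun j => β (o + j)

lemma bitsVal_dropBits (o a k : ℕ) (β : ℕ → ℕ) : bitsVal (dropBits o β) a k = bitsVal β (o + a) k := by
  simp [bitsVal, dropBits, add_assoc]

/-- The bits are the base-2 digits of the number; this gives injectivity in `expect_blocks`. -/
lemma bit_eq_of_bitsVal_eq {β β' : ℕ → ℕ} {o k j : ℕ} (h : bitsVal β o k = bitsVal β' o k)
    (hj : j < k) : β (o + j) % 2 = β' (o + j) % 2 := by
  have d : ∀ γ : ℕ → ℕ, bitsVal γ o k % 2 ^ (j + 1) / 2 ^ j = γ (o + j) % 2 := fun γ =>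
    sum_mul_pow_digit (u := fun j => γ (o + j) % 2) (fun _ => Nat.mod_lt _ (by norm_num)) hj
  rw [← d, ← d, h]

lemma coinStream_natAdd {a b : ℕ} (ω : Fin (a + b) → Bool) :
    coinStream (fun j => ω (Fin.natAdd a j)) = dropBits a (coinStream ω) := by
  funext j
  simp only [coinStream, dropBits, add_lt_add_iff_left]
  rfl

/-- Blocks of random bits are independent and uniform random numbers. -/
lemma expect_blocks (s k b : ℕ) (F : (Fin s → ℕ) → (ℕ → ℕ) → ℝ) :
    (𝔼 ω : Fin (s * k + b) → Bool,
      F (blocks s k (coinStream ω)) (dropBits (s * k) (coinStream ω))) =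
    𝔼 ρ : Fin s → Fin (2 ^ k), 𝔼 ω : Fin b → Bool, F (fun i => ρ i) (coinStream ω) := by
  let φ : (Fin (s * k + b) → Bool) → (Fin s → Fin (2 ^ k)) × (Fin b → Bool) := fun ω =>
    (fun i => ⟨blocks s k (coinStream ω) i, bitsVal_lt _ _ _⟩, fun j => ω (Fin.natAdd (s * k) j))
  have hφ : Function.Bijective φ := by
    -- Both sides have 2^(sk + b) elements, so injectivity suffices. Bit j < sk is digit j mod k of
    -- block j / k.
    rw [Fintype.bijective_iff_injective_and_card]
    refine ⟨fun ω ω' h => ?_, ?_⟩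
    · have h1 : ∀ i, blocks s k (coinStream ω) i = blocks s k (coinStream ω') i := fun i =>
        congrArg Fin.val (congrFun (congrArg Prod.fst h) i)
      have h2 : ∀ j, ω (Fin.natAdd (s * k) j) = ω' (Fin.natAdd (s * k) j) :=
        congrFun (congrArg Prod.snd h)
      funext j
      refine Fin.addCases (fun j => ?_) h2 j
      have hk : 0 < k := by
        rcases Nat.eq_zero_or_pos k with rfl | hk
        · exact absurd j.2 (by simp)
        · exact hk
      have hi : (j : ℕ) / k < s := Nat.div_lt_of_lt_mul (j.2.trans_eq (mul_comm s k))
      have h3 := bit_eq_of_bitsVal_eq (h1 ⟨_, hi⟩) (Nat.mod_lt (j : ℕ) hk)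
      simp only at h3
      rw [Nat.div_add_mod'] at h3
      have h4 : (j : ℕ) < s * k + b := by have := j.2; omega
      simp only [coinStream, h4, dif_pos] at h3
      have h5 : (⟨(j : ℕ), h4⟩ : Fin (s * k + b)) = Fin.castAdd b j := rfl
      rw [h5] at h3
      revert h3
      cases ω (Fin.castAdd b j) <;> cases ω' (Fin.castAdd b j) <;> simp
    · simp [pow_add, pow_mul, mul_comm s k]
  rw [← Finset.expect_product', Finset.univ_product_univ]
  refine Fintype.expect_bijective φ hφ _ _ fun ω => ?_
  simp only [φ]
  rw [coinStream_natAdd]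

/-! ## Expectations -/

section

variable {ι A : Type*}

/-- The empty set, with expectation 0, must be covered because `NGen` may be empty for some
parameters. -/
lemma abs_expect_le_of_forall {S : Finset A} {f : A → ℝ} {ε : ℝ} (hε : 0 ≤ ε)
    (h : ∀ a ∈ S, |f a| ≤ ε) : |𝔼 a ∈ S, f a| ≤ ε := by
  rcases S.eq_empty_or_nonempty with rfl | hS
  · simpa using hε
  · exact (Finset.abs_expect_le _ _).trans (Finset.expect_le hS h)

lemma abs_expect_sub_le {S : Finset A} {f g : A → ℝ} {ε : ℝ} (hε : 0 ≤ ε)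
    (h : ∀ a ∈ S, |f a - g a| ≤ ε) : |𝔼 a ∈ S, f a - 𝔼 a ∈ S, g a| ≤ ε := by
  rw [← Finset.expect_sub_distrib]
  exact abs_expect_le_of_forall hε h

variable [Fintype A] [Fintype ι] [DecidableEq ι]

/-- Resampling one coordinate does not change a uniform distribution. -/
lemma expect_resample [Nonempty A] (F : (ι → A) → ℝ) (i : ι) :
    𝔼 a : ι → A, F a = 𝔼 a : ι → A, 𝔼 a' : A, F (Function.update a i a') := by
  have h1 : 𝔼 a : ι → A, F a = 𝔼 a : ι → A, 𝔼 _a' : A, F a := by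
    simp only [Fintype.expect_const]
  rw [h1, ← Finset.expect_product', ← Finset.expect_product']
  -- Exchange coordinate i with the spare sample; this is an involution of the product space.
  let e : (ι → A) × A → (ι → A) × A := fun z => (Function.update z.1 i z.2, z.1 i)
  have he : Function.Involutive e := fun z => by simp [e]
  refine Finset.expect_nbij' e e (by simp) (by simp) (fun z _ => he z) (fun z _ => he z) ?_
  intro z _
  simp [e]

/-- The hybrid argument. -/
lemma hybrid [Nonempty A] {Y : Type*} (g : Bool → ι → A → Y) (f : (ι → Y) → ℝ) {ε : ℝ}
    (h : ∀ (i : ι) (b : ι → Bool) (a : ι → A),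
      |(𝔼 a' : A, f (Function.update (fun j => g (b j) j (a j)) i (g false i a'))) -
        𝔼 a' : A, f (Function.update (fun j => g (b j) j (a j)) i (g true i a'))| ≤ ε) :
    |(𝔼 a : ι → A, f fun j => g false j (a j)) - 𝔼 a : ι → A, f fun j => g true j (a j)| ≤
      Fintype.card ι * ε := by
  -- S is the set of coordinates already switched. Enlarging S by i changes only coordinate i, which
  -- is resampled so that all others are fixed when the hypothesis is applied.
  suffices H : ∀ S : Finset ι,
      |(𝔼 a : ι → A, f fun j => g false j (a j)) -
        𝔼 a : ι → A, f fun j => g (decide (j ∈ S)) j (a j)| ≤ S.card * ε by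
    simpa using H Finset.univ
  intro S
  induction S using Finset.induction_on with
  | empty => simp
  | insert i S hi ih =>
    have hε : 0 ≤ ε := (abs_nonneg _).trans
      (h i (fun _ => false) (fun _ => Classical.arbitrary A))
    have key : |(𝔼 a : ι → A, f fun j => g (decide (j ∈ S)) j (a j)) -
        𝔼 a : ι → A, f fun j => g (decide (j ∈ insert i S)) j (a j)| ≤ ε := by
      rw [expect_resample _ i, expect_resample (fun a => f fun j => g (decide (j ∈ insert i S)) j (a j)) i]
      refine abs_expect_sub_le hε fun a _ => ?_
      have e1 : ∀ a' : A, (fun j => g (decide (j ∈ S)) j (Function.update a i a' j)) =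
          Function.update (fun j => g (decide (j ∈ S)) j (a j)) i (g false i a') := by
        intro a'
        funext j
        by_cases hj : j = i
        · subst hj
          simp [hi]
        · simp [hj]
      have e2 : ∀ a' : A, (fun j => g (decide (j ∈ insert i S)) j (Function.update a i a' j)) =
          Function.update (fun j => g (decide (j ∈ S)) j (a j)) i (g true i a') := by
        intro a'
        funext j
        by_cases hj : j = i
        · subst hj
          simp
        · simp [hj]
      simp only [e1, e2]
      exact h i _ a
    rw [Finset.card_insert_of_notMem hi]
    push_cast
    calc _ ≤ _ + _ := abs_sub_le _ (𝔼 a : ι → A, f fun j => g (decide (j ∈ S)) j (a j)) _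
      _ ≤ S.card * ε + ε := add_le_add ih key
      _ = _ := by ring

end

/-- Adding a fixed number to a uniform random number below `R` changes the distribution by at most
`|x| / R`. -/
lemma abs_expect_shift_sub_le {R : ℕ} (hR : 0 < R) (x : ℤ) {f : ℤ → ℝ} (h0 : ∀ z, 0 ≤ f z)
    (h1 : ∀ z, f z ≤ 1) :
    |(𝔼 r : Fin R, f (x + r)) - 𝔼 r : Fin R, f r| ≤ |(x : ℝ)| / R := by
  have hR' : (0 : ℝ) < R := by exact_mod_cast hR
  have e : ∀ y : ℤ, (𝔼 r : Fin R, f (y + r)) = (∑ z ∈ Finset.Ico y (y + R), f z) / R := by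
    intro y
    rw [Fintype.expect_eq_sum_div_card, Fintype.card_fin]
    congr 1
    refine Finset.sum_bij (fun r _ => y + (r : ℤ)) ?_ ?_ ?_ ?_
    · intro r _
      have := r.2
      simp only [Finset.mem_Ico]
      omega
    · intro r _ r' _ h
      have : (r : ℤ) = r' := by simpa using h
      exact Fin.ext (by exact_mod_cast this)
    · intro z hz
      rw [Finset.mem_Ico] at hz
      exact ⟨⟨(z - y).toNat, by omega⟩, Finset.mem_univ _, by simp; omega⟩
    · intro r _
      rfl
  have e0 := e 0
  simp only [zero_add] at e0
  rw [e, e0, ← sub_div, abs_div, abs_of_pos hR']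
  refine div_le_div_of_nonneg_right ?_ hR'.le
  have hc : ∀ S : Finset ℤ, 0 ≤ ∑ z ∈ S, f z ∧ ∑ z ∈ S, f z ≤ S.card := by
    intro S
    refine ⟨Finset.sum_nonneg fun z _ => h0 z, ?_⟩
    have := Finset.sum_le_card_nsmul S f 1 fun z _ => h1 z
    simpa using this
  -- The common part of the windows [0, R) and [x, x + R) cancels. Both remainders have at most |x|
  -- elements, and their sums are non-negative, so the difference is bounded by |x| and not by 2|x|.
  have hd := Finset.sum_sdiff_sub_sum_sdiff (s₁ := Finset.Ico (0 : ℤ) R) (s₂ := Finset.Ico x (x + R)) (f := f)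
  rw [← hd]
  obtain ⟨p1, p2⟩ := hc (Finset.Ico x (x + R) \ Finset.Ico (0 : ℤ) R)
  obtain ⟨q1, q2⟩ := hc (Finset.Ico (0 : ℤ) R \ Finset.Ico x (x + R))
  have c1 : ((Finset.Ico x (x + R) \ Finset.Ico (0 : ℤ) R).card : ℝ) ≤ |(x : ℝ)| := by
    have : (Finset.Ico x (x + R) \ Finset.Ico (0 : ℤ) R).card ≤ x.natAbs := by
      have hsub : Finset.Ico x (x + R) \ Finset.Ico (0 : ℤ) R ⊆
          if 0 ≤ x then Finset.Ico (R : ℤ) (x + R) else Finset.Ico x 0 := by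
        intro z hz
        rw [Finset.mem_sdiff, Finset.mem_Ico, Finset.mem_Ico] at hz
        split_ifs <;> rw [Finset.mem_Ico] <;> omega
      refine (Finset.card_le_card hsub).trans ?_
      split_ifs <;> rw [Int.card_Ico] <;> omega
    calc _ ≤ ((x.natAbs : ℕ) : ℝ) := by exact_mod_cast this
      _ = _ := by rw [Nat.cast_natAbs]; simp
  have c2 : ((Finset.Ico (0 : ℤ) R \ Finset.Ico x (x + R)).card : ℝ) ≤ |(x : ℝ)| := by
    have : (Finset.Ico (0 : ℤ) R \ Finset.Ico x (x + R)).card ≤ x.natAbs := by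
      have hsub : Finset.Ico (0 : ℤ) R \ Finset.Ico x (x + R) ⊆
          if 0 ≤ x then Finset.Ico 0 x else Finset.Ico (x + R) R := by
        intro z hz
        rw [Finset.mem_sdiff, Finset.mem_Ico, Finset.mem_Ico] at hz
        split_ifs <;> rw [Finset.mem_Ico] <;> omega
      refine (Finset.card_le_card hsub).trans ?_
      split_ifs <;> rw [Int.card_Ico] <;> omega
    calc _ ≤ ((x.natAbs : ℕ) : ℝ) := by exact_mod_cast this
      _ = _ := by rw [Nat.cast_natAbs]; simp
  rw [abs_le]
  constructor <;> linarith

/-! ## Negligible functions -/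

lemma Negligible.of_le {f g : ℕ → ℝ} (hg : Negligible g) (h0 : ∀ κ, 0 ≤ f κ) (h : ∀ κ, f κ ≤ g κ) :
    Negligible f := by
  intro c
  refine squeeze_zero (fun κ => ?_) (fun κ => ?_) (hg c)
  · exact mul_nonneg (by positivity) (h0 κ)
  · exact mul_le_mul_of_nonneg_left (h κ) (by positivity)

lemma Negligible.polyBounded_mul {p : ℕ → ℕ} (hp : PolyBounded p) {f : ℕ → ℝ} (hf : Negligible f)
    (h0 : ∀ κ, 0 ≤ f κ) : Negligible fun κ => p κ * f κ := by
  obtain ⟨c, hc⟩ := hp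
  have h1 : Negligible fun κ => ((κ : ℝ) + c) ^ c * f κ := by
    have := Asymptotics.SuperpolynomialDecay.polynomial_mul hf
      ((Polynomial.X + Polynomial.C (c : ℝ)) ^ c)
    simpa [Negligible] using this
  refine h1.of_le (fun κ => mul_nonneg (by positivity) (h0 κ)) fun κ => ?_
  refine mul_le_mul_of_nonneg_right ?_ (h0 κ)
  exact_mod_cast hc κ

lemma acceptProb_nonneg (P : Prog) (w : List ℕ) : 0 ≤ P.acceptProb w :=
  Finset.expect_nonneg fun ω _ => by split_ifs <;> norm_num

lemma acceptProb_le_one (P : Prog) (w : List ℕ) : P.acceptProb w ≤ 1 :=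
  Finset.expect_le Finset.univ_nonempty fun ω _ => by split_ifs <;> norm_num

/-! ## Running a distinguisher on a computed list -/

/-- Destination register of an instruction. -/
def Instr.dest : Instr → ℕ
  | .const d _ | .add d _ _ | .sub d _ _ | .mul d _ _ | .div d _ _ | .mod d _ _ => d

lemma Instr.exec_of_ne (I : Instr) (μ : State) {r : ℕ} (h : r ≠ I.dest) : I.exec μ r = μ r := by
  cases I <;> exact Function.update_of_ne h _ _

lemma execCode_of_dest_ne {code : List Instr} (μ : State) {r : ℕ} (h : ∀ I ∈ code, r ≠ I.dest) :
    execCode code μ r = μ r := by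
  induction code generalizing μ with
  | nil => rfl
  | cons I code ih =>
    rw [execCode, ih _ fun J hJ => h J (by simp [hJ]), I.exec_of_ne μ (h I (by simp))]

/-- All destination registers are below `M`. -/
def DestLt (M : ℕ) (code : List Instr) : Prop := ∀ I ∈ code, I.dest < M

lemma DestLt.append {M : ℕ} {a b : List Instr} (ha : DestLt M a) (hb : DestLt M b) :
    DestLt M (a ++ b) := by
  intro I hI
  rcases List.mem_append.mp hI with h | h
  · exact ha I h
  · exact hb I h

lemma DestLt.mono {M M' : ℕ} {a : List Instr} (ha : DestLt M a) (h : M ≤ M') : DestLt M' a :=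
  fun I hI => (ha I hI).trans_le h

lemma destLt_powCode (A K m b e : ℕ) : DestLt (A + 16) (powCode A K m b e) := by
  refine DestLt.append ?_ ?_
  · simp [DestLt, Instr.dest]
  · intro I hI
    obtain ⟨l, hl, hI⟩ := List.mem_flatten.mp hI
    rw [List.eq_of_mem_replicate hl] at hI
    have h : DestLt (A + 16) (powStep A m) := by
      simp [DestLt, powStep, mulMod, addMod, Instr.dest]
    exact h I hI

lemma destLt_encCode (A K : ℕ) : DestLt (A + 16) (encCode A K) := by
  refine ((((destLt_powCode _ _ _ _ _).append (destLt_powCode _ _ _ _ _)).append ?_).append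
    ?_).append ?_ <;> simp [DestLt, mulMod, addMod, Instr.dest]

lemma destLt_bitsCode (A o k : ℕ) : DestLt (A + 16) (bitsCode A o k) := by
  induction k generalizing o with
  | zero => simp [DestLt, bitsCode, Instr.dest]
  | succ k ih =>
    refine (((ih _).append ?_).append ?_).append ?_ <;> simp [DestLt, addMod, Instr.dest]

lemma destLt_sourceCode (A : ℕ) (src : Source) : DestLt (A + 16) (src.code A) := by
  cases src with
  | cst c => simp [DestLt, Source.code, Instr.dest]
  | reg i => simp [DestLt, Source.code, Instr.dest]
  | bits o k => exact destLt_bitsCode A o k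

lemma destLt_itemCode {A K d : ℕ} (hd : A + 16 ≤ d) (it : Item) :
    DestLt (d + 1) (it.code A K d) := by
  have h : DestLt (d + 1) [.div d (A + 9) (A + 1)] ∧ DestLt (d + 1) [.div d (A + 10) (A + 1)] := by
    simp [DestLt, Instr.dest]
  cases it with
  | plain src => exact ((destLt_sourceCode A src).mono (by omega)).append h.1
  | cipher m src =>
    refine ((((destLt_sourceCode A src).append ?_).append (destLt_encCode A K)).mono
      (by omega)).append h.2
    simp [DestLt, residueCode, addMod, Instr.dest]

lemma destLt_itemsCode {A K : ℕ} (l : List Item) {d : ℕ} (hd : A + 16 ≤ d) :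
    DestLt (d + l.length) (itemsCode A K d l) := by
  induction l generalizing d with
  | nil => simp [DestLt, itemsCode]
  | cons it l ih =>
    rw [List.length_cons]
    exact ((destLt_itemCode hd it).mono (by omega)).append
      ((ih (d := d + 1) (by omega)).mono (by omega))

lemma destLt_listCode {A K : ℕ} {mid : List Instr} (hmid : DestLt (A + 16) mid) (items : List Item) :
    DestLt (A + 16 + items.length) (listCode A K mid items) := by
  refine DestLt.append (DestLt.append ?_ (hmid.mono (by omega))) (destLt_itemsCode items le_rfl)
  refine DestLt.mono (M := A + 16) ?_ (by omega)
  simp [DestLt, initCode, Instr.dest]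

/-- Renaming of registers. -/
def Instr.map (f : ℕ → ℕ) : Instr → Instr
  | .const d c => .const (f d) c
  | .add d a b => .add (f d) (f a) (f b)
  | .sub d a b => .sub (f d) (f a) (f b)
  | .mul d a b => .mul (f d) (f a) (f b)
  | .div d a b => .div (f d) (f a) (f b)
  | .mod d a b => .mod (f d) (f a) (f b)

lemma Instr.exec_map {f : ℕ → ℕ} (hf : Function.Injective f) (I : Instr) (μ : State) :
    (I.map f).exec μ ∘ f = I.exec (μ ∘ f) := by
  cases I <;> exact Function.update_comp_eq_of_injective _ hf _ _

lemma Instr.cost_map (f : ℕ → ℕ) (I : Instr) (μ : State) : (I.map f).cost μ = I.cost (μ ∘ f) := by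
  cases I <;> rfl

/-- Pulling a state back along an injective renaming commutes with every instruction. So a
distinguisher can run in a shifted block of registers, at its original cost by `codeCost_map`. -/
lemma execCode_map {f : ℕ → ℕ} (hf : Function.Injective f) (code : List Instr) (μ : State) :
    execCode (code.map (Instr.map f)) μ ∘ f = execCode code (μ ∘ f) := by
  induction code generalizing μ with
  | nil => rfl
  | cons I code ih => rw [List.map_cons, execCode, ih, I.exec_map hf, execCode]

lemma codeCost_map {f : ℕ → ℕ} (hf : Function.Injective f) (code : List Instr) (μ : State) :
    codeCost (code.map (Instr.map f)) μ = codeCost code (μ ∘ f) := by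
  induction code generalizing μ with
  | nil => rfl
  | cons I code ih => rw [List.map_cons, codeCost, ih, I.exec_map hf, codeCost, I.cost_map]

lemma Instr.dest_map (f : ℕ → ℕ) (I : Instr) : (I.map f).dest = f I.dest := by
  cases I <;> rfl

lemma BoundedState.mono {b b' : ℕ} {μ : State} (h : BoundedState b μ) (hb : b ≤ b') :
    BoundedState b' μ := fun i => (h i).trans hb

/-- The cost of an instruction includes the length of its result, so lengths cannot grow by more
than the total cost. This bounds the state left by an arbitrary distinguisher. -/
lemma execCode_bounded_cost {b : ℕ} (code : List Instr) {μ : State} (hμ : BoundedState b μ) :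
    BoundedState (b + codeCost code μ) (execCode code μ) := by
  induction code generalizing b μ with
  | nil => exact hμ
  | cons I code ih =>
    have h1 : BoundedState (b + I.cost μ) (I.exec μ) := by
      have weak := hμ.mono (Nat.le_add_right b (I.cost μ))
      cases I <;> exact weak.update _ (by simp only [Instr.cost]; omega)
    rw [codeCost, ← add_assoc]
    exact ih h1

/-- Multiplication of the number in register `r` by the indicator of `2 ^ m ≤ N`; the result is
in register `A + 8`. -/
def maskCode (A r m : ℕ) : List Instr :=
  [.const (A + 8) (2 ^ m), .div (A + 8) 0 (A + 8), .const (A + 9) 1, .sub (A + 8) (A + 9) (A + 8),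
    .sub (A + 8) (A + 9) (A + 8), .mul (A + 8) (A + 8) r]

/-- With truncated subtraction 1 - (1 - N / 2^m) is the indicator of N ≥ 2^m, obtained without
branching. -/
lemma maskCode_spec {A r m : ℕ} (hA : 0 < A) (hr : A + 16 ≤ r) (μ : State) :
    execCode (maskCode A r m) μ (A + 8) = if 2 ^ m ≤ μ 0 then μ r else 0 := by
  simp only [maskCode, execCode, Instr.exec]
  obtain ⟨μ₁, e, v₁, f₁⟩ := exists_update μ (A + 8) (2 ^ m)
  rw [e]; clear e
  obtain ⟨μ₂, e, v₂, f₂⟩ := exists_update μ₁ (A + 8) (μ₁ 0 / μ₁ (A + 8))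
  rw [e]; clear e
  obtain ⟨μ₃, e, v₃, f₃⟩ := exists_update μ₂ (A + 9) 1
  rw [e]; clear e
  obtain ⟨μ₄, e, v₄, f₄⟩ := exists_update μ₃ (A + 8) (μ₃ (A + 9) - μ₃ (A + 8))
  rw [e]; clear e
  obtain ⟨μ₅, e, v₅, f₅⟩ := exists_update μ₄ (A + 8) (μ₄ (A + 9) - μ₄ (A + 8))
  rw [e]; clear e
  rw [Function.update_self, v₅, v₄, f₄ _ (by omega), v₃, f₃ _ (by omega), v₂, v₁, f₁ _ (by omega),
    f₅ _ (by omega), f₄ _ (by omega), f₃ _ (by omega), f₂ _ (by omega), f₁ _ (by omega)]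
  split_ifs with h
  · have : 0 < μ 0 / 2 ^ m := Nat.div_pos h (by positivity)
    have h2 : 1 - (1 - μ 0 / 2 ^ m) = 1 := by omega
    rw [h2, one_mul]
  · rw [Nat.div_eq_of_lt (by omega)]
    simp

/-- The entries, computed from an input of length `3`, followed by the random bits. -/
def withCoins (D : Prog) (items : List Item) : List Item :=
  items ++ (List.range D.coins).map fun j => .plain (.reg (3 + j))

/-- The program that runs `D` on a computed list of entries and accepts only if `2 ^ m ≤ N`. -/
def reductionProg (D : Prog) (K m : ℕ) (items : List Item) : Prog where
  coins := D.coins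
  code := listCode (3 + D.coins) K [] (withCoins D items) ++
    D.code.map (Instr.map (3 + D.coins + 16 + ·)) ++
    maskCode (3 + D.coins) (3 + D.coins + 16 + D.out.headD 0) m
  out := (D.out.take 1).map fun _ => 3 + D.coins + 8

/-! ### Cost and acceptance probability of the reduction. -/

lemma withCoins_ok {D : Prog} {K : ℕ} {items : List Item}
    (hit : ∀ it ∈ items, it.Ok (3 + D.coins) K) :
    ∀ it ∈ withCoins D items, it.Ok (3 + D.coins) K := by
  intro it h
  rcases List.mem_append.mp h with h | h
  · exact hit it h
  · obtain ⟨j, hj, rfl⟩ := List.mem_map.mp h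
    have := List.mem_range.mp hj
    simp only [Item.Ok, Source.Ok]
    omega

lemma shift_injective (o : ℕ) : Function.Injective (o + ·) := add_right_injective o

lemma init_eq_zero (P : Prog) (w : List ℕ) (ω : Fin P.coins → Bool) {r : ℕ}
    (h : w.length + P.coins ≤ r) : P.init w ω r = 0 := by
  rw [Prog.init, List.getD_eq_default]
  simpa using h

/-- A cost bound for a program speaks only of initial states. Any state that vanishes from some
register on is one: its entries are the input, and all coins are false. -/
lemma init_ofFn (P : Prog) (M : ℕ) {μ : State} (h : ∀ r, M ≤ r → μ r = 0) :
    P.init (List.ofFn fun i : Fin M => μ i) (fun _ => false) = μ := by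
  funext i
  rw [Prog.init, List.getD_eq_getElem?_getD]
  by_cases hi : i < M
  · rw [List.getElem?_append_left (by simpa using hi)]
    simp [hi]
  · rw [List.getElem?_append_right (by simpa using hi), h i (by omega)]
    rcases h2 : (List.ofFn fun j : Fin P.coins => (false : Bool).toNat)[i - (List.ofFn fun i : Fin M => μ i).length]? with _ | a
    · rfl
    · have := List.mem_of_getElem? h2
      rw [List.mem_ofFn] at this
      obtain ⟨_, rfl⟩ := this
      rfl

/-- On a malformed input the distinguisher does not start in a state of the intended form. Its
registers are then read as a longer input with zero coins, to which its cost bound T applies; b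
bounds the length of the input, and l the number of computed entries. -/
lemma reductionProg_cost {D : Prog} {K m : ℕ} {items : List Item} {T : ℕ → ℕ} (hT : Monotone T)
    (hD : ∀ w (ω : Fin D.coins → Bool), D.cost w ω ≤ T (listSize w)) (hm : m ≤ K)
    (hit : ∀ it ∈ items, it.Ok (3 + D.coins) K) {b l : ℕ} (hl : items.length + D.coins ≤ l)
    (w : List ℕ) (hw : listSize w + 1 ≤ b) : ∀ ω : Fin (reductionProg D K m items).coins → Bool,
    (reductionProg D K m items).cost w ω ≤
      l + (28 + l * (23 + 31 * K)) * (4 ^ 8 * (b + K + 4) + 2) +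
      T ((b + 2 * l + 19) * (4 ^ 7 * (b + K + 4) + 1)) +
      7 * (4 ^ 7 * ((4 ^ 7 * (b + K + 4) + T ((b + 2 * l + 19) * (4 ^ 7 * (b + K + 4) + 1))) +
        (K + 1) + 1)) + 1 := by
  set P := reductionProg D K m items with hP
  intro ω
  set A := 3 + D.coins with hA
  have hlen : (withCoins D items).length = items.length + D.coins := by simp [withCoins]
  set B := 4 ^ 7 * (b + K + 4) with hB
  have h0 : BoundedState b (P.init w ω) := (boundedState_init P w ω).mono hw
  obtain ⟨h1, h2⟩ := listCode_bounded (K := K) (k := 0) (mid := []) (items := withCoins D items)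
    (A := A) (by omega) Safe.nil (withCoins_ok hit) h0
  set μ₁ := execCode (listCode A K [] (withCoins D items)) (P.init w ω) with hμ₁
  -- The entries occupy at most l registers; everything above still holds the original input or
  -- zero.
  have hsupp : ∀ r, b + l + l + 19 ≤ r → (μ₁ ∘ (A + 16 + ·)) r = 0 := by
    intro r hr
    have h3 : μ₁ (A + 16 + r) = P.init w ω (A + 16 + r) :=
      execCode_of_dest_ne _ fun I hI => by
        have := destLt_listCode (A := A) (K := K) (mid := []) (by simp [DestLt]) _ I hI
        omega
    rw [Function.comp, h3]
    have := length_le_listSize w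
    refine init_eq_zero P w ω ?_
    have : P.coins = D.coins := rfl
    omega
  set w' := List.ofFn fun i : Fin (b + l + l + 19) => (μ₁ ∘ (A + 16 + ·)) i with hw'
  have hinit := init_ofFn D _ hsupp
  rw [← hw'] at hinit
  have hsize : listSize w' ≤ (b + 2 * l + 19) * (B + 1) := by
    refine (listSize_le (B := B) ?_).trans (Nat.mul_le_mul_right _ (by simp [hw']; omega))
    intro a ha
    rw [hw', List.mem_ofFn] at ha
    obtain ⟨i, rfl⟩ := ha
    exact h1 _
  have hcost : codeCost D.code (μ₁ ∘ (A + 16 + ·)) ≤ T ((b + 2 * l + 19) * (B + 1)) := by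
    refine le_trans ?_ ((hD w' fun _ => false).trans (hT hsize))
    rw [Prog.cost, hinit]
    omega
  set Q := T ((b + 2 * l + 19) * (B + 1)) with hQ
  have h4 : codeCost (D.code.map (Instr.map (A + 16 + ·))) μ₁ ≤ Q := by
    rw [codeCost_map (shift_injective _)]
    exact hcost
  have h5 := (execCode_bounded_cost (D.code.map (Instr.map (A + 16 + ·))) h1).mono
    (Nat.add_le_add_left h4 B)
  obtain ⟨h6, h7⟩ := execCode_bounded (G := K + 1) (code := maskCode A (A + 16 + D.out.headD 0) m)
    (by
      intro I hI
      simp only [maskCode, List.mem_cons, List.not_mem_nil, or_false] at hI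
      rcases hI with rfl | rfl | rfl | rfl | rfl | rfl <;> simp [Instr.SmallConst]
      rw [Nat.size_pow]
      omega) h5
  have hcode : P.code = listCode A K [] (withCoins D items) ++
    D.code.map (Instr.map (A + 16 + ·)) ++ maskCode A (A + 16 + D.out.headD 0) m := rfl
  have hout : listSize (P.run w ω) ≤ 4 ^ 6 * (B + Q + (K + 1) + 1) + 1 := by
    have h8 : (P.run w ω).length ≤ 1 := by simp [Prog.run, hP, reductionProg]
    refine (listSize_le (B := 4 ^ 6 * (B + Q + (K + 1) + 1)) ?_).trans ?_
    · intro a ha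
      simp only [Prog.run, List.mem_map] at ha
      obtain ⟨r, -, rfl⟩ := ha
      rw [hcode, execCode_append, execCode_append]
      exact h6 r
    · calc _ ≤ 1 * (4 ^ 6 * (B + Q + (K + 1) + 1) + 1) := Nat.mul_le_mul_right _ h8
        _ = _ := one_mul _
  have h9 : codeCost P.code (P.init w ω) ≤
      (28 + l * (23 + 31 * K)) * (4 ^ 8 * (b + K + 4) + 2) + Q +
        6 * (4 ^ 7 * (B + Q + (K + 1) + 1)) := by
    rw [hcode, codeCost_append, codeCost_append, execCode_append]
    refine Nat.add_le_add (Nat.add_le_add (h2.trans ?_) h4) h7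
    rw [hlen, add_zero]
    gcongr
  have h10 : P.coins ≤ l := by
    have : P.coins = D.coins := rfl
    omega
  have h11 : 4 ^ 6 * (B + Q + (K + 1) + 1) ≤ 4 ^ 7 * (B + Q + (K + 1) + 1) :=
    Nat.mul_le_mul_right _ (by norm_num)
  change P.coins + codeCost P.code (P.init w ω) + listSize (P.run w ω) ≤ _
  omega

/-- Hard-wired preprocessing keeps a distinguisher polynomial. -/
lemma isPPT_reductionProg {D S : ℕ → Prog} {p : ℕ → ℕ} (hD : IsPPT D) (hp : PolyBounded p)
    (h : ∀ κ, ∃ K m items, S κ = reductionProg (D κ) K m items ∧ m ≤ K ∧ K ≤ p κ ∧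
      items.length ≤ p κ ∧ ∀ it ∈ items, it.Ok (3 + (D κ).coins) K) : IsPPT S := by
  obtain ⟨c, hc⟩ := hD
  obtain ⟨P, hP, hmono, hle⟩ := hp.exists_monotone
  have cst := polyBounded_const
  let l : ℕ → ℕ := fun u => P u + (u + c) ^ c
  have hl : PolyBounded l := hP.add ⟨c, fun _ => le_rfl⟩
  let B : ℕ → ℕ := fun u => u + 1 + P u + 4
  have hB : PolyBounded B := ((polyBounded_id.add (cst 1)).add hP).add (cst 4)
  let Q : ℕ → ℕ := fun u => (u + (u + 1 + 2 * l u + 19) * (4 ^ 7 * B u + 1) + c) ^ c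
  have hQ : PolyBounded Q := by
    have h1 : PolyBounded fun u => (u + c) ^ c := ⟨c, fun _ => le_rfl⟩
    exact h1.comp (polyBounded_id.add ((((polyBounded_id.add (cst 1)).add
      ((cst 2).mul hl)).add (cst 19)).mul (((cst (4 ^ 7)).mul hB).add (cst 1))))
  refine isPPT_of_polyBounded (f := fun u =>
    l u + (28 + l u * (23 + 31 * P u)) * (4 ^ 8 * B u + 2) + Q u +
      7 * (4 ^ 7 * ((4 ^ 7 * B u + Q u) + (P u + 1) + 1)) + 1) ?_ ?_
  · exact (((hl.add (((cst 28).add (hl.mul ((cst 23).add ((cst 31).mul hP)))).mul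
      (((cst (4 ^ 8)).mul hB).add (cst 2)))).add hQ).add ((cst 7).mul ((cst (4 ^ 7)).mul
      (((((cst (4 ^ 7)).mul hB).add hQ).add (hP.add (cst 1))).add (cst 1))))).add (cst 1)
  · intro κ w ω
    obtain ⟨K, m, items, hS, hm, hK, hlen, hit⟩ := h κ
    revert ω
    rw [hS]
    intro ω
    set u := κ + listSize w with hu
    have hPu : p κ ≤ P u := (hle κ).trans (hmono (by omega))
    -- The coins are part of the cost, so the bound on the empty input limits their number.
    have hcoins : (D κ).coins ≤ (u + c) ^ c := by
      have h1 := hc κ [] fun _ => false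
      have h2 : (D κ).coins ≤ (κ + listSize [] + c) ^ c := le_trans (by rw [Prog.cost]; omega) h1
      exact h2.trans (Nat.pow_le_pow_left (by simp [listSize]; omega) _)
    have hT : Monotone fun v => (κ + v + c) ^ c := fun v v' hv => Nat.pow_le_pow_left (by omega) _
    refine (reductionProg_cost hT (fun w ω => hc κ w ω) hm hit (b := u + 1) (l := l u)
      (Nat.add_le_add (hlen.trans hPu) hcoins) w (by omega) ω).trans ?_
    have hKP : K ≤ P u := hK.trans hPu
    have hκu : κ ≤ u := by omega
    simp only [Q, B]
    gcongr

lemma init_apply_lt {P : Prog} {w : List ℕ} {ω : Fin P.coins → Bool} {r : ℕ} (h : r < w.length) :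
    P.init w ω r = w[r] := by
  rw [Prog.init, List.getD_eq_getElem?_getD, List.getElem?_append_left h,
    List.getElem?_eq_getElem h, Option.getD_some]

lemma init_apply_add {P : Prog} {w : List ℕ} {ω : Fin P.coins → Bool} (j : ℕ) :
    P.init w ω (w.length + j) = coinStream ω j := by
  rw [Prog.init, List.getD_eq_getElem?_getD, List.getElem?_append_right (by omega),
    Nat.add_sub_cancel_left, List.getElem?_ofFn, coinStream]
  split_ifs <;> rfl

/-- The reduction passes its own coins on to the distinguisher, so both are compared coin by coin.
If the mask is 0, the output is 0 or empty and never counts as acceptance. -/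
lemma reductionProg_acceptProb {D : Prog} {K m N h c : ℕ} {items : List Item} {w : List ℕ}
    (hN : 0 < N) (hNK : N < 2 ^ K) (hK : 0 < K) (hit : ∀ it ∈ items, it.Ok (3 + D.coins) K)
    (hw : ∀ μ : State, μ 0 = N → μ 1 = h → μ 2 = c → items.map (Item.val N h μ) = w) :
    (reductionProg D K m items).acceptProb [N, h, c] =
      if 2 ^ m ≤ N then D.acceptProb w else 0 := by
  set P := reductionProg D K m items with hP
  set A := 3 + D.coins with hA
  have key : ∀ ω : Fin D.coins → Bool, (P.run [N, h, c] ω).head? = some 1 ↔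
      2 ^ m ≤ N ∧ (D.run w ω).head? = some 1 := by
    intro ω
    set μ₀ := P.init [N, h, c] ω with hμ₀
    have i0 : μ₀ 0 = N := init_apply_lt (P := P) (by simp)
    have i1 : μ₀ 1 = h := init_apply_lt (P := P) (by simp)
    have i2 : μ₀ 2 = c := init_apply_lt (P := P) (by simp)
    have p : Params A K N h (execCode (initCode A K) μ₀) := by
      have := params_initCode (A := A) (K := K) (by omega) hK (μ := μ₀) (by rw [i0]; exact hN)
        (by rw [i0]; exact hNK)
      rwa [i0, i1] at this
    have hlow : ∀ r, r < A ∨ A + 6 ≤ r → execCode (initCode A K) μ₀ r = μ₀ r :=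
      (initCode_spec (by omega) μ₀).2.2.2.2.2.2
    set ν := execCode (initCode A K) μ₀ with hν
    obtain ⟨h1, h2⟩ := execCode_listCode (A := A) (K := K) (mid := []) (μ := μ₀) (ν := ν) rfl p
      (withCoins_ok hit)
    set μ₁ := execCode (listCode A K [] (withCoins D items)) μ₀ with hμ₁
    have hlen : (withCoins D items).length = items.length + D.coins := by simp [withCoins]
    have hvals : (withCoins D items).map (Item.val N h ν) =
        w ++ List.ofFn fun j => (ω j).toNat := by
      rw [withCoins, List.map_append, hw ν (by rw [hlow _ (by omega), i0])
        (by rw [hlow _ (by omega), i1]) (by rw [hlow _ (by omega), i2]), List.map_map]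
      congr 1
      rw [List.ofFn_eq_map, ← List.map_coe_finRange_eq_range, List.map_map]
      refine List.map_congr_left fun j _ => ?_
      simp only [Function.comp, Item.val, Source.val]
      rw [hlow _ (by omega)]
      have := init_apply_add (P := P) (w := [N, h, c]) (ω := ω) j
      simp only [List.length_cons, List.length_nil, zero_add] at this
      exact this.trans (dif_pos (show (j : ℕ) < P.coins from j.2))
    -- Seen through the shift, the registers are the intended input, the coins, and untouched zeros.
    have hinit : μ₁ ∘ (A + 16 + ·) = D.init w ω := by
      funext i
      rw [Prog.init, ← hvals, ← h2, List.getD_eq_getElem?_getD]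
      by_cases hi : i < (withCoins D items).length
      · rw [List.getElem?_map, List.getElem?_range hi]
        rfl
      · rw [List.getElem?_eq_none (by simpa using hi), Function.comp, h1 _ (by omega),
          hlow _ (by omega), Option.getD_none]
        refine init_eq_zero P [N, h, c] ω ?_
        have : P.coins = D.coins := rfl
        simp only [List.length_cons, List.length_nil]
        omega
    have hrun : execCode P.code μ₀ (A + 8) =
        if 2 ^ m ≤ N then execCode D.code (D.init w ω) (D.out.headD 0) else 0 := by
      have hcode : P.code = listCode A K [] (withCoins D items) ++
        D.code.map (Instr.map (A + 16 + ·)) ++ maskCode A (A + 16 + D.out.headD 0) m := rfl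
      rw [hcode, execCode_append, execCode_append, maskCode_spec (by omega) (by omega), ← hμ₁]
      have e1 : execCode (D.code.map (Instr.map (A + 16 + ·))) μ₁ 0 = N := by
        rw [execCode_of_dest_ne]
        · rw [← i0, ← hlow 0 (by omega), hμ₁, listCode, List.append_nil, execCode_append]
          exact (itemsCode_spec _ p (le_refl (A + 16)) (withCoins_ok hit)).1 0 (by omega)
        · intro I hI
          obtain ⟨J, -, rfl⟩ := List.mem_map.mp hI
          rw [Instr.dest_map]
          omega
      have e2 := congrFun (execCode_map (shift_injective (A + 16)) D.code μ₁) (D.out.headD 0)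
      rw [hinit] at e2
      rw [e1, ← e2]
      rfl
    have hPout : P.out = (D.out.take 1).map fun _ => A + 8 := rfl
    change (P.out.map (execCode P.code μ₀)).head? = some 1 ↔
      2 ^ m ≤ N ∧ (D.out.map (execCode D.code (D.init w ω))).head? = some 1
    rw [hPout]
    rcases hD : D.out with _ | ⟨o, os⟩
    · simp
    · have := hrun
      rw [hD, List.headD_cons] at this
      simp only [List.take_succ_cons, List.take_zero, List.map_cons, List.map_nil, List.head?_cons,
        Option.some.injEq]
      rw [this]
      split_ifs with h
      · simp [h]
      · simp [h]
  rw [Prog.acceptProb, Prog.acceptProb]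
  split_ifs with h
  · refine Finset.expect_congr rfl fun ω _ => ?_
    have := key ω
    simp only [h, true_and] at this
    simp only [this]
  · refine Finset.expect_eq_zero fun ω _ => ?_
    have := key ω
    simp only [h, false_and, iff_false] at this
    exact if_neg this

/-! ## Privacy against the first server -/

/-- The arrangement of the entries in a view of `S₁`, after a list `k` of keys. -/
def layout₁ {α : Type*} {s : ℕ} (k : List α) (c r : Fin s → α) (d : α) (u v l M : Fin s → α) :
    List α :=
  k ++ (List.ofFn c ++ List.ofFn r ++ [d] ++ List.ofFn u ++ List.ofFn v ++ List.ofFn l ++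
    List.ofFn M)

lemma map_layout₁ {α β : Type*} {s : ℕ} (f : α → β) (k : List α) (c r : Fin s → α) (d : α)
    (u v l M : Fin s → α) :
    (layout₁ k c r d u v l M).map f = layout₁ (k.map f) (fun i => f (c i)) (fun i => f (r i)) (f d)
      (fun i => f (u i)) (fun i => f (v i)) (fun i => f (l i)) (fun i => f (M i)) := by
  simp only [layout₁, List.map_append, List.map_ofFn, List.map_cons, List.map_nil,
    Function.comp_def]

lemma forall_mem_layout₁ {α : Type*} {s : ℕ} {P : α → Prop} {k : List α} {c r : Fin s → α} {d : α}
    {u v l M : Fin s → α} (hk : ∀ a ∈ k, P a) (hc : ∀ i, P (c i)) (hr : ∀ i, P (r i)) (hd : P d)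
    (hu : ∀ i, P (u i)) (hv : ∀ i, P (v i)) (hl : ∀ i, P (l i)) (hM : ∀ i, P (M i)) :
    ∀ a ∈ layout₁ k c r d u v l M, P a := by
  intro a ha
  simp only [layout₁, List.mem_append, List.mem_ofFn, List.mem_cons, List.not_mem_nil,
    or_false] at ha
  rcases ha with h | ((((((⟨i, rfl⟩ | ⟨i, rfl⟩) | rfl) | ⟨i, rfl⟩) | ⟨i, rfl⟩) | ⟨i, rfl⟩) | ⟨i, rfl⟩)
  exacts [hk a h, hc i, hr i, hd, hu i, hv i, hl i, hM i]

lemma length_layout₁ {α : Type*} {s : ℕ} (k : List α) (c r : Fin s → α) (d : α)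
    (u v l M : Fin s → α) : (layout₁ k c r d u v l M).length = k.length + (6 * s + 1) := by
  simp only [layout₁, List.length_append, List.length_ofFn, List.length_cons, List.length_nil]
  ring

/-! ### Rearranging expectations -/

lemma ite_expect {ι : Type*} [Fintype ι] (p : Prop) [Decidable p] (f : ι → ℝ) :
    (if p then 𝔼 i, f i else 0) = 𝔼 i, if p then f i else 0 := by
  split_ifs <;> simp

lemma expPK_congr {κ n : ℕ} {f g : PublicKey → ℝ}
    (h : ∀ t ∈ NGen κ n, ∀ y, f (pubKey t y) = g (pubKey t y)) : expPK κ n f = expPK κ n g :=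
  Finset.expect_congr rfl fun t ht => Finset.expect_congr rfl fun y _ => h t ht y

lemma expPK_expect {κ n : ℕ} {Ω : Type*} [Fintype Ω] (f : PublicKey → Ω → ℝ) :
    expPK κ n (fun pk => 𝔼 ω, f pk ω) = 𝔼 ω, expPK κ n fun pk => f pk ω := by
  simp only [expPK]
  rw [Finset.expect_comm]
  refine Finset.expect_congr rfl fun t _ => ?_
  rw [Finset.expect_comm]

/-- Collects the exponents of the input ciphertexts and of the answers into one uniform family over
I ⊕ I, the index set of the hybrid argument, and moves all other choices outside. -/
lemma expect_reorder {A I E R D U V W : Type*} [Fintype A] [Fintype I] [DecidableEq I] [Fintype E]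
    [Fintype R] [Fintype D] [Fintype U] [Fintype V] [Fintype W]
    (F : A → (I → E) → R → D → U → V → W → (I → E) → ℝ) :
    (𝔼 a, 𝔼 x, 𝔼 r, 𝔼 d, 𝔼 u, 𝔼 v, 𝔼 w, 𝔼 τ, F a x r d u v w τ) =
    𝔼 z : A × R × D × U × V × W, 𝔼 b : I ⊕ I → E, F z.1 (fun i => b (.inl i)) z.2.1 z.2.2.1
      z.2.2.2.1 z.2.2.2.2.1 z.2.2.2.2.2 (fun i => b (.inr i)) := by
  have h : ∀ G : (I → E) → (I → E) → ℝ, (𝔼 b : I ⊕ I → E, G (fun i => b (.inl i))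
      (fun i => b (.inr i))) = 𝔼 x, 𝔼 τ, G x τ := by
    intro G
    rw [← Finset.expect_product', Finset.univ_product_univ]
    exact Fintype.expect_equiv (Equiv.sumArrowEquivProdArrow I I E) _ _ fun b => rfl
  simp only [← Finset.univ_product_univ, Finset.expect_product]
  refine Finset.expect_congr rfl fun a _ => ?_
  rw [Finset.expect_comm]
  refine Finset.expect_congr rfl fun r _ => ?_
  rw [Finset.expect_comm]
  refine Finset.expect_congr rfl fun d _ => ?_
  rw [Finset.expect_comm]
  refine Finset.expect_congr rfl fun u _ => ?_
  rw [Finset.expect_comm]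
  refine Finset.expect_congr rfl fun v _ => ?_
  rw [Finset.expect_comm]
  exact Finset.expect_congr rfl fun w _ => (h fun x τ => F a x r d u v w τ).symm

/-- Random choices of `S₁` that do not enter its input ciphertexts: `sk₁`, the masks, and the
exponents of its encryptions. -/
abbrev Side (κ σ s : ℕ) : Type :=
  Fin (2 ^ σ) × (Fin s → Fin (2 ^ σ)) × EncCoin κ × (Fin s → EncCoin κ) × (Fin s → EncCoin κ) ×
    (Fin s → EncCoin κ)

/-- The input of the distinguisher, for given input ciphertexts and given answers of `S₂`. -/
def input₁ {κ σ s : ℕ} (δ : ℕ) (pk : PublicKey) (z : Side κ σ s) (Y : Fin s ⊕ Fin s → ℕ) : List ℕ :=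
  layout₁ [pk.N, pk.h.val, z.1, δ] (fun i => Y (.inl i)) (fun i => z.2.1 i) z.2.2.1
    (fun i => z.2.2.2.1 i) (fun i => z.2.2.2.2.1 i) (fun i => z.2.2.2.2.2 i) (fun i => Y (.inr i))

/-- Acceptance probability on views in which the ciphertexts encrypt the given messages. -/
noncomputable def viewGame (κ n σ L δ : ℕ) {s : ℕ} (D : Prog)
    (m : Side κ σ s → Fin s ⊕ Fin s → ℤ) : ℝ :=
  𝔼 z : Side κ σ s, 𝔼 a : Fin s ⊕ Fin s → EncCoin κ, expPK κ n fun pk =>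
    if Fits pk L s then D.acceptProb (input₁ δ pk z fun j => (enc pk (m z j) (a j)).val) else 0

lemma viewGame_eq (κ n σ L δ : ℕ) {s : ℕ} (D : Prog) (m : Side κ σ s → Fin s ⊕ Fin s → ℤ)
    (m₀ : Fin s → ℤ) (m₁ : (Fin s → Fin (2 ^ σ)) → Fin s → ℤ)
    (hm : ∀ z, m z = Sum.elim m₀ (m₁ z.2.1)) :
    viewGame κ n σ L δ D m = expPK κ n fun pk => 𝔼 a : Fin (2 ^ σ), if Fits pk L s then
      𝔼 ρx : Fin s → EncCoin κ, 𝔼 r : Fin s → Fin (2 ^ σ), 𝔼 ρδ : EncCoin κ,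
      𝔼 ρr : Fin s → EncCoin κ, 𝔼 ρsq : Fin s → EncCoin κ, 𝔼 ρlin : Fin s → EncCoin κ,
      𝔼 τ : Fin s → EncCoin κ, D.acceptProb (layout₁ [pk.N, pk.h.val, a, δ]
        (fun i => (enc pk (m₀ i) (ρx i)).val) (fun i => r i) ρδ (fun i => ρr i) (fun i => ρsq i)
        (fun i => ρlin i) (fun i => (enc pk (m₁ r i) (τ i)).val)) else 0 := by
  simp only [ite_expect, expect_reorder]
  simp only [expPK_expect, viewGame, hm]
  rfl

/-- By `unpack_pack` the answers are fresh encryptions of (x_i + r_i)², so sk₂ and η disappear from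
the view. What remains of the keys besides the public key is sk₁, an independent uniform number that
can be fixed with the other choices. -/
lemma real₁_eq {κ n σ ℓ L δ s : ℕ} (η : ℕ × ℕ × ℕ × ℕ → ℕ → ℤ) (hσ : ℓ < σ)
    (hL : 2 ^ (σ + 2) ≤ L) {x : Fin s → ℤ} (hx : Admissible ℓ δ x) (D : Prog) :
    real₁ κ n σ η L δ x D = viewGame κ n σ L δ D fun z =>
      Sum.elim x fun i => (x i + z.2.1 i) ^ 2 := by
  rw [viewGame_eq κ n σ L δ D _ x (fun r i => (x i + r i) ^ 2) fun _ => rfl, real₁, expKeys, expPK]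
  refine Finset.expect_congr rfl fun t ht => Finset.expect_congr rfl fun y _ =>
    Finset.expect_congr rfl fun a _ => ?_
  change (if Fits (pubKey t y) L s then _ else _) = _
  split_ifs with hfit
  swap
  · rfl
  refine Finset.expect_congr rfl fun ρx _ => Finset.expect_congr rfl fun r _ =>
    Finset.expect_congr rfl fun ρδ _ => Finset.expect_congr rfl fun ρr _ =>
    Finset.expect_congr rfl fun ρsq _ => Finset.expect_congr rfl fun ρlin _ =>
    Finset.expect_congr rfl fun τ _ => ?_
  congr 1
  have h : ∀ i : Fin s, unpack (keyGen t y a (η t a)).pk (keyGen t y a (η t a)).sk₂ L δ _ _ i =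
      x i + r i := fun i => unpack_pack ht y a (η t a) hσ hL hfit hx
    (c := fun i => enc (keyGen t y a (η t a)).pk (x i) (ρx i)) (fun i => ⟨ρx i, rfl⟩)
    (r := fun i => r i) (fun i => (r i).2) ρδ (fun i => ρr i) i
  simp only [keys₁, view₁, reply, h]
  rfl

/-! ### The simulator -/

/-- Number of random bits of the simulator for `S₁`. -/
def coins₁ (w σ s : ℕ) : ℕ :=
  s * w + (s * σ + (1 * w + (s * w + (s * w + (s * w + (s * w + 0))))))

lemma dropBits_dropBits (a b : ℕ) (β : ℕ → ℕ) : dropBits a (dropBits b β) = dropBits (b + a) β := by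
  funext j
  simp [dropBits, add_assoc]

/-- The bit stream is split block by block with `expect_blocks`. The single exponent ρδ is treated
as a family over `Fin 1`, and the empty remainder of the stream contributes nothing. -/
lemma expect_coins₁ (w σ s : ℕ)
    (G : (Fin s → ℕ) → (Fin s → ℕ) → ℕ → (Fin s → ℕ) → (Fin s → ℕ) → (Fin s → ℕ) → (Fin s → ℕ) → ℝ) :
    (𝔼 ω : Fin (coins₁ w σ s) → Bool,
      G (blocks s w (coinStream ω)) (blocks s σ (dropBits (s * w) (coinStream ω)))
        (blocks 1 w (dropBits (s * w + s * σ) (coinStream ω)) 0)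
        (blocks s w (dropBits (s * w + s * σ + 1 * w) (coinStream ω)))
        (blocks s w (dropBits (s * w + s * σ + 1 * w + s * w) (coinStream ω)))
        (blocks s w (dropBits (s * w + s * σ + 1 * w + s * w + s * w) (coinStream ω)))
        (blocks s w (dropBits (s * w + s * σ + 1 * w + s * w + s * w + s * w) (coinStream ω)))) =
    𝔼 ρx : Fin s → Fin (2 ^ w), 𝔼 r : Fin s → Fin (2 ^ σ), 𝔼 ρδ : Fin (2 ^ w),
      𝔼 ρr : Fin s → Fin (2 ^ w), 𝔼 ρsq : Fin s → Fin (2 ^ w), 𝔼 ρlin : Fin s → Fin (2 ^ w),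
      𝔼 τ : Fin s → Fin (2 ^ w), G (fun i => ρx i) (fun i => r i) ρδ (fun i => ρr i)
        (fun i => ρsq i) (fun i => ρlin i) (fun i => τ i) := by
  simp only [← dropBits_dropBits]
  refine (expect_blocks s w _ fun X₁ β => G X₁ (blocks s σ β) (blocks 1 w (dropBits (s * σ) β) 0)
    (blocks s w (dropBits (1 * w) (dropBits (s * σ) β)))
    (blocks s w (dropBits (s * w) (dropBits (1 * w) (dropBits (s * σ) β))))
    (blocks s w (dropBits (s * w) (dropBits (s * w) (dropBits (1 * w) (dropBits (s * σ) β)))))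
    (blocks s w (dropBits (s * w) (dropBits (s * w) (dropBits (s * w) (dropBits (1 * w)
      (dropBits (s * σ) β))))))).trans (Finset.expect_congr rfl fun X₁ _ => ?_)
  refine (expect_blocks s σ _ fun X₂ β => G _ X₂ (blocks 1 w β 0)
    (blocks s w (dropBits (1 * w) β)) (blocks s w (dropBits (s * w) (dropBits (1 * w) β)))
    (blocks s w (dropBits (s * w) (dropBits (s * w) (dropBits (1 * w) β))))
    (blocks s w (dropBits (s * w) (dropBits (s * w) (dropBits (s * w) (dropBits (1 * w) β)))))).trans
    (Finset.expect_congr rfl fun X₂ _ => ?_)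
  refine (expect_blocks 1 w _ fun X₃ β => G _ _ (X₃ 0)
    (blocks s w β) (blocks s w (dropBits (s * w) β))
    (blocks s w (dropBits (s * w) (dropBits (s * w) β)))
    (blocks s w (dropBits (s * w) (dropBits (s * w) (dropBits (s * w) β))))).trans ?_
  refine Fintype.expect_equiv (Equiv.funUnique (Fin 1) (Fin (2 ^ w))) _ _ fun X₃ => ?_
  refine (expect_blocks s w _ fun X₄ β => G _ _ _ X₄ (blocks s w β)
    (blocks s w (dropBits (s * w) β)) (blocks s w (dropBits (s * w) (dropBits (s * w) β)))).trans
    (Finset.expect_congr rfl fun X₄ _ => ?_)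
  refine (expect_blocks s w _ fun X₅ β => G _ _ _ _ X₅ (blocks s w β)
    (blocks s w (dropBits (s * w) β))).trans (Finset.expect_congr rfl fun X₅ _ => ?_)
  refine (expect_blocks s w _ fun X₆ β => G _ _ _ _ _ X₆ (blocks s w β)).trans
    (Finset.expect_congr rfl fun X₆ _ => ?_)
  refine (expect_blocks s w 0 fun X₇ _ => G _ _ _ _ _ _ X₇).trans
    (Finset.expect_congr rfl fun X₇ _ => ?_)
  exact Fintype.expect_const _

/-- The `i`-th number of `k` random bits, for an input of length `e` and an offset `o`. -/
def bitsAt (e o k i : ℕ) : Source := .bits (e + (o + i * k)) k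

lemma bitsAt_ok {e o k i s c K : ℕ} (hi : i < s) (ho : o + s * k ≤ c) (hk : k ≤ K) :
    (bitsAt e o k i).Ok (e + c) K := by
  have : (i + 1) * k ≤ s * k := Nat.mul_le_mul_right _ hi
  rw [add_mul, one_mul] at this
  exact ⟨by omega, hk⟩

lemma bitsAt_val {e o k s c : ℕ} {ν : State} {β : ℕ → ℕ} (hν : ∀ j, j < c → ν (e + j) = β j)
    (ho : o + s * k ≤ c) (i : Fin s) :
    (bitsAt e o k i).val ν = blocks s k (dropBits o β) i := by
  simp only [bitsAt, Source.val, blocks, bitsVal_dropBits]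
  refine Finset.sum_congr rfl fun j hj => ?_
  have hj := Finset.mem_range.mp hj
  have : ((i : ℕ) + 1) * k ≤ s * k := Nat.mul_le_mul_right _ i.2
  rw [add_mul, one_mul] at this
  rw [add_assoc, hν _ (by omega)]

/-- The entries of the simulated view of `S₁`. -/
def simItems₁ (w σ s : ℕ) : List Item :=
  layout₁ [] (fun i : Fin s => .cipher 0 (bitsAt 4 0 w i))
    (fun i => .plain (bitsAt 4 (s * w) σ i))
    (.plain (bitsAt 4 (s * w + s * σ) w (0 : Fin 1)))
    (fun i => .plain (bitsAt 4 (s * w + s * σ + 1 * w) w i))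
    (fun i => .plain (bitsAt 4 (s * w + s * σ + 1 * w + s * w) w i))
    (fun i => .plain (bitsAt 4 (s * w + s * σ + 1 * w + s * w + s * w) w i))
    (fun i => .cipher 0 (bitsAt 4 (s * w + s * σ + 1 * w + s * w + s * w + s * w) w i))

lemma simItems₁_ok {w σ s K : ℕ} (hw : w ≤ K) (hσ : 0 < s → σ ≤ K) :
    ∀ it ∈ simItems₁ w σ s, it.Ok (4 + coins₁ w σ s) K := by
  have h0 : (0 : ℤ).natAbs.size ≤ K := by simp
  refine forall_mem_layout₁ (by simp) (fun i => ⟨?_, h0, id⟩) (fun i => ?_) ?_ (fun i => ?_)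
    (fun i => ?_) (fun i => ?_) (fun i => ⟨?_, h0, id⟩)
  · exact bitsAt_ok i.2 (by simp only [coins₁]; omega) hw
  · exact bitsAt_ok i.2 (by simp only [coins₁]; omega) (hσ i.pos)
  · exact bitsAt_ok (0 : Fin 1).2 (by simp only [coins₁]; omega) hw
  · exact bitsAt_ok i.2 (by simp only [coins₁]; omega) hw
  · exact bitsAt_ok i.2 (by simp only [coins₁]; omega) hw
  · exact bitsAt_ok i.2 (by simp only [coins₁]; omega) hw
  · exact bitsAt_ok i.2 (by simp only [coins₁]; omega) hw

/-- The simulator for `S₁`: encryptions of zero and random numbers. -/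
def sim₁ (κ n σ s : ℕ) : Prog :=
  listProg (coins₁ (4 * κ) σ s) (4 + coins₁ (4 * κ) σ s) (4 * κ + n + 1) []
    (simItems₁ (4 * κ) σ s)

/-- The machine's encryptions equal `enc` exactly, so the simulated view is the game with all
plaintexts zero. The bound on σ is needed only if masks occur, that is for s > 0. -/
lemma ideal₁_eq {κ n σ L δ s : ℕ} (η : ℕ × ℕ × ℕ × ℕ → ℕ → ℤ) (hσ : 0 < s → σ ≤ n) (D : Prog) :
    ideal₁ κ n σ η L δ s (sim₁ κ n σ s) D = viewGame κ n σ L δ (s := s) D fun _ _ => 0 := by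
  rw [viewGame_eq κ n σ L δ D _ (fun _ => 0) (fun _ _ => 0) fun _ => by
    funext j; cases j <;> rfl, ideal₁, expKeys, expPK]
  refine Finset.expect_congr rfl fun t ht => Finset.expect_congr rfl fun y _ =>
    Finset.expect_congr rfl fun a _ => ?_
  change (if Fits (pubKey t y) L s then _ else _) = _
  split_ifs with hfit
  swap
  · rfl
  have hN : 1 < (pubKey t y).N := one_lt_modulus ht
  have hNn : (pubKey t y).N < 2 ^ (4 * κ + n + 1) :=
    (Nat.size_le.mp (modulus_size_le ht)).trans_le (Nat.pow_le_pow_right (by norm_num) (by omega))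
  have hit := simItems₁_ok (w := 4 * κ) (K := 4 * κ + n + 1) (σ := σ) (s := s) (by omega)
    fun h => (hσ h).trans (by omega)
  have key : ∀ ω : Fin (coins₁ (4 * κ) σ s) → Bool,
      (sim₁ κ n σ s).run (keys₁ (keyGen t y a (η t a)) δ) ω =
      layout₁ [] (fun i => (enc (pubKey t y) 0 (blocks s (4 * κ) (coinStream ω) i)).val)
        (blocks s σ (dropBits (s * (4 * κ)) (coinStream ω)))
        (blocks 1 (4 * κ) (dropBits (s * (4 * κ) + s * σ) (coinStream ω)) 0)
        (blocks s (4 * κ) (dropBits (s * (4 * κ) + s * σ + 1 * (4 * κ)) (coinStream ω)))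
        (blocks s (4 * κ) (dropBits (s * (4 * κ) + s * σ + 1 * (4 * κ) + s * (4 * κ)) (coinStream ω)))
        (blocks s (4 * κ) (dropBits (s * (4 * κ) + s * σ + 1 * (4 * κ) + s * (4 * κ) + s * (4 * κ))
          (coinStream ω)))
        (fun i => (enc (pubKey t y) 0 (blocks s (4 * κ) (dropBits (s * (4 * κ) + s * σ +
          1 * (4 * κ) + s * (4 * κ) + s * (4 * κ) + s * (4 * κ)) (coinStream ω)) i)).val) := by
    intro ω
    set μ₀ := (sim₁ κ n σ s).init (keys₁ (keyGen t y a (η t a)) δ) ω with hμ₀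
    have i0 : μ₀ 0 = (pubKey t y).N := init_apply_lt (P := sim₁ κ n σ s) (by simp [keys₁])
    have i1 : μ₀ 1 = (pubKey t y).h.val := init_apply_lt (P := sim₁ κ n σ s) (by simp [keys₁])
    have p := params_initCode (A := 4 + coins₁ (4 * κ) σ s) (K := 4 * κ + n + 1) (by omega)
      (by omega) (μ := μ₀) (by omega) (by omega)
    have hν : ∀ j, j < coins₁ (4 * κ) σ s →
        execCode (initCode (4 + coins₁ (4 * κ) σ s) (4 * κ + n + 1)) μ₀ (4 + j) =
          coinStream ω j := by
      intro j hj
      rw [(initCode_spec (by omega) μ₀).2.2.2.2.2.2 _ (by omega)]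
      exact init_apply_add (P := sim₁ κ n σ s) (w := keys₁ (keyGen t y a (η t a)) δ) (ω := ω) j
    obtain ⟨ν, hνμ⟩ : ∃ ν, execCode (initCode (4 + coins₁ (4 * κ) σ s) (4 * κ + n + 1)) μ₀ = ν :=
      ⟨_, rfl⟩
    rw [i0, i1, hνμ] at p
    simp only [hνμ] at hν
    refine (listProg_run (coins := coins₁ (4 * κ) σ s) hνμ p hit).trans ?_
    rw [simItems₁, map_layout₁]
    have hval : ∀ o k (i : Fin s), o + s * k ≤ coins₁ (4 * κ) σ s → (bitsAt 4 o k i).val ν =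
        blocks s k (dropBits o (coinStream ω)) i := fun o k i ho => bitsAt_val hν ho i
    have hval1 : (bitsAt 4 (s * (4 * κ) + s * σ) (4 * κ) (0 : Fin 1)).val ν =
        blocks 1 (4 * κ) (dropBits (s * (4 * κ) + s * σ) (coinStream ω)) 0 :=
      bitsAt_val hν (by simp only [coins₁]; omega) 0
    have hdrop : dropBits 0 (coinStream ω) = coinStream ω := by
      funext j
      simp [dropBits]
    simp only [Item.val, enc_val, hval1]
    simp (disch := (simp only [coins₁]; omega)) only [hval, hdrop]
    simp
  have hpre : ∀ w : List ℕ, keys₁ (keyGen t y a (η t a)) δ ++ w =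
      [(pubKey t y).N, (pubKey t y).h.val, (a : ℕ), δ] ++ w := fun _ => rfl
  rw [← expect_coins₁ (4 * κ) σ s fun X₁ X₂ X₃ X₄ X₅ X₆ X₇ => D.acceptProb
    (layout₁ [(pubKey t y).N, (pubKey t y).h.val, a, δ] (fun i => (enc (pubKey t y) 0 (X₁ i)).val)
      X₂ X₃ X₄ X₅ X₆ fun i => (enc (pubKey t y) 0 (X₇ i)).val)]
  refine Finset.expect_congr rfl fun ω _ => ?_
  rw [key ω, hpre]
  rfl

/-! ### The reduction to semantic security -/

/-- The condition compares N with a fixed power of two, so the reduction can test it by one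
division. -/
lemma fits_iff {pk : PublicKey} {L s : ℕ} (hL : 0 < L) (hs : 0 < s) :
    Fits pk L s ↔ 2 ^ (s * L.size - 1) ≤ pk.N := by
  have h2 : 0 < s * L.size := Nat.mul_pos hs (Nat.size_pos.mpr hL)
  rw [Fits, Nat.le_div_iff_mul_le (Nat.size_pos.mpr hL), ← Nat.lt_size]
  omega

lemma mul_size_le_of_fits {κ n L s : ℕ} {t : ℕ × ℕ × ℕ × ℕ} (ht : t ∈ NGen κ n)
    {y : (ZMod (modulus t))ˣ} (hL : 0 < L) (h : Fits (pubKey t y) L s) : s * L.size ≤ n :=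
  ((Nat.le_div_iff_mul_le (Nat.size_pos.mpr hL)).mp h).trans (modulus_size_le ht)

/-- All choices that are hard-wired into the reduction. -/
abbrev Choice (κ σ s : ℕ) : Type :=
  Side κ σ s × (Fin s ⊕ Fin s) × (Fin s ⊕ Fin s → Bool) × (Fin s ⊕ Fin s → EncCoin κ)

section

variable {κ n σ L δ s : ℕ}

/-- The ciphertext at one position: the challenge, or an encryption of a hard-wired message. -/
def challengeItem (m : Side κ σ s → Fin s ⊕ Fin s → ℤ) (ch : Choice κ σ s) (j : Fin s ⊕ Fin s) :
    Item :=
  if j = ch.2.1 then .plain (.reg 2)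
  else .cipher (if ch.2.2.1 j then 0 else m ch.1 j) (.cst (ch.2.2.2 j))

/-- The input of the distinguisher, with the challenge in one position. -/
def challengeItems (δ : ℕ) (m : Side κ σ s → Fin s ⊕ Fin s → ℤ) (ch : Choice κ σ s) : List Item :=
  layout₁ [.plain (.reg 0), .plain (.reg 1), .plain (.cst ch.1.1), .plain (.cst δ)]
    (fun i => challengeItem m ch (.inl i)) (fun i => .plain (.cst (ch.1.2.1 i)))
    (.plain (.cst ch.1.2.2.1)) (fun i => .plain (.cst (ch.1.2.2.2.1 i)))
    (fun i => .plain (.cst (ch.1.2.2.2.2.1 i))) (fun i => .plain (.cst (ch.1.2.2.2.2.2 i)))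
    (fun i => challengeItem m ch (.inr i))

lemma challengeItems_ok {m : Side κ σ s → Fin s ⊕ Fin s → ℤ} (ch : Choice κ σ s) {c K : ℕ}
    (hκ : 4 * κ ≤ K) (hσ : σ ≤ K) (hδ : δ.size ≤ K) (hm : ∀ z j, (m z j).natAbs.size ≤ K) :
    ∀ it ∈ challengeItems δ m ch, it.Ok (3 + c) K := by
  have hfin : ∀ {k : ℕ}, k ≤ K → ∀ a : Fin (2 ^ k), (a : ℕ).size ≤ K := fun hk a =>
    (Nat.size_le.mpr a.2).trans hk
  have hc : ∀ j, (challengeItem m ch j).Ok (3 + c) K := by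
    intro j
    rw [challengeItem]
    split_ifs with h h'
    · exact (by simp only [Item.Ok, Source.Ok]; omega)
    · exact ⟨hfin hκ _, by simp, id⟩
    · exact ⟨hfin hκ _, hm _ _, id⟩
  refine forall_mem_layout₁ ?_ (fun i => hc _) (fun i => hfin hσ _) (hfin hκ _) (fun i => hfin hκ _)
    (fun i => hfin hκ _) (fun i => hfin hκ _) (fun i => hc _)
  simp only [List.mem_cons, List.not_mem_nil, or_false, forall_eq_or_imp, forall_eq]
  refine ⟨?_, ?_, hfin hσ _, hδ⟩ <;> simp only [Item.Ok, Source.Ok] <;> omega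

lemma challengeItems_val {m : Side κ σ s → Fin s ⊕ Fin s → ℤ} (ch : Choice κ σ s)
    (pk : PublicKey) [NeZero pk.N] (c : ℕ) (μ : State) (h0 : μ 0 = pk.N) (h1 : μ 1 = pk.h.val)
    (h2 : μ 2 = c) :
    (challengeItems δ m ch).map (Item.val pk.N pk.h.val μ) =
      input₁ δ pk ch.1 (Function.update
        (fun j => (enc pk (if ch.2.2.1 j then 0 else m ch.1 j) (ch.2.2.2 j)).val) ch.2.1 c) := by
  have hc : ∀ j, (challengeItem m ch j).val pk.N pk.h.val μ = Function.update
        (fun j => (enc pk (if ch.2.2.1 j then 0 else m ch.1 j) (ch.2.2.2 j)).val) ch.2.1 c j := by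
    intro j
    rw [challengeItem]
    by_cases h : j = ch.2.1
    · rw [if_pos h, h, Function.update_self]
      exact h2
    · rw [if_neg h, Function.update_of_ne h, enc_val]
      rfl
  rw [challengeItems, map_layout₁, input₁]
  simp only [hc]
  simp [Item.val, Source.val, h0, h1]

/-- The distinguisher against the encryption scheme obtained from a distinguisher of views. -/
def reduction₁ (D : Prog) (K L δ : ℕ) (m : Side κ σ s → Fin s ⊕ Fin s → ℤ) (ch : Choice κ σ s) :
    Prog :=
  reductionProg D K (s * L.size - 1) (challengeItems δ m ch)

/-- The acceptance probability with a challenge that encrypts `v`. -/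
lemma encGame_reduction₁ {D : Prog} {K : ℕ} {m : Side κ σ s → Fin s ⊕ Fin s → ℤ}
    (ch : Choice κ σ s) (hL : 0 < L) (hs : 0 < s) (hn : n < K) (hκ : 4 * κ ≤ K) (hσ : σ ≤ K)
    (hδ : δ.size ≤ K) (hm : ∀ z j, (m z j).natAbs.size ≤ K) (v : ℤ) :
    encGame κ n v (reduction₁ D K L δ m ch) = 𝔼 r : EncCoin κ, expPK κ n fun pk =>
      if Fits pk L s then D.acceptProb (input₁ δ pk ch.1 (Function.update
        (fun j => (enc pk (if ch.2.2.1 j then 0 else m ch.1 j) (ch.2.2.2 j)).val) ch.2.1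
          (enc pk v r).val)) else 0 := by
  rw [encGame, expPK_expect]
  refine Finset.expect_congr rfl fun r _ => expPK_congr fun t ht y => ?_
  simp only [fits_iff hL hs]
  exact reductionProg_acceptProb (lt_trans one_pos (one_lt_modulus ht))
    ((Nat.size_le.mp (modulus_size_le ht)).trans (Nat.pow_lt_pow_right (by norm_num) hn))
    (by omega) (challengeItems_ok ch hκ hσ hδ hm)
    fun μ h0 h1 h2 => challengeItems_val ch (pubKey t y) _ μ h0 h1 h2

/-- The masks are fixed first because the plaintexts of the answers depend on them. The objects
exchanged are ciphertexts as functions of the public key, so the expectation over keys stays inside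
the hybrid functional, as in the encryption game. -/
lemma viewGame_hybrid {D : Prog} {K : ℕ} {m : Side κ σ s → Fin s ⊕ Fin s → ℤ}
    (hL : 0 < L) (hs : 0 < s) (hn : n < K) (hκ : 4 * κ ≤ K) (hσ : σ ≤ K)
    (hδ : δ.size ≤ K) (hm : ∀ z j, (m z j).natAbs.size ≤ K) {ε : ℝ}
    (h : ∀ ch : Choice κ σ s, |encGame κ n (m ch.1 ch.2.1) (reduction₁ D K L δ m ch) -
      encGame κ n 0 (reduction₁ D K L δ m ch)| ≤ ε) :
    |viewGame κ n σ L δ D m - viewGame κ n σ L δ (s := s) D fun _ _ => 0| ≤ (2 * s : ℕ) * ε := by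
  have hε : 0 ≤ ε := (abs_nonneg _).trans (h ⟨⟨0, 0, 0, 0, 0, 0⟩, .inl ⟨0, hs⟩, fun _ => false, 0⟩)
  refine abs_expect_sub_le (by positivity) fun z _ => ?_
  let g : Bool → Fin s ⊕ Fin s → EncCoin κ → PublicKey → ℕ := fun b j a pk =>
    (enc pk (if b then 0 else m z j) a).val
  let f : (Fin s ⊕ Fin s → PublicKey → ℕ) → ℝ := fun Y => expPK κ n fun pk =>
    if Fits pk L s then D.acceptProb (input₁ δ pk z fun j => Y j pk) else 0
  have := hybrid g f (ε := ε) fun i b a => by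
    have e := fun v => encGame_reduction₁ (D := D) (m := m) ⟨z, i, b, a⟩ hL hs hn hκ hσ hδ hm v
    have h1 := h ⟨z, i, b, a⟩
    rw [e, e] at h1
    refine le_trans (le_of_eq ?_) h1
    have e2 : ∀ (b' : Bool) (r : EncCoin κ),
        f (Function.update (fun j => g (b j) j (a j)) i (g b' i r)) = expPK κ n fun pk =>
        if Fits pk L s then D.acceptProb (input₁ δ pk z (Function.update
        (fun j => (enc pk (if b j then 0 else m z j) (a j)).val) i
          (enc pk (if b' then 0 else m z i) r).val)) else 0 := by
      intro b' r
      have : ∀ pk, (fun j => Function.update (fun j => g (b j) j (a j)) i (g b' i r) j pk) =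
          Function.update (fun j => (enc pk (if b j then 0 else m z j) (a j)).val) i
          (enc pk (if b' then 0 else m z i) r).val := by
        intro pk
        funext j
        by_cases hj : j = i
        · subst hj
          simp [g]
        · simp [hj, g]
      simp only [f, this]
    simp only [e2]
    simp
  have hcard : Fintype.card (Fin s ⊕ Fin s) = 2 * s := by
    simp
    ring
  rw [hcard] at this
  simpa [g, f] using this

end

/-! ### Hard-wiring the best choice, and the conclusion for the first server. -/

lemma size_two_pow_le {a k : ℕ} (h : a ≤ 2 ^ k) : a.size ≤ k + 1 :=
  (Nat.size_le_size h).trans (by rw [Nat.size_pow])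

/-- The plaintexts in the view of `S₁` have polynomial length. -/
lemma message_size_le {ℓ σ δ s : ℕ} (hσ : ℓ < σ) {x : Fin s → ℤ} (hx : Admissible ℓ δ x)
    (r : Fin s → Fin (2 ^ σ)) (j : Fin s ⊕ Fin s) :
    (Sum.elim x (fun i => (x i + r i) ^ 2) j : ℤ).natAbs.size ≤ 2 * σ + 2 := by
  obtain ⟨-, hx⟩ := hx
  have h1 : ∀ i, (x i).natAbs ≤ 2 ^ σ := by
    intro i
    have h2 : (2 : ℤ) ^ ℓ ≤ 2 ^ σ := pow_le_pow_right₀ (by norm_num) hσ.le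
    obtain ⟨h3, h4, -⟩ := hx i
    zify
    rw [abs_le]
    constructor <;> linarith
  rcases j with i | i
  · exact (size_two_pow_le (h1 i)).trans (by omega)
  · simp only [Sum.elim_inr, sq, Int.natAbs_mul]
    have h5 : (x i + (r i : ℕ)).natAbs ≤ 2 ^ (σ + 1) - 1 := by
      have := (r i).2
      have h6 := h1 i
      have h7 : (x i + (r i : ℕ)).natAbs ≤ (x i).natAbs + r i := by omega
      rw [pow_succ]
      omega
    have h8 : (x i + (r i : ℕ)).natAbs.size ≤ σ + 1 := by
      rw [Nat.size_le]
      have : 0 < 2 ^ (σ + 1) := by positivity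
      omega
    exact (size_mul_le _ _).trans (by omega)

/-- Keys for which the values do not fit contribute nothing. -/
lemma expKeys_eq_zero {κ n σ L s : ℕ} {η : ℕ × ℕ × ℕ × ℕ → ℕ → ℤ} (hL : 0 < L)
    (h : n < s * L.size) (f : Keys → ℝ) :
    (expKeys κ n σ η fun K => if Fits K.pk L s then f K else 0) = 0 := by
  refine Finset.expect_eq_zero fun t ht => Finset.expect_eq_zero fun y _ =>
    Finset.expect_eq_zero fun a _ => if_neg fun hfit => ?_
  have := mul_size_le_of_fits (y := y) ht hL hfit
  omega

/-- For one value of the security parameter, the advantage in distinguishing views is bounded by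
the advantage in distinguishing encryptions of two messages. -/
lemma exists_reduction₁ {κ n σ ℓ L δ s : ℕ} (η : ℕ × ℕ × ℕ × ℕ → ℕ → ℤ) (hσ : ℓ < σ)
    (hL : 2 ^ (σ + 2) ≤ L) {x : Fin s → ℤ} (hx : Admissible ℓ δ x) (hgood : s * L.size ≤ n)
    (D : Prog) :
    ∃ (v : ℤ) (K k : ℕ) (items : List Item), v.natAbs.size ≤ 2 * n + 2 ∧ k ≤ K ∧
      K ≤ 4 * κ + 2 * n + 3 ∧ items.length ≤ 6 * n + 5 ∧ (∀ it ∈ items, it.Ok (3 + D.coins) K) ∧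
      |real₁ κ n σ η L δ x D - ideal₁ κ n σ η L δ s (sim₁ κ n σ s) D| ≤
        (2 * n : ℕ) * |encGame κ n v (reductionProg D K k items) -
          encGame κ n 0 (reductionProg D K k items)| := by
  have hL0 : 0 < L := lt_of_lt_of_le (by positivity) hL
  have hLs : σ + 3 ≤ L.size := by
    have h1 := Nat.size_le_size hL
    rw [Nat.size_pow] at h1
    omega
  have hsn : s ≤ n := (Nat.le_mul_of_pos_right s (by omega)).trans hgood
  have hσn : 0 < s → σ ≤ n := fun hs =>
    le_trans (by omega) ((Nat.le_mul_of_pos_left L.size hs).trans hgood)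
  rw [real₁_eq η hσ hL hx, ideal₁_eq η hσn]
  rcases Nat.eq_zero_or_pos s with hs | hs
  · subst hs
    refine ⟨0, 0, 0, [], by simp, le_rfl, by omega, by simp, by simp, ?_⟩
    have : (fun (z : Side κ σ 0) => (Sum.elim x fun i => (x i + z.2.1 i) ^ 2 : _ → ℤ)) =
        fun _ _ => 0 := by
      funext z j
      rcases j with j | j <;> exact j.elim0
    rw [this, sub_self, abs_zero]
    positivity
  · have hm : ∀ (z : Side κ σ s) j,
        (Sum.elim x (fun i => (x i + z.2.1 i) ^ 2) j : ℤ).natAbs.size ≤ 2 * σ + 2 :=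
      fun z j => message_size_le hσ hx z.2.1 j
    have hδ : δ.size ≤ σ := (size_two_pow_le hx.1).trans hσ
    have hσn := hσn hs
    set m : Side κ σ s → Fin s ⊕ Fin s → ℤ := fun z => Sum.elim x fun i => (x i + z.2.1 i) ^ 2
    set K := 4 * κ + 2 * n + 3 with hK
    have : Nonempty (Choice κ σ s) := ⟨⟨0, 0, 0, 0, 0, 0⟩, .inl ⟨0, hs⟩, fun _ => false, 0⟩
    -- Non-uniformity enters here: for each κ a choice with the largest advantage is hard-wired, and
    -- its advantage dominates every hybrid step.
    obtain ⟨ch, hch⟩ := Finite.exists_max fun ch : Choice κ σ s =>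
      |encGame κ n (m ch.1 ch.2.1) (reduction₁ D K L δ m ch) -
        encGame κ n 0 (reduction₁ D K L δ m ch)|
    refine ⟨m ch.1 ch.2.1, K, s * L.size - 1, challengeItems δ m ch, (hm _ _).trans (by omega),
      by omega, le_rfl, ?_, challengeItems_ok ch (by omega) (by omega) (by omega)
        (fun z j => (hm z j).trans (by omega)), ?_⟩
    · rw [challengeItems, length_layout₁]
      simp only [List.length_cons, List.length_nil]
      omega
    · refine (viewGame_hybrid hL0 hs (by omega) (by omega) (by omega) (by omega)
        (fun z j => (hm z j).trans (by omega)) hch).trans ?_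
      refine mul_le_mul_of_nonneg_right ?_ (abs_nonneg _)
      exact_mod_cast Nat.mul_le_mul_left 2 hsn

theorem privateAgainstS₁ (n σ ℓ L s : ℕ → ℕ) (η : ℕ → ℕ × ℕ × ℕ × ℕ → ℕ → ℤ)
    (hn : PolyBounded n) (hσ : ∀ κ, ℓ κ < σ κ) (hL : ∀ κ, 2 ^ (σ κ + 2) ≤ L κ)
    (hsec : SemanticallySecure n) : PrivateAgainstS₁ n σ ℓ L s η := by
  have cst := polyBounded_const
  have hL0 : ∀ κ, 0 < L κ := fun κ => lt_of_lt_of_le (by positivity) (hL κ)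
  -- If s|L| > n, no key admits s values and both games are zero, so the simulator may use s = 0.
  -- This keeps it polynomial although no bound on s or σ is assumed.
  let s' : ℕ → ℕ := fun κ => if s κ * (L κ).size ≤ n κ then s κ else 0
  have hs' : ∀ κ, s' κ ≤ n κ ∧ s' κ * σ κ ≤ n κ ∧ (0 < s' κ → σ κ ≤ n κ) := by
    intro κ
    simp only [s']
    split_ifs with h
    · have h1 := Nat.size_le_size (hL κ)
      rw [Nat.size_pow] at h1
      refine ⟨(Nat.le_mul_of_pos_right _ (by omega)).trans h,
        (Nat.mul_le_mul_left _ (by omega)).trans h, fun hs => ?_⟩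
      exact le_trans (by omega) ((Nat.le_mul_of_pos_left _ hs).trans h)
    · simp
  refine ⟨fun κ => sim₁ κ (n κ) (σ κ) (s' κ), ?_, fun δ x hx D hD => ?_⟩
  · refine isPPT_listProg (p := fun κ => 5 * (n κ * (4 * κ)) + n κ + 4 * κ + (4 * κ + n κ + 1) +
      (6 * n κ + 1)) ?_ fun κ => ?_
    · have h4 := (cst 4).mul polyBounded_id
      exact ((((((cst 5).mul (hn.mul h4)).add hn).add h4).add ((h4.add hn).add (cst 1))).add
        (((cst 6).mul hn).add (cst 1)))
    · obtain ⟨h1, h2, h3⟩ := hs' κ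
      refine ⟨_, _, _, 0, _, _, rfl, by omega, Safe.nil,
        simItems₁_ok (by omega) (fun h => (h3 h).trans (by omega)), ?_, by omega, by omega, ?_⟩
      · have h4 : s' κ * (4 * κ) ≤ n κ * (4 * κ) := Nat.mul_le_mul_right _ h1
        simp only [coins₁]
        omega
      · rw [simItems₁, length_layout₁, List.length_nil]
        omega
  · have key : ∀ κ, ∃ (v : ℤ) (K k : ℕ) (items : List Item), v.natAbs.size ≤ 2 * n κ + 2 ∧
        k ≤ K ∧ K ≤ 4 * κ + 2 * n κ + 3 ∧ items.length ≤ 6 * n κ + 5 ∧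
        (∀ it ∈ items, it.Ok (3 + (D κ).coins) K) ∧
        |real₁ κ (n κ) (σ κ) (η κ) (L κ) (δ κ) (x κ) (D κ) -
          ideal₁ κ (n κ) (σ κ) (η κ) (L κ) (δ κ) (s κ) (sim₁ κ (n κ) (σ κ) (s' κ)) (D κ)| ≤
        (2 * n κ : ℕ) * |encGame κ (n κ) v (reductionProg (D κ) K k items) -
          encGame κ (n κ) 0 (reductionProg (D κ) K k items)| := by
      intro κ
      by_cases h : s κ * (L κ).size ≤ n κ
      · have : s' κ = s κ := if_pos h
        rw [this]
        exact exists_reduction₁ (η κ) (hσ κ) (hL κ) (hx κ) h (D κ)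
      · refine ⟨0, 0, 0, [], by simp, le_rfl, by omega, by simp, by simp, ?_⟩
        rw [real₁, ideal₁, expKeys_eq_zero (hL0 κ) (by omega), expKeys_eq_zero (hL0 κ) (by omega),
          sub_self, abs_zero]
        positivity
    choose v K k items h1 h2 h3 h4 h5 h6 using key
    have hppt : IsPPT fun κ => reductionProg (D κ) (K κ) (k κ) (items κ) := by
      refine isPPT_reductionProg hD (p := fun κ => (4 * κ + 2 * n κ + 3) + (6 * n κ + 5)) ?_
        fun κ => ⟨_, _, _, rfl, h2 κ, (h3 κ).trans (by omega), (h4 κ).trans (by omega), h5 κ⟩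
      exact ((((cst 4).mul polyBounded_id).add ((cst 2).mul hn)).add (cst 3)).add
        (((cst 6).mul hn).add (cst 5))
    have hneg := hsec v (fun _ => 0) ((((cst 2).mul hn).add (cst 2)).of_le h1)
      ((cst 0).of_le fun κ => by simp) _ hppt
    exact (hneg.polyBounded_mul ((cst 2).mul hn) fun κ => abs_nonneg _).of_le
      (fun κ => abs_nonneg _) h6

/-! ## Privacy against the second server -/

/-! ### Weighted sums -/

/-- Only registers below `A` are read. -/
def Source.IsInput (A : ℕ) : Source → Prop
  | .cst _ => True
  | .reg i => i < A
  | .bits o k => o + k ≤ A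

lemma Source.val_congr_input {A : ℕ} {μ ν : State} {src : Source} (hs : src.IsInput A)
    (h : ∀ r, r < A → ν r = μ r) : src.val ν = src.val μ := by
  cases src with
  | cst c => rfl
  | reg i => exact h i hs
  | bits o k =>
    simp only [Source.val, bitsVal]
    refine Finset.sum_congr rfl fun j hj => ?_
    rw [h _ (by have := Finset.mem_range.mp hj; simp only [Source.IsInput] at hs; omega)]

/-- Addition of a multiple of a number to register `d`, modulo the number in register `m`. -/
def accCode (A d m : ℕ) (p : Source × ℕ) : List Instr :=
  p.1.code A ++ [.const (A + 13) p.2] ++ mulMod (A + 9) (A + 9) (A + 13) m ++ addMod d d (A + 9) m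

lemma accCode_spec {A K N h d m : ℕ} {μ : State} (q : Params A K N h μ) (hd : d = A + 6 ∨ d = A + 7)
    (hm : m ∈ moduli A) {p : Source × ℕ} (hp : p.1.Ok A K) :
    (∀ r, r ≠ d → r ≠ A + 9 → r ≠ A + 13 → execCode (accCode A d m p) μ r = μ r) ∧
      execCode (accCode A d m p) μ d = (μ d + p.1.val μ * p.2 % μ m) % μ m := by
  have hm' : m = A ∨ m = A + 3 ∨ m = A + 5 := by simpa [moduli] using hm
  obtain ⟨f₁, v₁⟩ := Source.code_spec q hp
  simp only [accCode, execCode_append, execCode_mulMod (show m ≠ A + 9 by omega),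
    execCode_addMod (show m ≠ d by omega), execCode, Instr.exec]
  generalize execCode (p.1.code A) μ = μ₁ at *
  obtain ⟨μ₂, e, v₂, f₂⟩ := exists_update μ₁ (A + 13) p.2
  rw [e]; clear e
  obtain ⟨μ₃, e, v₃, f₃⟩ := exists_update μ₂ (A + 9) (μ₂ (A + 9) * μ₂ (A + 13) % μ₂ m)
  rw [e]; clear e
  refine ⟨fun r h1 h2 h3 => ?_, ?_⟩
  · rw [Function.update_of_ne h1, f₃ _ h2, f₂ _ h3, f₁ _ h2 h3]
  · rw [Function.update_self, v₃, v₂, f₃ _ (by omega), f₃ _ (by omega), f₂ _ (by omega),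
      f₂ _ (by omega), f₂ _ (by omega), v₁, f₁ _ (by omega) (by omega), f₁ _ (by omega) (by omega)]

lemma safe_accCode {A K G d m : ℕ} (hG : K ≤ G) (hd : d = A + 6 ∨ d = A + 7)
    (hm : m ∈ moduli A) {p : Source × ℕ} (hp : p.1.Ok A K) (hc : p.2.size ≤ K) :
    Safe (moduli A) G (accCode A d m p) (7 + 7 * K) := by
  have hd' : d ∉ moduli A := by
    rcases hd with rfl | rfl <;> exact not_mem_moduli A (by norm_num)
  exact ((((safe_sourceCode hG hp).append (Safe.const (not_mem_moduli A (by norm_num))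
    (hc.trans hG))).append (Safe.mulMod _ _ (not_mem_moduli A (by norm_num)) hm)).append
    (Safe.addMod _ _ hd' hm)).mono (by omega)

/-- The sum of multiples of numbers, in register `d`, modulo the number in register `m`. -/
def sumCode (A d m : ℕ) : List (Source × ℕ) → List Instr
  | [] => [.const d 0]
  | p :: l => sumCode A d m l ++ accCode A d m p

/-- The terms read only input registers, which the accumulation leaves alone, so each is evaluated
as in the initial state. Reducing after every addition gives the residue of the full sum. -/
lemma sumCode_spec {A K N h d m : ℕ} {μ : State} (q : Params A K N h μ) (hd : d = A + 6 ∨ d = A + 7)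
    (hm : m ∈ moduli A) (hm0 : μ m ≠ 0) {l : List (Source × ℕ)}
    (hl : ∀ p ∈ l, p.1.Ok A K ∧ p.1.IsInput A) :
    (∀ r, r ≠ d → r ≠ A + 9 → r ≠ A + 13 → execCode (sumCode A d m l) μ r = μ r) ∧
      execCode (sumCode A d m l) μ d = (l.map fun p => p.1.val μ * p.2).sum % μ m := by
  have hm' : m = A ∨ m = A + 3 ∨ m = A + 5 := by simpa [moduli] using hm
  induction l with
  | nil =>
    simp only [sumCode, execCode, Instr.exec, List.map_nil, List.sum_nil, Nat.zero_mod,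
      Function.update_self, and_true]
    exact fun r h1 _ _ => Function.update_of_ne h1 _ _
  | cons p l ih =>
    obtain ⟨f₁, v₁⟩ := ih fun p' hp' => hl p' (by simp [hp'])
    simp only [sumCode, execCode_append]
    generalize execCode (sumCode A d m l) μ = μ₁ at *
    have q₁ : Params A K N h μ₁ := q.frame fun r h1 h2 => f₁ r (by omega) (by omega) (by omega)
    obtain ⟨f₂, v₂⟩ := accCode_spec q₁ hd hm (hl p (by simp)).1
    refine ⟨fun r h1 h2 h3 => (f₂ r h1 h2 h3).trans (f₁ r h1 h2 h3), ?_⟩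
    rw [v₂, v₁, f₁ m (by omega) (by omega) (by omega),
      Source.val_congr_input (hl p (by simp)).2 fun r hr => f₁ r (by omega) (by omega) (by omega),
      List.map_cons, List.sum_cons, ← Nat.add_mod, add_comm]

lemma safe_sumCode {A K G d m : ℕ} (hG : K ≤ G) (hd : d = A + 6 ∨ d = A + 7)
    (hm : m ∈ moduli A) {l : List (Source × ℕ)} (hl : ∀ p ∈ l, p.1.Ok A K ∧ p.2.size ≤ K) :
    Safe (moduli A) G (sumCode A d m l) (1 + l.length * (7 + 7 * K)) := by
  have hd' : d ∉ moduli A := by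
    rcases hd with rfl | rfl <;> exact not_mem_moduli A (by norm_num)
  induction l with
  | nil => exact (Safe.const hd' (by simp)).mono (by simp)
  | cons p l ih =>
    obtain ⟨h1, h2⟩ := hl p (by simp)
    exact ((ih fun p' hp' => hl p' (by simp [hp'])).append (safe_accCode hG hd hm h1 h2)).mono
      (by rw [List.length_cons]; ring_nf; rfl)

/-! ### The message of the first server -/

/-- From the plaintext in register `A + 6` and the exponent in register `A + 7`, the ciphertext and
its partial decryption with `sk₁ = 1 - sk₂ mod N`, in these registers. -/
def messageCode (A K : ℕ) : List Instr :=
  [.div (A + 8) (A + 6) (A + 1), .div (A + 9) (A + 7) (A + 1)] ++ encCode A K ++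
  [.div (A + 6) (A + 10) (A + 1), .mod (A + 8) 2 A, .mod (A + 9) 3 A,
    .sub (A + 13) A (A + 8)] ++ addMod (A + 9) (A + 9) (A + 13) A ++
  addMod (A + 9) (A + 9) (A + 1) A ++ powCode A K (A + 3) (A + 6) (A + 9) ++
  [.div (A + 7) (A + 10) (A + 1)]

lemma safe_messageCode (A K G : ℕ) (hG : 0 < G) :
    Safe (moduli A) G (messageCode A K) (29 + 36 * K) := by
  have m0 : A ∈ moduli A := by simp [moduli]
  have m3 : A + 3 ∈ moduli A := by simp [moduli]
  have h : ∀ i, 6 ≤ i → A + i ∉ moduli A := fun i => not_mem_moduli A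
  have s1 : Safe (moduli A) G
      [.div (A + 8) (A + 6) (A + 1), .div (A + 9) (A + 7) (A + 1)] (1 + 1) :=
    (Safe.div _ _ (h _ (by norm_num))).append (Safe.div _ _ (h _ (by norm_num)))
  have s2 : Safe (moduli A) G [.div (A + 6) (A + 10) (A + 1), .mod (A + 8) 2 A, .mod (A + 9) 3 A,
      .sub (A + 13) A (A + 8)] (1 + 1 + 1 + 1) :=
    (((Safe.div _ _ (h _ (by norm_num))).append (Safe.mod _ _ (h _ (by norm_num)))).append
      (Safe.mod _ _ (h _ (by norm_num)))).append (Safe.sub _ _ (h _ (by norm_num)))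
  exact (((((((s1.append (safe_encCode A K G hG)).append s2).append
    (Safe.addMod _ _ (h _ (by norm_num)) m0)).append
    (Safe.addMod _ _ (h _ (by norm_num)) m0)).append (safe_powCode A K G _ _ hG m3)).append
    (Safe.div _ _ (h _ (by norm_num))))).mono (by omega)

/-- Registers 2 and 3 hold the positive and negative parts of sk₂, so the exponent is a
representative of 1 - sk₂ modulo N. The ciphertext is saved in A + 6 before the working space is
used again. -/
lemma messageCode_spec {A K N h : ℕ} {μ : State} (p : Params A K N h μ) (hA : 4 ≤ A)
    (hr : μ (A + 7) < 2 ^ K) :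
    (∀ r, r < A + 6 → execCode (messageCode A K) μ r = μ r) ∧
    execCode (messageCode A K) μ (A + 6) = encNat N h (μ (A + 6)) (μ (A + 7)) ∧
    execCode (messageCode A K) μ (A + 7) = encNat N h (μ (A + 6)) (μ (A + 7)) ^
      (((μ 3 % N + (N - μ 2 % N)) % N + 1) % N) % N ^ 2 := by
  have m3 : A + 3 ∈ moduli A := by simp [moduli]
  simp only [messageCode, execCode_append, execCode, Instr.exec,
    execCode_addMod (show A ≠ A + 9 by omega)]
  obtain ⟨μ₁, e, v₁, f₁⟩ := exists_update μ (A + 8) (μ (A + 6) / μ (A + 1))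
  rw [e]; clear e
  obtain ⟨μ₂, e, v₂, f₂⟩ := exists_update μ₁ (A + 9) (μ₁ (A + 7) / μ₁ (A + 1))
  rw [e]; clear e
  have lo₂ : ∀ r, r < A + 8 → μ₂ r = μ r := fun r hr => by
    rw [f₂ _ (by omega), f₁ _ (by omega)]
  have p₂ : Params A K N h μ₂ := p.frame fun r _ h2 => lo₂ r (by omega)
  have x₂ : μ₂ (A + 8) = μ (A + 6) := by rw [f₂ _ (by omega), v₁, p.one_eq, Nat.div_one]
  have y₂ : μ₂ (A + 9) = μ (A + 7) := by
    rw [v₂, f₁ _ (by omega), f₁ _ (by omega), p.one_eq, Nat.div_one]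
  obtain ⟨f₃, v₃⟩ := encCode_spec p₂ (by rw [y₂]; exact hr)
  rw [x₂, y₂] at v₃
  generalize execCode (encCode A K) μ₂ = μ₃ at *
  have lo₃ : ∀ r, r < A + 8 → μ₃ r = μ r := fun r hr => by rw [f₃ _ (by omega), lo₂ _ hr]
  obtain ⟨μ₄, e, v₄, f₄⟩ := exists_update μ₃ (A + 6) (μ₃ (A + 10) / μ₃ (A + 1))
  rw [e]; clear e
  rw [v₃, lo₃ _ (by omega), p.one_eq, Nat.div_one] at v₄
  have lo₄ : ∀ r, r < A + 6 → μ₄ r = μ r := fun r hr => by rw [f₄ _ (by omega), lo₃ _ (by omega)]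
  obtain ⟨μ₅, e, v₅, f₅⟩ := exists_update μ₄ (A + 8) (μ₄ 2 % μ₄ A)
  rw [e]; clear e
  rw [lo₄ _ (by omega), lo₄ _ (by omega), p.N_eq] at v₅
  obtain ⟨μ₆, e, v₆, f₆⟩ := exists_update μ₅ (A + 9) (μ₅ 3 % μ₅ A)
  rw [e]; clear e
  rw [f₅ _ (by omega), f₅ _ (by omega), lo₄ _ (by omega), lo₄ _ (by omega), p.N_eq] at v₆
  obtain ⟨μ₇, e, v₇, f₇⟩ := exists_update μ₆ (A + 13) (μ₆ A - μ₆ (A + 8))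
  rw [e]; clear e
  have N₆ : μ₆ A = N := by rw [f₆ _ (by omega), f₅ _ (by omega), lo₄ _ (by omega), p.N_eq]
  rw [N₆, f₆ _ (by omega), v₅] at v₇
  have N₇ : μ₇ A = N := by rw [f₇ _ (by omega), N₆]
  obtain ⟨μ₈, e, v₈, f₈⟩ := exists_update μ₇ (A + 9) ((μ₇ (A + 9) + μ₇ (A + 13)) % μ₇ A)
  rw [e]; clear e
  rw [f₇ _ (by omega), v₆, v₇, N₇] at v₈
  obtain ⟨μ₉, e, v₉, f₉⟩ := exists_update μ₈ (A + 9) ((μ₈ (A + 9) + μ₈ (A + 1)) % μ₈ A)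
  rw [e]; clear e
  have lo₈ : ∀ r, r < A + 8 → μ₈ r = μ₄ r := fun r hr => by
    rw [f₈ _ (by omega), f₇ _ (by omega), f₆ _ (by omega), f₅ _ (by omega)]
  rw [v₈, lo₈ _ (by omega), lo₈ _ (by omega), lo₄ _ (by omega), lo₄ _ (by omega), p.one_eq,
    p.N_eq] at v₉
  have lo₉ : ∀ r, r < A + 8 → μ₉ r = μ₄ r := fun r hr => by rw [f₉ _ (by omega), lo₈ _ hr]
  have p₉ : Params A K N h μ₉ := p.frame fun r _ h2 => by rw [lo₉ _ (by omega), lo₄ _ h2]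
  have e₉ : μ₉ (A + 9) < 2 ^ K := by
    rw [v₉]
    exact (Nat.mod_lt _ p.N_pos).trans p.N_lt
  obtain ⟨fr, v⟩ := powCode_spec m3 p.K_pos p₉.one_eq p₉.two_eq
    (by rw [p₉.sq_eq]; exact pow_ne_zero _ p.N_pos.ne') e₉ (b := A + 6) (by omega)
  rw [p₉.sq_eq, v₉, lo₉ _ (by omega), v₄] at v
  generalize execCode (powCode A K (A + 3) (A + 6) (A + 9)) μ₉ = ξ at *
  refine ⟨fun r hr => ?_, ?_, ?_⟩
  · rw [Function.update_of_ne (by omega), fr _ (by omega), lo₉ _ (by omega), lo₄ _ hr]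
  · rw [Function.update_of_ne (by omega), fr _ (by omega), lo₉ _ (by omega), v₄]
  · rw [Function.update_self, v, fr _ (by omega), p₉.one_eq, Nat.div_one]

/-! ### The simulator -/

/-- Number of random bits of the simulator for `S₂`. -/
def coins₂ (w σ s : ℕ) : ℕ := s * w + (s * σ + (1 * w + (s * w + (s * w + 0))))

lemma expect_coins₂ (w σ s : ℕ)
    (G : (Fin s → ℕ) → (Fin s → ℕ) → ℕ → (Fin s → ℕ) → (Fin s → ℕ) → ℝ) :
    (𝔼 ω : Fin (coins₂ w σ s) → Bool,
      G (blocks s w (coinStream ω)) (blocks s σ (dropBits (s * w) (coinStream ω)))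
        (blocks 1 w (dropBits (s * w + s * σ) (coinStream ω)) 0)
        (blocks s w (dropBits (s * w + s * σ + 1 * w) (coinStream ω)))
        (blocks s w (dropBits (s * w + s * σ + 1 * w + s * w) (coinStream ω)))) =
    𝔼 ρx : Fin s → Fin (2 ^ w), 𝔼 r : Fin s → Fin (2 ^ σ), 𝔼 ρδ : Fin (2 ^ w),
      𝔼 ρr : Fin s → Fin (2 ^ w), 𝔼 τ : Fin s → Fin (2 ^ w),
        G (fun i => ρx i) (fun i => r i) ρδ (fun i => ρr i) (fun i => τ i) := by
  simp only [← dropBits_dropBits]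
  refine (expect_blocks s w _ fun X₁ β => G X₁ (blocks s σ β) (blocks 1 w (dropBits (s * σ) β) 0)
    (blocks s w (dropBits (1 * w) (dropBits (s * σ) β)))
    (blocks s w (dropBits (s * w) (dropBits (1 * w) (dropBits (s * σ) β))))).trans
    (Finset.expect_congr rfl fun X₁ _ => ?_)
  refine (expect_blocks s σ _ fun X₂ β => G _ X₂ (blocks 1 w β 0)
    (blocks s w (dropBits (1 * w) β)) (blocks s w (dropBits (s * w) (dropBits (1 * w) β)))).trans
    (Finset.expect_congr rfl fun X₂ _ => ?_)
  refine (expect_blocks 1 w _ fun X₃ β => G _ _ (X₃ 0)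
    (blocks s w β) (blocks s w (dropBits (s * w) β))).trans ?_
  refine Fintype.expect_equiv (Equiv.funUnique (Fin 1) (Fin (2 ^ w))) _ _ fun X₃ => ?_
  refine (expect_blocks s w _ fun X₄ β => G _ _ _ X₄ (blocks s w β)).trans
    (Finset.expect_congr rfl fun X₄ _ => ?_)
  refine (expect_blocks s w 0 fun X₅ _ => G _ _ _ _ X₅).trans
    (Finset.expect_congr rfl fun X₅ _ => ?_)
  exact Fintype.expect_const _

/-- The summands of the packed plaintext. -/
def plainTerms (w σ L s : ℕ) : List (Source × ℕ) :=
  (List.ofFn fun i : Fin s => (bitsAt 5 (s * w) σ i, L ^ (i : ℕ))) ++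
    List.ofFn fun i : Fin s => (.reg 4, L ^ (i : ℕ))

/-- The summands of the exponent of the packed ciphertext. -/
def exponentTerms (w σ L s : ℕ) : List (Source × ℕ) :=
  (List.ofFn fun i : Fin s => (bitsAt 5 0 w i, L ^ (i : ℕ))) ++
    (List.ofFn fun i : Fin s => (bitsAt 5 (s * w + s * σ) w (0 : Fin 1), L ^ (i : ℕ))) ++
    List.ofFn fun i : Fin s => (bitsAt 5 (s * w + s * σ + 1 * w) w i, L ^ (i : ℕ))

/-- Computation of the message of `S₁` for plaintexts that are zero. -/
def simCode₂ (A K w σ L s : ℕ) : List Instr :=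
  sumCode A (A + 6) A (plainTerms w σ L s) ++
    sumCode A (A + 7) (A + 5) (exponentTerms w σ L s) ++ messageCode A K

/-- The entries of the simulated view of `S₂`. -/
def simItems₂ (A w σ s : ℕ) : List Item :=
  [.plain (.reg (A + 6)), .plain (.reg (A + 7))] ++
    List.ofFn fun i : Fin s => .plain (bitsAt 5 (s * w + s * σ + 1 * w + s * w) w i)

/-- The simulator for `S₂`: an execution with plaintexts that are zero. -/
def sim₂ (κ n σ L s : ℕ) : Prog :=
  listProg (coins₂ (4 * κ) σ s) (5 + coins₂ (4 * κ) σ s) (4 * κ + n + 3)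
    (simCode₂ (5 + coins₂ (4 * κ) σ s) (4 * κ + n + 3) (4 * κ) σ L s)
    (simItems₂ (5 + coins₂ (4 * κ) σ s) (4 * κ) σ s)

section

variable {w σ L s K : ℕ}

lemma bitsAt_isInput {e o k i c : ℕ} (h : (bitsAt e o k i).Ok (e + c) K) :
    (bitsAt e o k i).IsInput (e + c) := h.1

lemma pow_size_le (hL : s * L.size ≤ K) (hK : 0 < K) (i : Fin s) : (L ^ (i : ℕ)).size ≤ K := by
  rw [Nat.size_le]
  rcases Nat.eq_zero_or_pos (i : ℕ) with h | h
  · rw [h, pow_zero]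
    exact Nat.one_lt_two_pow hK.ne'
  · calc L ^ (i : ℕ) < (2 ^ L.size) ^ (i : ℕ) := Nat.pow_lt_pow_left (Nat.lt_size_self L) h.ne'
      _ = 2 ^ (i * L.size) := by rw [← pow_mul, mul_comm]
      _ ≤ 2 ^ K := Nat.pow_le_pow_right (by norm_num)
        ((Nat.mul_le_mul_right _ i.2.le).trans hL)

lemma plainTerms_ok (hσ : 0 < s → σ ≤ K) (hL : s * L.size ≤ K) (hK : 0 < K) :
    ∀ p ∈ plainTerms w σ L s, p.1.Ok (5 + coins₂ w σ s) K ∧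
      p.1.IsInput (5 + coins₂ w σ s) ∧ p.2.size ≤ K := by
  intro p hp
  simp only [plainTerms, List.mem_append, List.mem_ofFn] at hp
  rcases hp with ⟨i, rfl⟩ | ⟨i, rfl⟩
  · have := bitsAt_ok (e := 5) (c := coins₂ w σ s) (o := s * w) i.2 (by simp only [coins₂]; omega)
      (hσ i.pos)
    exact ⟨this, bitsAt_isInput this, pow_size_le hL hK i⟩
  · refine ⟨?_, ?_, pow_size_le hL hK i⟩
    · simp only [Source.Ok]
      omega
    · simp only [Source.IsInput]
      omega

lemma exponentTerms_ok (hw : w ≤ K) (hL : s * L.size ≤ K) (hK : 0 < K) :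
    ∀ p ∈ exponentTerms w σ L s, p.1.Ok (5 + coins₂ w σ s) K ∧
      p.1.IsInput (5 + coins₂ w σ s) ∧ p.2.size ≤ K := by
  intro p hp
  simp only [exponentTerms, List.mem_append, List.mem_ofFn] at hp
  rcases hp with (⟨i, rfl⟩ | ⟨i, rfl⟩) | ⟨i, rfl⟩
  · have := bitsAt_ok (e := 5) (c := coins₂ w σ s) (o := 0) i.2 (by simp only [coins₂]; omega) hw
    exact ⟨this, bitsAt_isInput this, pow_size_le hL hK i⟩
  · have := bitsAt_ok (e := 5) (c := coins₂ w σ s) (o := s * w + s * σ) (0 : Fin 1).2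
      (by simp only [coins₂]; omega) hw
    exact ⟨this, bitsAt_isInput this, pow_size_le hL hK i⟩
  · have := bitsAt_ok (e := 5) (c := coins₂ w σ s) (o := s * w + s * σ + 1 * w) i.2
      (by simp only [coins₂]; omega) hw
    exact ⟨this, bitsAt_isInput this, pow_size_le hL hK i⟩

lemma simItems₂_ok (hw : w ≤ K) :
    ∀ it ∈ simItems₂ (5 + coins₂ w σ s) w σ s, it.Ok (5 + coins₂ w σ s) K := by
  intro it h
  simp only [simItems₂, List.mem_append, List.mem_cons, List.not_mem_nil, or_false,
    List.mem_ofFn] at h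
  rcases h with (rfl | rfl) | ⟨i, rfl⟩
  · simp only [Item.Ok, Source.Ok]
    omega
  · simp only [Item.Ok, Source.Ok]
    omega
  · exact bitsAt_ok i.2 (by simp only [coins₂]; omega) hw

lemma safe_simCode₂ (hw : w ≤ K) (hσ : 0 < s → σ ≤ K) (hL : s * L.size ≤ K) (hK : 0 < K) :
    Safe (moduli (5 + coins₂ w σ s)) (K + 1) (simCode₂ (5 + coins₂ w σ s) K w σ L s)
      (31 + 36 * K + 5 * s * (7 + 7 * K)) := by
  have m0 : 5 + coins₂ w σ s ∈ moduli (5 + coins₂ w σ s) := by simp [moduli]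
  have m5 : 5 + coins₂ w σ s + 5 ∈ moduli (5 + coins₂ w σ s) := by simp [moduli]
  refine (((safe_sumCode (K := K) (by omega) (Or.inl rfl) m0 fun p hp => ?_).append
    (safe_sumCode (K := K) (by omega) (Or.inr rfl) m5 fun p hp => ?_)).append
    (safe_messageCode _ K _ (by omega))).mono ?_
  · exact ⟨(plainTerms_ok hσ hL hK p hp).1, (plainTerms_ok hσ hL hK p hp).2.2⟩
  · exact ⟨(exponentTerms_ok hw hL hK p hp).1, (exponentTerms_ok hw hL hK p hp).2.2⟩
  · simp only [plainTerms, exponentTerms, List.length_append, List.length_ofFn]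
    ring_nf
    omega

end

/-! ### The simulated view is the view of an execution with plaintexts zero -/

section

variable {w σ L s c : ℕ} {ν : State} {β : ℕ → ℕ}

lemma plainTerms_sum (hν : ∀ j, j < coins₂ w σ s → ν (5 + j) = β j) :
    ((plainTerms w σ L s).map fun p => p.1.val ν * p.2).sum =
      ∑ i : Fin s, (ν 4 + blocks s σ (dropBits (s * w) β) i) * L ^ (i : ℕ) := by
  have h : ∀ i : Fin s, (bitsAt 5 (s * w) σ i).val ν = blocks s σ (dropBits (s * w) β) i :=
    fun i => bitsAt_val hν (by simp only [coins₂]; omega) i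
  simp only [plainTerms, List.map_append, List.map_ofFn, List.sum_append, List.sum_ofFn,
    Function.comp_apply, h]
  rw [← Finset.sum_add_distrib]
  exact Finset.sum_congr rfl fun i _ => by rw [Source.val]; ring

lemma exponentTerms_sum (hν : ∀ j, j < coins₂ w σ s → ν (5 + j) = β j) :
    ((exponentTerms w σ L s).map fun p => p.1.val ν * p.2).sum =
      ∑ i : Fin s, (blocks s w β i + blocks 1 w (dropBits (s * w + s * σ) β) 0 +
        blocks s w (dropBits (s * w + s * σ + 1 * w) β) i) * L ^ (i : ℕ) := by
  have h1 : ∀ i : Fin s, (bitsAt 5 0 w i).val ν = blocks s w β i := fun i => by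
    rw [bitsAt_val hν (by simp only [coins₂]; omega) i]
    simp only [blocks, bitsVal_dropBits, zero_add]
  have h2 : (bitsAt 5 (s * w + s * σ) w (0 : Fin 1)).val ν =
      blocks 1 w (dropBits (s * w + s * σ) β) 0 :=
    bitsAt_val hν (by simp only [coins₂]; omega) 0
  have h3 : ∀ i : Fin s, (bitsAt 5 (s * w + s * σ + 1 * w) w i).val ν =
      blocks s w (dropBits (s * w + s * σ + 1 * w) β) i :=
    fun i => bitsAt_val hν (by simp only [coins₂]; omega) i
  simp only [exponentTerms, List.map_append, List.map_ofFn, List.sum_append, List.sum_ofFn,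
    Function.comp_apply, h1, h2, h3]
  rw [← Finset.sum_add_distrib, ← Finset.sum_add_distrib]
  exact Finset.sum_congr rfl fun i _ => by ring

/-- Three exponents below 2^w per position and Σ L^i < L^s ≤ 2^n give less than 8 · 2^w · 2^n. So
the simulator, which sums modulo 2^K with K ≥ w + n + 3, obtains the true exponent. -/
lemma sum_exponents_lt {n : ℕ} (hL : 1 < L) (hn : s * L.size ≤ n) {a b : Fin s → ℕ} {d : ℕ}
    (ha : ∀ i, a i < 2 ^ w) (hd : d < 2 ^ w) (hb : ∀ i, b i < 2 ^ w) :
    ∑ i : Fin s, (a i + d + b i) * L ^ (i : ℕ) < 2 ^ (w + n + 3) := by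
  have h1 : ∑ i : Fin s, (a i + d + b i) * L ^ (i : ℕ) ≤ ∑ i : Fin s, 3 * 2 ^ w * L ^ (i : ℕ) :=
    Finset.sum_le_sum fun i _ => Nat.mul_le_mul_right _ (by have := ha i; have := hb i; omega)
  have h2 : ∑ i ∈ Finset.range s, 1 * L ^ i < L ^ s := sum_mul_pow_lt (fun _ => hL) s
  have h3 : L ^ s ≤ 2 ^ n := by
    calc L ^ s ≤ (2 ^ L.size) ^ s := Nat.pow_le_pow_left (Nat.lt_size_self L).le s
      _ = 2 ^ (s * L.size) := by rw [← pow_mul, mul_comm]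
      _ ≤ 2 ^ n := Nat.pow_le_pow_right (by norm_num) hn
  rw [Finset.sum_range] at h2
  simp only [one_mul] at h2
  rw [← Finset.mul_sum] at h1
  calc _ ≤ 3 * 2 ^ w * ∑ i : Fin s, L ^ (i : ℕ) := h1
    _ ≤ 3 * 2 ^ w * 2 ^ n := Nat.mul_le_mul_left _ (by omega)
    _ < 8 * (2 ^ w * 2 ^ n) := by
      have : 0 < 2 ^ w * 2 ^ n := by positivity
      rw [mul_assoc]
      omega
    _ = 2 ^ (w + n + 3) := by ring

end

/-- The first threshold key is determined by the second one. -/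
lemma recover_sk₁ {N k : ℕ} [NeZero N] {j : ℤ} (h : ((k + j : ℤ) : ZMod N) = 1) (hk : k < N) :
    (((-j).toNat % N + (N - j.toNat % N)) % N + 1) % N = k := by
  have h1 : j.toNat % N ≤ N := (Nat.mod_lt _ (NeZero.pos N)).le
  have h2 : ((((-j).toNat % N + (N - j.toNat % N)) % N + 1 : ℕ) : ZMod N) = (k : ZMod N) := by
    have h3 : ((j.toNat : ℤ) : ZMod N) - (((-j).toNat : ℤ) : ZMod N) = (j : ZMod N) := by
      rw [← Int.cast_sub, Int.toNat_sub_toNat_neg]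
    push_cast [Nat.cast_sub h1] at h h3 ⊢
    simp only [ZMod.natCast_mod, ZMod.natCast_self, Nat.cast_add, Nat.cast_sub h1]
    linear_combination -h - h3
  rw [← ZMod.val_natCast, h2, ZMod.val_natCast, Nat.mod_eq_of_lt hk]

lemma val_pow_mod {M : ℕ} [NeZero M] (c : ZMod M) (k : ℕ) : c.val ^ k % M = (c ^ k).val := by
  rw [← ZMod.val_natCast]
  simp

lemma simCode₂_spec {K N h n w σ L s : ℕ} {μ : State} {β : ℕ → ℕ}
    (p : Params (5 + coins₂ w σ s) K N h μ) (hw : w ≤ K) (hσ : 0 < s → σ ≤ K)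
    (hK : w + n + 3 ≤ K) (hL : 1 < L) (hn : s * L.size ≤ n)
    (hβ : ∀ j, j < coins₂ w σ s → μ (5 + j) = β j) {ν : State}
    (hν : execCode (simCode₂ (5 + coins₂ w σ s) K w σ L s) μ = ν) {m r : ℕ}
    (hm : m = ∑ i : Fin s, (μ 4 + blocks s σ (dropBits (s * w) β) i) * L ^ (i : ℕ))
    (hr : r = ∑ i : Fin s, (blocks s w β i + blocks 1 w (dropBits (s * w + s * σ) β) 0 +
      blocks s w (dropBits (s * w + s * σ + 1 * w) β) i) * L ^ (i : ℕ)) :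
    (∀ r, r < 5 + coins₂ w σ s + 6 → ν r = μ r) ∧
    ν (5 + coins₂ w σ s + 6) = encNat N h (m % N) r ∧
    ν (5 + coins₂ w σ s + 7) = encNat N h (m % N) r ^
      (((μ 3 % N + (N - μ 2 % N)) % N + 1) % N) % N ^ 2 := by
  have hLK : s * L.size ≤ K := by omega
  have hr' : r < 2 ^ K := by
    rw [hr]
    exact (sum_exponents_lt hL hn (fun i => bitsVal_lt _ _ _) (bitsVal_lt _ _ _)
      fun i => bitsVal_lt _ _ _).trans_le (Nat.pow_le_pow_right (by norm_num) hK)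
  rw [← plainTerms_sum hβ] at hm
  rw [← exponentTerms_sum hβ] at hr
  have o₁ := plainTerms_ok (w := w) hσ hLK p.K_pos
  have o₂ := exponentTerms_ok (σ := σ) hw hLK p.K_pos
  simp only [simCode₂, execCode_append] at hν
  generalize plainTerms w σ L s = l₁ at *
  generalize exponentTerms w σ L s = l₂ at *
  generalize hA : 5 + coins₂ w σ s = A at *
  obtain ⟨f₁, v₁⟩ := sumCode_spec p (Or.inl rfl) (m := A) (by simp [moduli])
    (by rw [p.N_eq]; exact p.N_pos.ne') (l := l₁) fun q hq => ⟨(o₁ q hq).1, (o₁ q hq).2.1⟩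
  rw [← hm, p.N_eq] at v₁
  generalize execCode (sumCode A (A + 6) A l₁) μ = μ₁ at *
  have p₁ : Params A K N h μ₁ := p.frame fun r _ _ => f₁ r (by omega) (by omega) (by omega)
  obtain ⟨f₂, v₂⟩ := sumCode_spec p₁ (Or.inr rfl) (m := A + 5) (by simp [moduli])
    (by rw [p₁.pow_eq]; positivity) (l := l₂) fun q hq => ⟨(o₂ q hq).1, (o₂ q hq).2.1⟩
  have e₂ : (l₂.map fun q => q.1.val μ₁ * q.2).sum = r := by
    rw [hr]
    congr 1
    refine List.map_congr_left fun q hq => ?_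
    rw [Source.val_congr_input (o₂ q hq).2.1 fun r hr => f₁ r (by omega) (by omega) (by omega)]
  rw [e₂, p₁.pow_eq, Nat.mod_eq_of_lt hr'] at v₂
  generalize execCode (sumCode A (A + 7) (A + 5) l₂) μ₁ = μ₂ at *
  have f : ∀ r, r < A + 6 → μ₂ r = μ r := fun r hr => by
    rw [f₂ r (by omega) (by omega) (by omega), f₁ r (by omega) (by omega) (by omega)]
  have p₂ : Params A K N h μ₂ := p.frame fun r _ hr => f r hr
  obtain ⟨f₃, v₃, v₄⟩ := messageCode_spec p₂ (by omega) (by rw [v₂]; exact hr')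
  rw [hν] at f₃ v₃ v₄
  rw [v₂, f₂ (A + 6) (by omega) (by omega) (by omega), v₁] at v₃ v₄
  rw [f 3 (by omega), f 2 (by omega)] at v₄
  exact ⟨fun r hr => (f₃ r hr).trans (f r hr), v₃, v₄⟩

/-- The exponent of the packed ciphertext is not uniform, so the simulator does not sample it but
recomputes the weighted sum. The equality with an execution on zero plaintexts then holds for each
coin string. -/
lemma sim₂_run {κ n σ L δ s : ℕ} {t : ℕ × ℕ × ℕ × ℕ} (ht : t ∈ NGen κ n)
    (y : (ZMod (modulus t))ˣ) (a : Fin (2 ^ σ)) (η : ℤ) (hL : 2 ^ (σ + 2) ≤ L)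
    (hfit : Fits (keyGen t y a η).pk L s) (ω : Fin (coins₂ (4 * κ) σ s) → Bool) :
    (sim₂ κ n σ L s).run (keys₂ (keyGen t y a η) δ) ω =
      view₂ (keyGen t y a η) L δ
        (fun i => enc _ 0 (blocks s (4 * κ) (coinStream ω) i))
        (blocks s σ (dropBits (s * (4 * κ)) (coinStream ω)))
        (blocks 1 (4 * κ) (dropBits (s * (4 * κ) + s * σ) (coinStream ω)) 0)
        (blocks s (4 * κ) (dropBits (s * (4 * κ) + s * σ + 1 * (4 * κ)) (coinStream ω)))
        (blocks s (4 * κ) (dropBits (s * (4 * κ) + s * σ + 1 * (4 * κ) + s * (4 * κ))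
          (coinStream ω))) := by
  have hL1 : 1 < L := lt_of_lt_of_le (Nat.one_lt_two_pow (by omega)) hL
  have hN : 1 < (pubKey t y).N := one_lt_modulus ht
  have hNn : (pubKey t y).N < 2 ^ (4 * κ + n + 3) :=
    (Nat.size_le.mp (modulus_size_le ht)).trans_le (Nat.pow_le_pow_right (by norm_num) (by omega))
  have hsn : s * L.size ≤ n := mul_size_le_of_fits ht (by omega) hfit
  have hσn : 0 < s → σ ≤ 4 * κ + n + 3 := fun hs => by
    have h1 := Nat.size_le_size hL
    rw [Nat.size_pow] at h1
    have := Nat.le_mul_of_pos_left L.size hs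
    omega
  set A := 5 + coins₂ (4 * κ) σ s with hA
  set μ₀ := (sim₂ κ n σ L s).init (keys₂ (keyGen t y a η) δ) ω with hμ₀
  have i0 : μ₀ 0 = (pubKey t y).N := init_apply_lt (P := sim₂ κ n σ L s) (by simp [keys₂])
  have i1 : μ₀ 1 = (pubKey t y).h.val := init_apply_lt (P := sim₂ κ n σ L s) (by simp [keys₂])
  have i2 : μ₀ 2 = (keyGen t y a η).sk₂.toNat :=
    init_apply_lt (P := sim₂ κ n σ L s) (by simp [keys₂])
  have i3 : μ₀ 3 = (-(keyGen t y a η).sk₂).toNat :=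
    init_apply_lt (P := sim₂ κ n σ L s) (by simp [keys₂])
  have i4 : μ₀ 4 = δ := init_apply_lt (P := sim₂ κ n σ L s) (by simp [keys₂])
  have p := params_initCode (A := A) (K := 4 * κ + n + 3) (by omega)
    (by omega) (μ := μ₀) (by omega) (by omega)
  have lo := (initCode_spec (A := A) (K := 4 * κ + n + 3) (by omega) μ₀).2.2.2.2.2.2
  have hβ₀ : ∀ j, j < coins₂ (4 * κ) σ s → μ₀ (5 + j) = coinStream ω j := fun j _ =>
    init_apply_add (P := sim₂ κ n σ L s) (w := keys₂ (keyGen t y a η) δ) (ω := ω) j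
  obtain ⟨μ, hμ⟩ : ∃ μ, execCode (initCode A (4 * κ + n + 3)) μ₀ = μ := ⟨_, rfl⟩
  rw [i0, i1, hμ] at p
  rw [hμ] at lo
  have hβ : ∀ j, j < coins₂ (4 * κ) σ s → μ (5 + j) = coinStream ω j := fun j hj => by
    rw [lo _ (by omega), hβ₀ j hj]
  obtain ⟨ν, hν⟩ : ∃ ν, execCode (simCode₂ A (4 * κ + n + 3) (4 * κ) σ L s) μ = ν := ⟨_, rfl⟩
  obtain ⟨f, v₁, v₂⟩ := simCode₂_spec (n := n) p (by omega) hσn le_rfl hL1 hsn hβ hν rfl rfl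
  rw [← hA] at f v₁ v₂
  have q : Params A (4 * κ + n + 3) (pubKey t y).N (pubKey t y).h.val ν :=
    p.frame fun r _ h2 => f r h2
  rw [lo 3 (by omega), lo 2 (by omega), i2, i3] at v₂
  rw [lo 4 (by omega), i4] at v₁ v₂
  refine (listProg_run (coins := coins₂ (4 * κ) σ s) (by rw [← hν, ← hμ, hμ₀]; rfl) q
    (simItems₂_ok (by omega))).trans ?_
  have hτ : ∀ i : Fin s, (bitsAt 5 (s * (4 * κ) + s * σ + 1 * (4 * κ) + s * (4 * κ)) (4 * κ) i).val ν =
      blocks s (4 * κ) (dropBits (s * (4 * κ) + s * σ + 1 * (4 * κ) + s * (4 * κ))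
        (coinStream ω)) i := fun i =>
    bitsAt_val (c := coins₂ (4 * κ) σ s) (fun j hj => by rw [f _ (by omega), hβ j hj])
      (by simp only [coins₂]; omega) i
  simp only [simItems₂, List.map_append, List.map_cons, List.map_nil, List.map_ofFn,
    Function.comp_def, Item.val, hτ]
  rw [view₂, pack_enc]
  simp only [Source.val]
  set S₁ := ∑ i : Fin s, (δ + blocks s σ (dropBits (s * (4 * κ)) (coinStream ω)) i) * L ^ (i : ℕ)
    with hS₁
  have hplain : (∑ i : Fin s, ((0 : ℤ) + δ + (blocks s σ (dropBits (s * (4 * κ)) (coinStream ω)) i :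
      ℕ)) * (L : ℤ) ^ (i : ℕ)) = S₁ := by
    rw [hS₁]
    push_cast
    simp only [zero_add]
  rw [hplain]
  set S₂ := ∑ i : Fin s, (blocks s (4 * κ) (coinStream ω) i +
    blocks 1 (4 * κ) (dropBits (s * (4 * κ) + s * σ) (coinStream ω)) 0 +
    blocks s (4 * κ) (dropBits (s * (4 * κ) + s * σ + 1 * (4 * κ)) (coinStream ω)) i) *
      L ^ (i : ℕ) with hS₂
  have hC : encNat (pubKey t y).N (pubKey t y).h.val (S₁ % (pubKey t y).N) S₂ =
      (enc (pubKey t y) S₁ S₂).val := by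
    rw [enc_val]
    norm_cast
  have hpow : enc (pubKey t y) S₁ S₂ ^ ((((-(keyGen t y a η).sk₂).toNat % (pubKey t y).N +
      ((pubKey t y).N - (keyGen t y a η).sk₂.toNat % (pubKey t y).N)) % (pubKey t y).N + 1) %
        (pubKey t y).N) = enc (pubKey t y) S₁ S₂ ^ (a : ℕ) := by
    -- Without values the ciphertext is 1, and the exponent does not matter. Otherwise sk₁ < 2^σ ≤
    -- L/4 and L ≤ L^s < 2N, so sk₁ is below N and equals the recovered residue.
    rcases Nat.eq_zero_or_pos s with rfl | hs
    · have h1 : S₁ = 0 := by simp [hS₁]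
      have h2 : S₂ = 0 := by simp [hS₂]
      rw [h1, h2, Nat.cast_zero, enc_zero_zero, one_pow, one_pow]
    · have h1 := pow_mul_le_of_fits (by omega) hs hfit
      have h2 : L ≤ L ^ s := Nat.le_self_pow hs.ne' L
      have h3 : (a : ℕ) < (pubKey t y).N := by
        have h4 := a.2
        rw [pow_add] at hL
        change L ^ s < 2 * (pubKey t y).N at h1
        omega
      exact congrArg (enc (pubKey t y) S₁ S₂ ^ ·)
        (recover_sk₁ (N := (pubKey t y).N) (keyGen_sum_cast ht y a η) h3)
  rw [hC] at v₁ v₂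
  rw [val_pow_mod, hpow] at v₂
  rw [v₁, v₂]
  have hpd : pdec (keyGen t y a η).pk ((keyGen t y a η).sk₁ : ℤ) (enc (keyGen t y a η).pk S₁ S₂) =
      enc (pubKey t y) S₁ S₂ ^ (a : ℕ) := by
    rw [pdec, intPow, if_pos (Int.natCast_nonneg _), Int.toNat_natCast]
    rfl
  rw [hpd]
  rfl

lemma ideal₂_eq {κ n σ L δ s : ℕ} (η : ℕ × ℕ × ℕ × ℕ → ℕ → ℤ) (hL : 2 ^ (σ + 2) ≤ L) (D : Prog) :
    ideal₂ κ n σ η L δ s (sim₂ κ n σ L s) D = real₂ κ n σ η L δ (fun _ : Fin s => 0) D := by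
  rw [ideal₂, real₂, expKeys, expKeys]
  refine Finset.expect_congr rfl fun t ht => Finset.expect_congr rfl fun y _ =>
    Finset.expect_congr rfl fun a _ => ?_
  split_ifs with hfit
  swap
  · rfl
  rw [← expect_coins₂ (4 * κ) σ s fun X₁ X₂ X₃ X₄ X₅ => D.acceptProb
    (keys₂ (keyGen t y a (η t a)) δ ++ view₂ (keyGen t y a (η t a)) L δ
      (fun i => enc _ 0 (X₁ i)) X₂ X₃ X₄ X₅)]
  refine Finset.expect_congr rfl fun ω _ => ?_
  rw [sim₂_run ht y a (η t a) hL hfit ω]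

/-! ### Statistical masking -/

/-- S₂ sees only the packed ciphertext, its power and its own coins. With the exponents fixed these
are functions of the sums x_i + r_i, so a hybrid over the s coordinates, each step a shift by x_i,
gives the bound. -/
lemma abs_view₂_sub_le {κ σ ℓ L δ s : ℕ} (K : Keys) [NeZero K.pk.N] {x : Fin s → ℤ}
    (hx : ∀ i, |x i| ≤ 2 ^ ℓ) (D : Prog) (ρx : Fin s → ℕ) :
    |(𝔼 r : Fin s → Fin (2 ^ σ), 𝔼 ρδ : EncCoin κ, 𝔼 ρr : Fin s → EncCoin κ,
        𝔼 τ : Fin s → EncCoin κ, D.acceptProb (keys₂ K δ ++ view₂ K L δ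
          (fun i => enc K.pk (x i) (ρx i)) (fun i => r i) ρδ (fun i => ρr i) (fun i => τ i))) -
      𝔼 r : Fin s → Fin (2 ^ σ), 𝔼 ρδ : EncCoin κ, 𝔼 ρr : Fin s → EncCoin κ,
        𝔼 τ : Fin s → EncCoin κ, D.acceptProb (keys₂ K δ ++ view₂ K L δ
          (fun i => enc K.pk 0 (ρx i)) (fun i => r i) ρδ (fun i => ρr i) (fun i => τ i))| ≤
      s * (2 ^ ℓ / 2 ^ σ) := by
  let C : (Fin s → ℤ) → EncCoin κ → (Fin s → EncCoin κ) → Cipher K.pk := fun u ρδ ρr =>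
    enc K.pk (∑ i : Fin s, (u i + δ) * (L : ℤ) ^ (i : ℕ))
      (∑ i : Fin s, (ρx i + ρδ + ρr i) * L ^ (i : ℕ))
  let f : (Fin s → ℤ) → ℝ := fun u => 𝔼 ρδ : EncCoin κ, 𝔼 ρr : Fin s → EncCoin κ,
    𝔼 τ : Fin s → EncCoin κ, D.acceptProb (keys₂ K δ ++ ([(C u ρδ ρr).val,
      (pdec K.pk K.sk₁ (C u ρδ ρr)).val] ++ List.ofFn fun i => (τ i : ℕ)))
  have hf0 : ∀ u, 0 ≤ f u := fun u => Finset.expect_nonneg fun _ _ => Finset.expect_nonneg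
    fun _ _ => Finset.expect_nonneg fun _ _ => acceptProb_nonneg _ _
  have hf1 : ∀ u, f u ≤ 1 := fun u => Finset.expect_le Finset.univ_nonempty fun _ _ =>
    Finset.expect_le Finset.univ_nonempty fun _ _ =>
    Finset.expect_le Finset.univ_nonempty fun _ _ => acceptProb_le_one _ _
  let g : Bool → Fin s → Fin (2 ^ σ) → ℤ := fun b i a => if b then a else x i + a
  have hview : ∀ (z : Fin s → ℤ) (r : Fin s → Fin (2 ^ σ)), (𝔼 ρδ : EncCoin κ,
      𝔼 ρr : Fin s → EncCoin κ, 𝔼 τ : Fin s → EncCoin κ, D.acceptProb (keys₂ K δ ++ view₂ K L δ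
        (fun i => enc K.pk (z i) (ρx i)) (fun i => r i) ρδ (fun i => ρr i) (fun i => τ i))) =
      f fun i => z i + r i := by
    intro z r
    have hplain : ∑ i : Fin s, (z i + δ + (r i : ℕ)) * (L : ℤ) ^ (i : ℕ) =
        ∑ i : Fin s, (z i + (r i : ℕ) + δ) * (L : ℤ) ^ (i : ℕ) :=
      Finset.sum_congr rfl fun i _ => by ring
    simp only [view₂, pack_enc, hplain, f, C]
  have h := hybrid g f (ε := 2 ^ ℓ / 2 ^ σ) fun i b a => by
    have h1 := abs_expect_shift_sub_le (R := 2 ^ σ) (by positivity) (x i)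
      (f := fun z => f (Function.update (fun j => g (b j) j (a j)) i z)) (fun _ => hf0 _)
      fun _ => hf1 _
    refine h1.trans ?_
    have h2 : |(x i : ℝ)| ≤ 2 ^ ℓ := by exact_mod_cast hx i
    push_cast
    gcongr
  rw [Fintype.card_fin] at h
  have e1 := fun r => hview x r
  have e2 := fun r => hview (fun _ => 0) r
  simp only [e1, e2, zero_add]
  exact h

lemma abs_real₂_sub_le {κ n σ ℓ L δ s : ℕ} (η : ℕ × ℕ × ℕ × ℕ → ℕ → ℤ) {x : Fin s → ℤ}
    (hx : ∀ i, |x i| ≤ 2 ^ ℓ) (D : Prog) :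
    |real₂ κ n σ η L δ x D - real₂ κ n σ η L δ (fun _ : Fin s => 0) D| ≤
      s * (2 ^ ℓ / 2 ^ σ) := by
  have h0 : (0 : ℝ) ≤ s * (2 ^ ℓ / 2 ^ σ) := by positivity
  refine abs_expect_sub_le h0 fun t _ => abs_expect_sub_le h0 fun y _ =>
    abs_expect_sub_le h0 fun a _ => ?_
  beta_reduce
  split_ifs
  · exact abs_expect_sub_le h0 fun ρx _ => abs_view₂_sub_le _ hx D fun i => ρx i
  · simpa using h0

/-! ### Conclusion for the second server. -/

theorem privateAgainstS₂ (n σ ℓ L s : ℕ → ℕ) (η : ℕ → ℕ × ℕ × ℕ × ℕ → ℕ → ℤ)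
    (hn : PolyBounded n) (hneg : Negligible fun κ => (2 : ℝ) ^ ℓ κ / 2 ^ σ κ)
    (hL : ∀ κ, 2 ^ (σ κ + 2) ≤ L κ) : PrivateAgainstS₂ n σ ℓ L s η := by
  have cst := polyBounded_const
  have hL0 : ∀ κ, 0 < L κ := fun κ => lt_of_lt_of_le (by positivity) (hL κ)
  -- As for the first server, parameters for which no key fits are replaced by s = 0, where the
  -- simulator is trivially small.
  let s' : ℕ → ℕ := fun κ => if s κ * (L κ).size ≤ n κ then s κ else 0
  have hs' : ∀ κ, s' κ ≤ n κ ∧ s' κ * (L κ).size ≤ n κ ∧ s' κ * σ κ ≤ n κ ∧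
      (0 < s' κ → σ κ ≤ n κ) := by
    intro κ
    simp only [s']
    split_ifs with h
    · have h1 := Nat.size_le_size (hL κ)
      rw [Nat.size_pow] at h1
      refine ⟨(Nat.le_mul_of_pos_right _ (by omega)).trans h, h,
        (Nat.mul_le_mul_left _ (by omega)).trans h, fun hs => ?_⟩
      exact le_trans (by omega) ((Nat.le_mul_of_pos_left _ hs).trans h)
    · simp
  refine ⟨fun κ => sim₂ κ (n κ) (σ κ) (L κ) (s' κ), ?_, fun δ x hx D hD => ?_⟩
  · refine isPPT_listProg (p := fun κ => 4 * (n κ * (4 * κ)) + n κ + 4 * κ +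
      (31 + 36 * (4 * κ + n κ + 3) + 5 * n κ * (7 + 7 * (4 * κ + n κ + 3)))) ?_ fun κ => ?_
    · have h4 := (cst 4).mul polyBounded_id
      have hK := (h4.add hn).add (cst 3)
      exact ((((cst 4).mul (hn.mul h4)).add hn).add h4).add
        (((cst 31).add ((cst 36).mul hK)).add
          (((cst 5).mul hn).mul ((cst 7).add ((cst 7).mul hK))))
    · obtain ⟨h1, h2, h3, h4⟩ := hs' κ
      refine ⟨_, _, _, 31 + 36 * (4 * κ + n κ + 3) + 5 * s' κ * (7 + 7 * (4 * κ + n κ + 3)), _, _,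
        rfl, by omega, safe_simCode₂ (by omega) (fun h => (h4 h).trans (by omega)) (by omega)
          (by omega), simItems₂_ok (by omega), ?_, by omega, ?_, ?_⟩
      · have h5 : s' κ * (4 * κ) ≤ n κ * (4 * κ) := Nat.mul_le_mul_right _ h1
        simp only [coins₂]
        omega
      · have h5 : 5 * s' κ * (7 + 7 * (4 * κ + n κ + 3)) ≤
            5 * n κ * (7 + 7 * (4 * κ + n κ + 3)) := by gcongr
        omega
      · simp only [simItems₂, List.length_append, List.length_ofFn, List.length_cons,
          List.length_nil]
        omega
  · refine (hneg.polyBounded_mul hn fun κ => by positivity).of_le (fun κ => abs_nonneg _)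
      fun κ => ?_
    by_cases h : s κ * (L κ).size ≤ n κ
    · have hs : s' κ = s κ := if_pos h
      have hsn : (s κ : ℝ) ≤ n κ := by exact_mod_cast hs ▸ (hs' κ).1
      simp only [hs]
      rw [ideal₂_eq (η κ) (hL κ)]
      refine (abs_real₂_sub_le (η κ) (fun i => ?_) (D κ)).trans
        (mul_le_mul_of_nonneg_right hsn (by positivity))
      exact abs_le.mpr ⟨((hx κ).2 i).1, ((hx κ).2 i).2.1⟩
    · rw [real₂, ideal₂, expKeys_eq_zero (hL0 κ) (by omega), expKeys_eq_zero (hL0 κ) (by omega),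
        sub_self, abs_zero]
      positivity

end BatchSquare

theorem corollary2 (n σ ℓ L s : ℕ → ℕ) (η : ℕ → ℕ × ℕ × ℕ × ℕ → ℕ → ℤ)
    (hn : BatchSquare.PolyBounded n)
    (hσ : ∀ κ, ℓ κ < σ κ)
    (hneg : BatchSquare.Negligible fun κ => (2 : ℝ) ^ ℓ κ / 2 ^ σ κ)
    (hL : ∀ κ, 2 ^ (σ κ + 2) ≤ L κ) :
    BatchSquare.Correct n σ ℓ L ∧
    (BatchSquare.SemanticallySecure n → BatchSquare.PrivateAgainstS₁ n σ ℓ L s η) ∧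
    BatchSquare.PrivateAgainstS₂ n σ ℓ L s η :=
  ⟨BatchSquare.correct n σ ℓ L hσ hL, BatchSquare.privateAgainstS₁ n σ ℓ L s η hn hσ hL,
    BatchSquare.privateAgainstS₂ n σ ℓ L s η hn hneg hL⟩
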